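/- **Setting.** Let $N\ge 1$, let $\Omega\subset\mathbb R^N$ be a bounded domain (a non-empty bounded connected open set), and let $A=(A_{ij})$ be a real symmetric matrix of functions $A_{ij}\in L^\infty(\mathbb R^N)$ with $\theta^{-1}|\xi|^2\le\sum_{i,j}A_{ij}(x)\xi_i\xi_j\le\theta|\xi|^2$ for all $x,\xi\in\mathbb R^N$ and some $\theta\ge 1$. Let $\phi,\tilde\phi$ be homeomorphisms of $\Omega$ onto domains $\phi(\Omega),\tilde\phi(\Omega)\subset\mathbb R^N$ such that $\phi,\tilde\phi$ and their inverses are Lipschitz continuous. Fix Dirichlet or Neumann boundary conditions, the same for both domains: for an open set $U$ let $\mathcal W(U)=W^{1,2}_0(U)$ (Dirichlet) or $\mathcal W(U)=W^{1,2}(U)$ (Neumann); functions are complex-valued. Put $$g=|\det\nabla\phi|,\quad \tilde g=|\det\nabla\tilde\phi|,\quad w=g^{1/2}\tilde g^{-1/2},\quad a=(\nabla\phi)^{-1}A(\phi)(\nabla\phi)^{-t},\quad \tilde a=(\nabla\tilde\phi)^{-1}A(\tilde\phi)(\nabla\tilde\phi)^{-t},\quad S=w^{-2}a^{-1/2}\tilde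 a\,a^{-1/2}.$$ Consider the following non-negative self-adjoint operators associated with quadratic forms: * $L$ in $L^2(\phi(\Omega))$, with form $\int_{\phi(\Omega)}A\nabla v\cdot\nabla\bar v\,dy$, $v\in\mathcal W(\phi(\Omega))$; and $\tilde L$ in $L^2(\tilde\phi(\Omega))$, defined in the same way from $\tilde\phi$; * $H$ in $L^2(\Omega,g\,dx)$, with form $\int_\Omega (a\nabla u\cdot\nabla\bar u)\,g\,dx$, $u\in\{v\circ\phi: v\in\mathcal W(\phi(\Omega))\}$; and $\tilde H$ in $L^2(\Omega,\tilde g\,dx)$, defined in the same way from $\tilde\phi$; * $T^*ST$ in $L^2(\Omega,g\,dx)$, with form $\int_\Omega(\tilde a\nabla u\cdot\nabla\bar u)\,\tilde g\,dx$, $u\in\{v\circ\phi: v\in\mathcal W(\phi(\Omega))\}$; * $w^{-1}\tilde Hw$ in $L^2(\Omega,g\,dx)$, where $w$ denotes multiplication by $w$, a unitary map $L^2(\Omega,g\,dx)\to L^2(\Omega,\tilde g\,dx)$. For such an operator $E$ with compact resolvent, $\lambda_1[E]\le\lambda_2[E]\le\dots$ are its eigenvalues repeated according to multiplicity. Suppose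 that $L$, $\tilde L$ and $T^*ST$ have compact resolvents and that, for some constants $\alpha,C_1>0$, $$\lambda_n[E]\ge C_1n^{1/\alpha}\quad\text{for all } n\ge 1 \text{ with } \lambda_n[E]\ne 0,\qquad E\in\{L,\tilde L,T^*ST\}.$$ Let $q_0\in\,]2,\infty]$ and $\gamma,C_2\in\,]0,\infty[$. An operator $E$ in $L^2(\Omega,g\,dx)$ has property (P1) if, for some orthonormal sequence $\psi_n$ of eigenfunctions belonging to $\lambda_n[E]$, $\|\psi_n\|_{L^{q_0}(\Omega,g\,dx)}\le C_2\lambda_n[E]^{\gamma}$ for all $n$ with $\lambda_n[E]\neq0$; it has property (P2) if, for some such sequence, $\|\nabla\psi_n\|_{L^{q_0}(\Omega,g\,dx)}\le C_2\lambda_n[E]^{\frac12+\gamma}$ for all $n$. For $0<q\le\infty$ let $$\begin{aligned}\delta_q(\phi,\tilde\phi)={}&\|w-1\|_{L^q(\Omega,g\,dx)}+\|w^{-1}-1\|_{L^q(\Omega,g\,dx)}\\&+\|(S^{1/2}-S^{-1/2})a^{1/2}\|_{L^q(\Omega,g\,dx)}+\|(S-I)a^{1/2}\|_{L^q(\Omega,g\,dx)},\end{aligned}$$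 where matrices are measured in the Euclidean operator norm. The exponents $\frac{2q_0}{q_0-2}$ and $\frac{q_0(\alpha+2\gamma)}{q_0-2}$ mean $2$ and $\alpha+2\gamma$ if $q_0=\infty$. Functions on $\phi(\Omega)$ and $\tilde\phi(\Omega)$ are extended by zero. **Theorem 3.3 (stability of eigenfunctions).** Assume that $H$ and $T^*ST$ satisfy (P1) and (P2) and that $w^{-1}\tilde Hw$ satisfies (P1), with the same $q_0,\gamma,C_2$. Let $\lambda$ be an eigenvalue of $L$ (resp. $\tilde L$) of multiplicity $m$, and let $n\ge 1$ be such that $\lambda=\lambda_n=\dots=\lambda_{n+m-1}$, where $\lambda_j=\lambda_j[L]$ (resp. $\lambda_j=\lambda_j[\tilde L]$). Then for any real $s>\frac{q_0(\alpha+2\gamma)}{q_0-2}$ there exists $c>0$, depending only on the type of boundary condition, $s$, $\alpha$, $q_0$, $\gamma$, $C_1$, $C_2$, $\lambda_{n-1}$ (if $n\ge 2$), $\lambda$, $\lambda_{n+m}$ and, in the case of Neumann boundary conditions, $\|g\|_{L^{q_0}(\Omega)}$, such that the following holds. If $$[1+\delta_s(\phi,\tilde\phi)]\,\delta_{\frac{2q_0}{q_0-2}}(\phi,\tilde\phi)\le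 c^{-1}$$ and $\psi_n[\tilde L],\dots,\psi_{n+m-1}[\tilde L]$ (resp. $\psi_n[L],\dots,\psi_{n+m-1}[L]$) are orthonormal eigenfunctions of $\tilde L$ in $L^2(\tilde\phi(\Omega))$ (resp. of $L$ in $L^2(\phi(\Omega))$), where $\psi_l[E]$ belongs to the eigenvalue $\lambda_l[E]$, then there exist orthonormal eigenfunctions $\psi_n[L],\dots,\psi_{n+m-1}[L]$ of $L$ in $L^2(\phi(\Omega))$ (resp. $\psi_n[\tilde L],\dots,\psi_{n+m-1}[\tilde L]$ of $\tilde L$ in $L^2(\tilde\phi(\Omega))$), $\psi_l[E]$ again belonging to $\lambda_l[E]$, such that for all $l=n,\dots,n+m-1$ $$\begin{aligned}\|\psi_l[L]-\psi_l[\tilde L]\|_{L^2(\phi(\Omega)\cup\tilde\phi(\Omega))}\le c\Big(&[1+\delta_s(\phi,\tilde\phi)]\,\delta_{\frac{2q_0}{q_0-2}}(\phi,\tilde\phi)\\&+\|g^{1/2}\psi_l[L]\circ\phi-\tilde g^{1/2}\psi_l[L]\circ\tilde\phi\|_{L^2(\Omega)}\\&+\|g^{1/2}\psi_l[\tilde L]\circ\phi-\tilde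 g^{1/2}\psi_l[\tilde L]\circ\tilde\phi\|_{L^2(\Omega)}\Big).\end{aligned}$$ -/

import Mathlib

open MeasureTheory Set
open scoped ENNReal NNReal ContDiff ComplexConjugate

noncomputable section

namespace SpectralStability

/-- Euclidean space `ℝ^N`. -/
abbrev E (N : ℕ) := EuclideanSpace ℝ (Fin N)

/-- `ℂ^N` with the Euclidean norm: the values of gradients of complex-valued functions. -/
abbrev CVec (N : ℕ) := EuclideanSpace ℂ (Fin N)

variable {N : ℕ}

/-! ### Sobolev spaces

An element of a Sobolev space is recorded as a pair `(u, F)`, where `F` is a weak gradient of `u`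
(which is determined almost everywhere by `u`). -/

/-- The `i`-th vector of the standard basis of `ℝ^N`. -/
def stdVec (i : Fin N) : E N := EuclideanSpace.single i 1

/-- `F` is a weak gradient of the locally integrable function `u` in the open set `U`:
`∫ u ∂ᵢη = - ∫ Fᵢ η` for every test function `η ∈ C_c^∞(U)`. -/
def IsWeakGradient (U : Set (E N)) (u : E N → ℂ) (F : E N → CVec N) : Prop :=
  LocallyIntegrableOn u U ∧ (∀ i, LocallyIntegrableOn (fun x => F x i) U) ∧
    ∀ η : E N → ℝ, ContDiff ℝ ∞ η → HasCompactSupport η → tsupport η ⊆ U →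
      ∀ i, ∫ x in U, fderiv ℝ η x (stdVec i) • u x = - ∫ x in U, η x • F x i

/-- A locally integrable function times a continuous function with compact support in `U`. -/
theorem integrable_test_smul {U : Set (E N)} {u : E N → ℂ} (hu : LocallyIntegrableOn u U)
    {ζ : E N → ℝ} (hc : Continuous ζ) (hK : HasCompactSupport ζ) (hs : tsupport ζ ⊆ U) :
    Integrable (fun x => ζ x • u x) (volume.restrict U) := by
  have h1 : IntegrableOn u (tsupport ζ) := hu.integrableOn_compact_subset hs hK
  have h2 : IntegrableOn (fun x => ζ x • u x) (tsupport ζ) :=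
    h1.continuousOn_smul hc.continuousOn hK
  have h3 : Integrable (fun x => ζ x • u x) := by
    refine (integrableOn_iff_integrable_of_support_subset ?_).1 h2
    intro x hx
    apply subset_tsupport
    intro h0
    exact hx (by simp [h0])
  exact h3.restrict

theorem continuous_partial {η : E N → ℝ} (h : ContDiff ℝ ∞ η) (v : E N) :
    Continuous (fun x => fderiv ℝ η x v) :=
  (h.continuous_fderiv (by simp)).clm_apply continuous_const

theorem tsupport_partial (η : E N → ℝ) (v : E N) :
    tsupport (fun x => fderiv ℝ η x v) ⊆ tsupport η :=
  tsupport_fderiv_apply_subset ℝ v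

theorem IsWeakGradient.zero (U : Set (E N)) : IsWeakGradient U 0 (0 : E N → CVec N) := by
  refine ⟨?_, fun i => ?_, ?_⟩
  · exact (locallyIntegrable_zero).locallyIntegrableOn U
  · exact (locallyIntegrable_zero).locallyIntegrableOn U
  · intro η _ _ _ i
    simp

theorem IsWeakGradient.add {U : Set (E N)} {u v : E N → ℂ} {F G : E N → CVec N}
    (hu : IsWeakGradient U u F) (hv : IsWeakGradient U v G) :
    IsWeakGradient U (u + v) (F + G) := by
  refine ⟨hu.1.add hv.1, fun i => (hu.2.1 i).add (hv.2.1 i), ?_⟩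
  intro η h1 h2 h3 i
  have hc := continuous_partial h1 (stdVec i)
  have hs := tsupport_partial η (stdVec i)
  have hK : HasCompactSupport (fun x => fderiv ℝ η x (stdVec i)) :=
    h2.of_isClosed_subset (isClosed_tsupport _) hs
  have e1 := hu.2.2 η h1 h2 h3 i
  have e2 := hv.2.2 η h1 h2 h3 i
  simp only [Pi.add_apply, PiLp.add_apply, smul_add]
  rw [integral_add (integrable_test_smul hu.1 hc hK (hs.trans h3))
      (integrable_test_smul hv.1 hc hK (hs.trans h3)),
    integral_add (integrable_test_smul (hu.2.1 i) h1.continuous h2 h3)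
      (integrable_test_smul (hv.2.1 i) h1.continuous h2 h3), e1, e2]
  ring

theorem IsWeakGradient.smul {U : Set (E N)} {u : E N → ℂ} {F : E N → CVec N} (k : ℂ)
    (hu : IsWeakGradient U u F) : IsWeakGradient U (k • u) (k • F) := by
  refine ⟨hu.1.smul k, fun i => (hu.2.1 i).smul k, ?_⟩
  intro η h1 h2 h3 i
  have e1 := hu.2.2 η h1 h2 h3 i
  simp only [Pi.smul_apply, PiLp.smul_apply, smul_comm _ k]
  rw [integral_smul, integral_smul, e1, smul_neg]

/-- The Sobolev space `W^{1,2}(U)` of complex-valued functions, as pairs `(u, ∇u)`. -/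
def sobolev (U : Set (E N)) : Submodule ℂ ((E N → ℂ) × (E N → CVec N)) where
  carrier := {p | MemLp p.1 2 (volume.restrict U) ∧ MemLp p.2 2 (volume.restrict U) ∧
    IsWeakGradient U p.1 p.2}
  zero_mem' := ⟨MemLp.zero', MemLp.zero', IsWeakGradient.zero U⟩
  add_mem' := fun hp hq => ⟨hp.1.add hq.1, hp.2.1.add hq.2.1, hp.2.2.add hq.2.2⟩
  smul_mem' := fun k _ hp => ⟨hp.1.const_smul k, hp.2.1.const_smul k, hp.2.2.smul k⟩

/-- The classical gradient. -/
def classicalGrad (η : E N → ℂ) (x : E N) : CVec N :=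
  WithLp.toLp 2 fun i => fderiv ℝ η x (stdVec i)

/-- `C^∞` functions with compact support contained in `U`. -/
def IsTestFunction (U : Set (E N)) (η : E N → ℂ) : Prop :=
  ContDiff ℝ ∞ η ∧ HasCompactSupport η ∧ tsupport η ⊆ U

theorem classicalGrad_add {η ζ : E N → ℂ} (h : ContDiff ℝ ∞ η) (k : ContDiff ℝ ∞ ζ) :
    classicalGrad (η + ζ) = classicalGrad η + classicalGrad ζ := by
  funext x
  ext i
  have h1 : DifferentiableAt ℝ η x := (h.differentiable (by simp)) x
  have h2 : DifferentiableAt ℝ ζ x := (k.differentiable (by simp)) x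
  simp [classicalGrad, fderiv_add h1 h2]

theorem classicalGrad_smul {η : E N → ℂ} (h : ContDiff ℝ ∞ η) (k : ℂ) :
    classicalGrad (k • η) = k • classicalGrad η := by
  funext x
  ext i
  have h1 : DifferentiableAt ℝ η x := (h.differentiable (by simp)) x
  simp [classicalGrad, fderiv_const_smul h1 k]

theorem classicalGrad_zero : classicalGrad (0 : E N → ℂ) = 0 := by
  have := classicalGrad_smul (N := N) (η := 0) contDiff_const 0
  simpa using this

theorem continuous_classicalGrad {η : E N → ℂ} (h : ContDiff ℝ ∞ η) :
    Continuous (classicalGrad η) := by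
  unfold classicalGrad
  refine (PiLp.continuous_toLp 2 _).comp (continuous_pi fun i => ?_)
  exact (h.continuous_fderiv (by simp)).clm_apply continuous_const

theorem IsTestFunction.add {U : Set (E N)} {η ζ : E N → ℂ} (h : IsTestFunction U η)
    (k : IsTestFunction U ζ) : IsTestFunction U (η + ζ) :=
  ⟨h.1.add k.1, h.2.1.add k.2.1,
    (tsupport_add (f := η) (g := ζ)).trans (union_subset h.2.2 k.2.2)⟩

theorem IsTestFunction.smul {U : Set (E N)} {η : E N → ℂ} (h : IsTestFunction U η) (k : ℂ) :
    IsTestFunction U (k • η) :=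
  ⟨h.1.const_smul k, h.2.1.smul_left (f := fun _ => k),
    (tsupport_smul_subset_right (fun _ => k) η).trans h.2.2⟩

theorem tendsto_eLpNorm_add {α V : Type*} [MeasurableSpace α] [NormedAddCommGroup V]
    {μ : Measure α} {f g : α → V} {a b : ℕ → α → V}
    (hf : AEStronglyMeasurable f μ) (hg : AEStronglyMeasurable g μ)
    (ha : ∀ k, AEStronglyMeasurable (a k) μ) (hb : ∀ k, AEStronglyMeasurable (b k) μ)
    (h1 : Filter.Tendsto (fun k => eLpNorm (f - a k) 2 μ) Filter.atTop (nhds 0))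
    (h2 : Filter.Tendsto (fun k => eLpNorm (g - b k) 2 μ) Filter.atTop (nhds 0)) :
    Filter.Tendsto (fun k => eLpNorm (f + g - (a k + b k)) 2 μ) Filter.atTop (nhds 0) := by
  have h3 := h1.add h2
  rw [add_zero] at h3
  refine tendsto_of_tendsto_of_tendsto_of_le_of_le tendsto_const_nhds h3
    (fun _ => zero_le) (fun k => ?_)
  dsimp only
  rw [add_sub_add_comm]
  exact eLpNorm_add_le (hf.sub (ha k)) (hg.sub (hb k)) (by norm_num)

theorem tendsto_eLpNorm_smul {α V : Type*} [MeasurableSpace α] [NormedAddCommGroup V]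
    [NormedSpace ℂ V] {μ : Measure α} {f : α → V} {a : ℕ → α → V} (k : ℂ)
    (h1 : Filter.Tendsto (fun j => eLpNorm (f - a j) 2 μ) Filter.atTop (nhds 0)) :
    Filter.Tendsto (fun j => eLpNorm (k • f - k • a j) 2 μ) Filter.atTop (nhds 0) := by
  have h3 := ENNReal.Tendsto.const_mul (a := ‖k‖ₑ) h1 (Or.inr (by simp))
  rw [mul_zero] at h3
  refine h3.congr fun j => ?_
  rw [← smul_sub, eLpNorm_const_smul]

/-- `W_0^{1,2}(U)`: the closure of `C_c^∞(U)` in `W^{1,2}(U)`. -/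
def sobolevZero (U : Set (E N)) : Submodule ℂ ((E N → ℂ) × (E N → CVec N)) where
  carrier := {p | p ∈ sobolev U ∧ ∃ η : ℕ → E N → ℂ, (∀ k, IsTestFunction U (η k)) ∧
    Filter.Tendsto (fun k => eLpNorm (p.1 - η k) 2 (volume.restrict U)) Filter.atTop (nhds 0) ∧
    Filter.Tendsto (fun k => eLpNorm (p.2 - classicalGrad (η k)) 2 (volume.restrict U))
      Filter.atTop (nhds 0)}
  zero_mem' := by
    refine ⟨zero_mem _, fun _ => 0, fun _ => ⟨contDiff_const, HasCompactSupport.zero, ?_⟩, ?_, ?_⟩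
    · simp [tsupport]
    · simp
    · simp [classicalGrad_zero]
  add_mem' := by
    rintro p q ⟨hp, a, ha, ha1, ha2⟩ ⟨hq, b, hb, hb1, hb2⟩
    refine ⟨add_mem hp hq, fun k => a k + b k, fun k => (ha k).add (hb k), ?_, ?_⟩
    · exact tendsto_eLpNorm_add hp.1.1 hq.1.1 (fun k => (ha k).1.continuous.aestronglyMeasurable)
        (fun k => (hb k).1.continuous.aestronglyMeasurable) ha1 hb1
    · have := tendsto_eLpNorm_add hp.2.1.1 hq.2.1.1
        (fun k => (continuous_classicalGrad (ha k).1).aestronglyMeasurable)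
        (fun k => (continuous_classicalGrad (hb k).1).aestronglyMeasurable) ha2 hb2
      refine this.congr fun k => ?_
      rw [classicalGrad_add (ha k).1 (hb k).1]
      rfl
  smul_mem' := by
    rintro k p ⟨hp, a, ha, ha1, ha2⟩
    refine ⟨Submodule.smul_mem _ k hp, fun j => k • a j, fun j => (ha j).smul k, ?_, ?_⟩
    · exact tendsto_eLpNorm_smul k ha1
    · refine (tendsto_eLpNorm_smul k ha2).congr fun j => ?_
      rw [classicalGrad_smul (ha j).1]
      rfl

/-- The two boundary conditions. -/
inductive BoundaryCondition
  | dirichlet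
  | neumann

/-- The form domain: `W_0^{1,2}(U)` for Dirichlet and `W^{1,2}(U)` for Neumann conditions. -/
def formDomain (bc : BoundaryCondition) (U : Set (E N)) :
    Submodule ℂ ((E N → ℂ) × (E N → CVec N)) :=
  match bc with
  | .dirichlet => sobolevZero U
  | .neumann => sobolev U

/-- The pulled-back form domain `C_φ[𝒲] = {v ∘ φ : v ∈ 𝒲}`, where `𝒲` is the form domain on
`φ(Ω)`; each function is recorded with a weak gradient in `Ω`. -/
def pullbackDomain (bc : BoundaryCondition) (Ω : Set (E N)) (φ : E N → E N) :
    Submodule ℂ ((E N → ℂ) × (E N → CVec N)) where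
  carrier := {p | IsWeakGradient Ω p.1 p.2 ∧
    ∃ q ∈ formDomain bc (φ '' Ω), p.1 =ᵐ[volume.restrict Ω] q.1 ∘ φ}
  zero_mem' := ⟨IsWeakGradient.zero Ω, 0, zero_mem _, Filter.EventuallyEq.rfl⟩
  add_mem' := by
    rintro p p' ⟨hp, q, hq, h⟩ ⟨hp', q', hq', h'⟩
    exact ⟨hp.add hp', q + q', add_mem hq hq', h.add h'⟩
  smul_mem' := by
    rintro k p ⟨hp, q, hq, h⟩
    exact ⟨hp.smul k, k • q, Submodule.smul_mem _ k hq, h.const_smul k⟩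

/-! ### Unbounded operators

An unbounded operator in a complex Hilbert space is identified with its graph, a linear subspace of
the product of the space with itself: `(u, f) ∈ G` means that `u` is in the domain and is mapped
to `f`. -/

section Abstract

variable {H : Type*} [NormedAddCommGroup H] [InnerProductSpace ℂ H]

/-- The kernel of `G - t`. -/
def eigenspace (G : Submodule ℂ (H × H)) (t : ℝ) : Submodule ℂ H :=
  G.comap (LinearMap.id.prod ((t : ℂ) • LinearMap.id))

theorem mem_eigenspace (G : Submodule ℂ (H × H)) (t : ℝ) (u : H) :
    u ∈ eigenspace G t ↔ (u, (t : ℂ) • u) ∈ G := Iff.rfl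

/-- The resolvent `R = (G + 1)⁻¹` exists as a bounded operator and is compact. -/
def HasCompactResolvent (G : Submodule ℂ (H × H)) : Prop :=
  ∃ R : H →L[ℂ] H, IsCompactOperator R ∧ ∀ u f, (u, f) ∈ G ↔ u = R (f + u)

/-- `lam 0 ≤ lam 1 ≤ …` are the eigenvalues of `G`, repeated according to multiplicity. -/
def IsEigenvalueSeq (G : Submodule ℂ (H × H)) (lam : ℕ → ℝ) : Prop :=
  Monotone lam ∧ ∀ t : ℝ, {n | lam n = t}.Finite ∧ FiniteDimensional ℂ (eigenspace G t) ∧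
    {n | lam n = t}.ncard = Module.finrank ℂ (eigenspace G t)

/-- `ψ` is an orthonormal sequence of eigenfunctions of `G` for the eigenvalues `lam`. -/
def IsEigenfunctionSeq (G : Submodule ℂ (H × H)) (lam : ℕ → ℝ) (ψ : ℕ → H) : Prop :=
  Orthonormal ℂ ψ ∧ ∀ n, ψ n ∈ eigenspace G (lam n)

/-- The growth condition `λ_n ≥ C₁ n^{1/α}`, `n = 1, 2, …`, for the non-zero eigenvalues
(the enumeration `lam` starts at `0`). -/
def EigenvalueGrowth (lam : ℕ → ℝ) (α C₁ : ℝ) : Prop :=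
  ∀ n : ℕ, lam n ≠ 0 → C₁ * ((n : ℝ) + 1) ^ (1 / α) ≤ lam n

end Abstract

/-! ### Operators associated with quadratic forms -/

/-- The density `∑ B_{ij} F_i conj(G_j)` of a sesquilinear form at a point. -/
def formDensity (B : Matrix (Fin N) (Fin N) ℝ) (F G : CVec N) : ℂ :=
  ∑ i, ∑ j, (B i j : ℂ) * F i * conj (G j)

theorem formDensity_add (B : Matrix (Fin N) (Fin N) ℝ) (F F' G : CVec N) :
    formDensity B (F + F') G = formDensity B F G + formDensity B F' G := by
  simp [formDensity, mul_add, add_mul, Finset.sum_add_distrib]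

theorem formDensity_smul (B : Matrix (Fin N) (Fin N) ℝ) (k : ℂ) (F G : CVec N) :
    formDensity B (k • F) G = k * formDensity B F G := by
  simp only [formDensity, PiLp.smul_apply, smul_eq_mul, Finset.mul_sum]
  refine Finset.sum_congr rfl fun i _ => Finset.sum_congr rfl fun j _ => ?_
  ring

/-- The operator in `L²(μ)` associated with the form
`Q(u, v) = ∫ ∑ B_{ij} ∂_i u conj(∂_j v) dν` on the domain `D`: `u` is mapped to `f` if `u ∈ D` and
`Q(u, v) = ⟨f, v⟩` in `L²(μ)` for all `v ∈ D`. -/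
def formOperator (μ ν : Measure (E N)) (D : Submodule ℂ ((E N → ℂ) × (E N → CVec N)))
    (B : E N → Matrix (Fin N) (Fin N) ℝ) : Submodule ℂ (Lp ℂ 2 μ × Lp ℂ 2 μ) where
  carrier := {p | ∃ q ∈ D, p.1 =ᵐ[μ] q.1 ∧ ∀ r ∈ D, ∀ v : Lp ℂ 2 μ, v =ᵐ[μ] r.1 →
    Integrable (fun x => formDensity (B x) (q.2 x) (r.2 x)) ν ∧
      ∫ x, formDensity (B x) (q.2 x) (r.2 x) ∂ν = inner ℂ v p.2}
  zero_mem' := by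
    refine ⟨0, zero_mem _, Lp.coeFn_zero _ _ _, fun r _ v _ => ?_⟩
    simp [formDensity]
  add_mem' := by
    rintro p p' ⟨q, hq, h1, h2⟩ ⟨q', hq', h1', h2'⟩
    refine ⟨q + q', add_mem hq hq', (Lp.coeFn_add _ _).trans (h1.add h1'), fun r hr v hv => ?_⟩
    obtain ⟨i1, e1⟩ := h2 r hr v hv
    obtain ⟨i2, e2⟩ := h2' r hr v hv
    simp only [Prod.snd_add, Pi.add_apply, formDensity_add]
    exact ⟨i1.add i2, by rw [integral_add i1 i2, e1, e2, inner_add_right]⟩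
  smul_mem' := by
    rintro k p ⟨q, hq, h1, h2⟩
    refine ⟨k • q, Submodule.smul_mem _ k hq, (Lp.coeFn_smul _ _).trans (h1.const_smul k),
      fun r hr v hv => ?_⟩
    obtain ⟨i1, e1⟩ := h2 r hr v hv
    simp only [Prod.smul_snd, Pi.smul_apply, formDensity_smul]
    exact ⟨i1.const_mul k, by rw [integral_const_mul, e1, inner_smul_right]⟩

/-- The operator `w⁻¹ G w` in `L²(μ)`, where `w` is a function, acting by multiplication
`L²(μ) → L²(μ')`, and `G` is an operator in `L²(μ')`. -/
def conjugateOperator (μ μ' : Measure (E N)) (w : E N → ℝ)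
    (G : Submodule ℂ (Lp ℂ 2 μ' × Lp ℂ 2 μ')) : Submodule ℂ (Lp ℂ 2 μ × Lp ℂ 2 μ) where
  carrier := {p | ∃ u f : E N → ℂ, p.1 =ᵐ[μ] u ∧ p.2 =ᵐ[μ] f ∧ ∃ q ∈ G,
    q.1 =ᵐ[μ'] (fun x => w x • u x) ∧ q.2 =ᵐ[μ'] (fun x => w x • f x)}
  zero_mem' := by
    refine ⟨0, 0, Lp.coeFn_zero _ _ _, Lp.coeFn_zero _ _ _, 0, zero_mem _, ?_, ?_⟩
    · exact (Lp.coeFn_zero ℂ 2 μ').trans (Filter.Eventually.of_forall fun x => by simp)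
    · exact (Lp.coeFn_zero ℂ 2 μ').trans (Filter.Eventually.of_forall fun x => by simp)
  add_mem' := by
    rintro p p' ⟨u, f, hu, hf, q, hq, h1, h2⟩ ⟨u', f', hu', hf', q', hq', h1', h2'⟩
    refine ⟨u + u', f + f', (Lp.coeFn_add _ _).trans (hu.add hu'),
      (Lp.coeFn_add _ _).trans (hf.add hf'), q + q', add_mem hq hq',
      (Lp.coeFn_add _ _).trans ?_, (Lp.coeFn_add _ _).trans ?_⟩
    · exact (h1.add h1').trans (Filter.Eventually.of_forall fun x => by simp)
    · exact (h2.add h2').trans (Filter.Eventually.of_forall fun x => by simp)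
  smul_mem' := by
    rintro k p ⟨u, f, hu, hf, q, hq, h1, h2⟩
    refine ⟨k • u, k • f, (Lp.coeFn_smul _ _).trans (hu.const_smul k),
      (Lp.coeFn_smul _ _).trans (hf.const_smul k), k • q, Submodule.smul_mem _ k hq,
      (Lp.coeFn_smul _ _).trans ?_, (Lp.coeFn_smul _ _).trans ?_⟩
    · exact (h1.const_smul k).trans
        (Filter.Eventually.of_forall fun x => by simp [mul_left_comm])
    · exact (h2.const_smul k).trans
        (Filter.Eventually.of_forall fun x => by simp [mul_left_comm])

/-! ### The growth properties of eigenfunctions -/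

/-- Property (P1) of an operator in `L²(μ)`: `‖ψ_n‖_{L^{q₀}(μ)} ≤ C₂ λ_n^γ` for all `n` with
`λ_n ≠ 0`, for some orthonormal sequence of eigenfunctions. -/
def PropertyP1 (μ : Measure (E N)) (G : Submodule ℂ (Lp ℂ 2 μ × Lp ℂ 2 μ)) (q₀ : ℝ≥0∞)
    (γ C₂ : ℝ) : Prop :=
  ∃ (lam : ℕ → ℝ) (ψ : ℕ → Lp ℂ 2 μ), IsEigenvalueSeq G lam ∧ IsEigenfunctionSeq G lam ψ ∧
    ∀ n, lam n ≠ 0 → eLpNorm (ψ n) q₀ μ ≤ ENNReal.ofReal (C₂ * lam n ^ γ)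

/-- Property (P2) of an operator in `L²(μ)`, where `μ` is a measure on the open set `U`:
`‖∇ψ_n‖_{L^{q₀}(μ)} ≤ C₂ λ_n^{1/2 + γ}` for all `n`, for some orthonormal sequence of
eigenfunctions. -/
def PropertyP2 (U : Set (E N)) (μ : Measure (E N)) (G : Submodule ℂ (Lp ℂ 2 μ × Lp ℂ 2 μ))
    (q₀ : ℝ≥0∞) (γ C₂ : ℝ) : Prop :=
  ∃ (lam : ℕ → ℝ) (ψ : ℕ → Lp ℂ 2 μ), IsEigenvalueSeq G lam ∧ IsEigenfunctionSeq G lam ψ ∧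
    ∀ n, ∃ F : E N → CVec N, IsWeakGradient U (ψ n) F ∧
      eLpNorm F q₀ μ ≤ ENNReal.ofReal (C₂ * lam n ^ (1 / 2 + γ))

/-! ### Coefficients and domain transformations -/

/-- `A` is a symmetric matrix of bounded measurable functions on `ℝ^N`, uniformly elliptic with
constant `θ`. -/
structure IsElliptic (A : E N → Matrix (Fin N) (Fin N) ℝ) (θ : ℝ) : Prop where
  memLp : ∀ i j, MemLp (fun x => A x i j) ∞ volume
  symm : ∀ x, (A x).IsSymm
  one_le : 1 ≤ θ
  lower : ∀ (x : E N) (ξ : Fin N → ℝ), θ⁻¹ * ∑ i, ξ i ^ 2 ≤ ∑ i, ∑ j, A x i j * ξ i * ξ j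
  upper : ∀ (x : E N) (ξ : Fin N → ℝ), ∑ i, ∑ j, A x i j * ξ i * ξ j ≤ θ * ∑ i, ξ i ^ 2

/-- `φ` is a homeomorphism of `Ω` onto a domain `φ(Ω)`, and `φ` and its inverse are Lipschitz
continuous. Only the values of `φ` on `Ω` matter. -/
structure IsBiLipschitz (Ω : Set (E N)) (φ : E N → E N) : Prop where
  isOpen_image : IsOpen (φ '' Ω)
  lipschitz : ∃ K : ℝ≥0, LipschitzOnWith K φ Ω
  lipschitz_inv : ∃ K : ℝ≥0, ∀ x ∈ Ω, ∀ y ∈ Ω, dist x y ≤ K * dist (φ x) (φ y)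

/-- The Jacobian matrix `(∂_j φ_i)_{ij}`. -/
def jacobian (φ : E N → E N) (x : E N) : Matrix (Fin N) (Fin N) ℝ :=
  Matrix.of fun i j => (fderiv ℝ φ x (stdVec j)) i

/-- `g = |det ∇φ|`. -/
def jacDet (φ : E N → E N) (x : E N) : ℝ := |(jacobian φ x).det|

/-- `a = (∇φ)⁻¹ A(φ) (∇φ)⁻ᵗ`. -/
def pullbackMatrix (A : E N → Matrix (Fin N) (Fin N) ℝ) (φ : E N → E N) (x : E N) :
    Matrix (Fin N) (Fin N) ℝ :=
  (jacobian φ x)⁻¹ * A (φ x) * ((jacobian φ x)⁻¹).transpose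

/-- The measure `g dx` on `Ω`. -/
def weightedMeasure (Ω : Set (E N)) (φ : E N → E N) : Measure (E N) :=
  (volume.restrict Ω).withDensity fun x => ENNReal.ofReal (jacDet φ x)

/-- `w = g^{1/2} g̃^{-1/2}`. -/
def weightRatio (φ φt : E N → E N) (x : E N) : ℝ :=
  Real.sqrt (jacDet φ x) / Real.sqrt (jacDet φt x)

/-- The operator `L` in `L²(φ(Ω))`. -/
def opL (bc : BoundaryCondition) (A : E N → Matrix (Fin N) (Fin N) ℝ) (Ω : Set (E N))
    (φ : E N → E N) :
    Submodule ℂ (Lp ℂ 2 (volume.restrict (φ '' Ω)) × Lp ℂ 2 (volume.restrict (φ '' Ω))) :=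
  formOperator (volume.restrict (φ '' Ω)) (volume.restrict (φ '' Ω)) (formDomain bc (φ '' Ω)) A

/-- The pull-back `H` of `L`, an operator in `L²(Ω, g dx)`. -/
def opH (bc : BoundaryCondition) (A : E N → Matrix (Fin N) (Fin N) ℝ) (Ω : Set (E N))
    (φ : E N → E N) :
    Submodule ℂ (Lp ℂ 2 (weightedMeasure Ω φ) × Lp ℂ 2 (weightedMeasure Ω φ)) :=
  formOperator (weightedMeasure Ω φ) (weightedMeasure Ω φ) (pullbackDomain bc Ω φ)
    (pullbackMatrix A φ)

/-- The operator `T^*ST` in `L²(Ω, g dx)`, associated with the form `∫_Ω ã∇u · ∇v̄ g̃ dx` on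
`C_φ[𝒲]`. -/
def opTST (bc : BoundaryCondition) (A : E N → Matrix (Fin N) (Fin N) ℝ) (Ω : Set (E N))
    (φ φt : E N → E N) :
    Submodule ℂ (Lp ℂ 2 (weightedMeasure Ω φ) × Lp ℂ 2 (weightedMeasure Ω φ)) :=
  formOperator (weightedMeasure Ω φ) (weightedMeasure Ω φt) (pullbackDomain bc Ω φ)
    (pullbackMatrix A φt)

/-- The operator `w⁻¹ H̃ w` in `L²(Ω, g dx)`. -/
def opWHW (bc : BoundaryCondition) (A : E N → Matrix (Fin N) (Fin N) ℝ) (Ω : Set (E N))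
    (φ φt : E N → E N) :
    Submodule ℂ (Lp ℂ 2 (weightedMeasure Ω φ) × Lp ℂ 2 (weightedMeasure Ω φ)) :=
  conjugateOperator (weightedMeasure Ω φ) (weightedMeasure Ω φt) (weightRatio φ φt)
    (opH bc A Ω φt)

/-! ### The measure of vicinity -/

/-- The square root of a symmetric positive semidefinite matrix, by functional calculus. -/
def matSqrt (M : Matrix (Fin N) (Fin N) ℝ) : Matrix (Fin N) (Fin N) ℝ := cfc Real.sqrt M

/-- `S = w⁻² a^{-1/2} ã a^{-1/2}`. -/
def matS (A : E N → Matrix (Fin N) (Fin N) ℝ) (φ φt : E N → E N) (x : E N) :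
    Matrix (Fin N) (Fin N) ℝ :=
  (weightRatio φ φt x ^ 2)⁻¹ • ((matSqrt (pullbackMatrix A φ x))⁻¹ * pullbackMatrix A φt x *
    (matSqrt (pullbackMatrix A φ x))⁻¹)

/-- The operator norm of a matrix with respect to the Euclidean norm. -/
def matNorm (M : Matrix (Fin N) (Fin N) ℝ) : ℝ := ‖Matrix.toEuclideanCLM (𝕜 := ℝ) M‖

/-- `δ_q^{(1)} = ‖w - 1‖ + ‖w⁻¹ - 1‖`, norms in `L^q(Ω, g dx)`. -/
def vicinity₁ (Ω : Set (E N)) (φ φt : E N → E N) (q : ℝ≥0∞) : ℝ≥0∞ :=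
  eLpNorm (fun x => weightRatio φ φt x - 1) q (weightedMeasure Ω φ) +
    eLpNorm (fun x => (weightRatio φ φt x)⁻¹ - 1) q (weightedMeasure Ω φ)

/-- `δ_q^{(2)} = ‖(S^{1/2} - S^{-1/2}) a^{1/2}‖ + ‖(S - I) a^{1/2}‖`, norms in `L^q(Ω, g dx)`. -/
def vicinity₂ (A : E N → Matrix (Fin N) (Fin N) ℝ) (Ω : Set (E N)) (φ φt : E N → E N)
    (q : ℝ≥0∞) : ℝ≥0∞ :=
  eLpNorm (fun x => matNorm ((matSqrt (matS A φ φt x) - (matSqrt (matS A φ φt x))⁻¹) *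
      matSqrt (pullbackMatrix A φ x))) q (weightedMeasure Ω φ) +
    eLpNorm (fun x => matNorm ((matS A φ φt x - 1) * matSqrt (pullbackMatrix A φ x))) q
      (weightedMeasure Ω φ)

/-- The measure of vicinity `δ_q(φ, φ̃)`. -/
def vicinity (A : E N → Matrix (Fin N) (Fin N) ℝ) (Ω : Set (E N)) (φ φt : E N → E N)
    (q : ℝ≥0∞) : ℝ≥0∞ :=
  vicinity₁ Ω φ φt q + vicinity₂ A Ω φ φt q

/-- The exponent `2 q₀ / (q₀ - 2) = (1/2 - 1/q₀)⁻¹`, which is `2` for `q₀ = ∞`. -/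
def dualExponent (q₀ : ℝ≥0∞) : ℝ≥0∞ := (2⁻¹ - q₀⁻¹)⁻¹

/-- `[1 + δ_s] δ_{2q₀/(q₀-2)}`. -/
def vicinityFactor (A : E N → Matrix (Fin N) (Fin N) ℝ) (Ω : Set (E N)) (φ φt : E N → E N)
    (q₀ : ℝ≥0∞) (s : ℝ) : ℝ≥0∞ :=
  (1 + vicinity A Ω φ φt (ENNReal.ofReal s)) * vicinity A Ω φ φt (dualExponent q₀)

/-! ### Eigenfunctions on the two domains -/

/-- `ψ 0, …, ψ (m - 1)` are orthonormal eigenfunctions of `L`, in `L²(φ(Ω))`, for the eigenvalues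
`lam n, …, lam (n + m - 1)`. -/
def AreEigenfunctions (bc : BoundaryCondition) (A : E N → Matrix (Fin N) (Fin N) ℝ)
    (Ω : Set (E N)) (φ : E N → E N) (lam : ℕ → ℝ) (n m : ℕ)
    (ψ : Fin m → Lp ℂ 2 (volume.restrict (φ '' Ω))) : Prop :=
  Orthonormal ℂ ψ ∧ ∀ j : Fin m, ψ j ∈ eigenspace (opL bc A Ω φ) (lam (n + j))

/-- `λ` is an eigenvalue of multiplicity `m` of the operator `L`, with
`λ = lam n = … = lam (n + m - 1)`; and the neighbours of `λ` in the sequence are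
`lam (n - 1) = lamPrev` (if `n > 0`) and `lam (n + m) = lamNext`. -/
structure IsEigenvalueBlock (bc : BoundaryCondition) (A : E N → Matrix (Fin N) (Fin N) ℝ)
    (Ω : Set (E N)) (φ : E N → E N) (lam : ℕ → ℝ) (n m : ℕ) (lamPrev lamVal lamNext : ℝ) :
    Prop where
  pos : 0 < m
  multiplicity : Module.finrank ℂ (eigenspace (opL bc A Ω φ) lamVal) = m
  eq : ∀ j, n ≤ j → j < n + m → lam j = lamVal
  prev : ∀ j, j + 1 = n → lam j = lamPrev
  next : lam (n + m) = lamNext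

/-- `‖g^{1/2} u ∘ φ - g̃^{1/2} u ∘ φ̃‖_{L²(Ω)}`. -/
def changeTerm (Ω : Set (E N)) (φ φt : E N → E N) (u : E N → ℂ) : ℝ≥0∞ :=
  eLpNorm (fun x => Real.sqrt (jacDet φ x) • u (φ x) - Real.sqrt (jacDet φt x) • u (φt x)) 2
    (volume.restrict Ω)

/-- The asserted estimate for `u` on `φ(Ω)` and `v` on `φ̃(Ω)`, both extended by zero. -/
def EigenfunctionEstimate (A : E N → Matrix (Fin N) (Fin N) ℝ) (Ω : Set (E N))
    (φ φt : E N → E N) (q₀ : ℝ≥0∞) (s : ℝ) (c : ℝ≥0) (u v : E N → ℂ) : Prop :=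
  eLpNorm ((φ '' Ω).indicator u - (φt '' Ω).indicator v) 2
      (volume.restrict (φ '' Ω ∪ φt '' Ω)) ≤
    c * (vicinityFactor A Ω φ φt q₀ s + changeTerm Ω φ φt ((φ '' Ω).indicator u) +
      changeTerm Ω φ φt ((φt '' Ω).indicator v))

end SpectralStability

end

open SpectralStability

noncomputable section

namespace SpectralStability

variable {N : ℕ}

/-! ### Bi-Lipschitz maps -/

/-! `L` and `L̃` act on different domains, so both are carried to the single space L²(Ω, g dx).
Composition with φ turns `L` into `H`; composition with φ̃ followed by division by w turns `L̃` into
w⁻¹H̃w. Both Sobolev spaces are invariant under bi-Lipschitz changes of variables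
(`IsBiLipschitz.comp_mem_formDomain`), so all form domains coincide with one space V of functions on
Ω. On V there are two forms, q (matrix a, weight g) and q' (matrix ã, weight g̃), and two embeddings
in L²(Ω, g dx), Ju = u and J'u = w⁻¹u. The pairs (q, J), (q', J') and (q', J) represent H, w⁻¹H̃w
and T*ST.

These data are close on eigenvectors with bounded eigenvalue (`isClose_gradientForm`). With b =
a^{1/2} and s = S^{1/2}, pointwise a - w⁻²ã = -bs(s - s⁻¹)b = -b(S - I)b. Hölder's inequality with
exponents 2q₀/(q₀-2), q₀, 2 and (P2) then bound q(y, x) - q'(y, x) by a multiple of δ√q'(y, y) or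
δ√q(y, y), for a normalized eigenvector x and arbitrary y; (P1) and w - 1, w⁻¹ - 1 handle Jx - J'x.
Properties (P1) and (P2) concern particular eigenfunctions, but the growth condition bounds the
multiplicity of non-zero eigenvalues, hence the norms of all normalized eigenfunctions. For the
eigenvalue zero, (P2) forces a vanishing gradient, so the eigenfunction is constant on the connected
set Ω; constants are estimated by comparison with one normalized eigenfunction obeying (P1).

The rest is abstract. Trial vectors in the min-max principle compare eigenvalues around the cycle
(q, J), (q', J'), (q', J), (q, J), so the n-th eigenvalues of H and w⁻¹H̃w are close
(`eigenvalue_close`). Testing the difference of the forms with a resolvent-type vector shows that an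
eigenvector of (q, J) is close to the span of the eigenvectors of (q', J') with nearby eigenvalues
(`IsEigenbasis.dist_span_le`). Equality of dimensions makes this symmetric, and an
orthonormalization adapted to the given eigenfunctions produces the required ones
(`exists_eigenvector_stability_const`). Undoing the unitary maps compares u ∘ φ with v ∘ φ̃;
replacing either by a composition with the other map costs the last two terms of the estimate
(`eigenfunctionEstimate_of_norm_le`). -/

theorem jacobian_eq_toMatrix (χ : E N → E N) (x : E N) :
    jacobian χ x = LinearMap.toMatrix (EuclideanSpace.basisFun (Fin N) ℝ).toBasis
      (EuclideanSpace.basisFun (Fin N) ℝ).toBasis (fderiv ℝ χ x : E N →ₗ[ℝ] E N) := by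
  ext i j
  simp [jacobian, LinearMap.toMatrix_apply, stdVec]

theorem jacDet_eq_abs_det (χ : E N → E N) (x : E N) : jacDet χ x = |(fderiv ℝ χ x).det| := by
  rw [jacDet, jacobian_eq_toMatrix, LinearMap.det_toMatrix]

theorem jacDet_nonneg (χ : E N → E N) (x : E N) : 0 ≤ jacDet χ x := abs_nonneg _

theorem measurable_jacobian (χ : E N → E N) (i j : Fin N) :
    Measurable (fun x => jacobian χ x i j) := by
  have h := measurable_fderiv_apply_const ℝ χ (stdVec j)
  have h2 : Continuous (fun v : E N => v i) := by fun_prop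
  exact h2.measurable.comp h

theorem measurable_jacDet (χ : E N → E N) : Measurable (jacDet χ) := by
  unfold jacDet
  simp_rw [Matrix.det_apply]
  refine Measurable.abs (Finset.measurable_sum _ fun σ _ => ?_)
  refine Measurable.const_smul ?_ _
  exact Finset.measurable_prod _ fun i _ => measurable_jacobian χ _ _

/-- The determinant is the factor by which `M` scales the volume of the unit ball, whose image lies
between the balls of radius K⁻¹ and K. -/
theorem abs_det_bounds (N : ℕ) (K : ℝ) (hK : 0 < K) : ∃ c C : ℝ, 0 < c ∧
    ∀ M : E N →L[ℝ] E N, (∀ v, ‖M v‖ ≤ K * ‖v‖) → (∀ v, ‖v‖ ≤ K * ‖M v‖) →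
      c ≤ |M.det| ∧ |M.det| ≤ C := by
  set B := Metric.ball (0 : E N) 1 with hB
  have hB0 : volume B ≠ 0 := (Metric.measure_ball_pos volume _ one_pos).ne'
  have hBt : volume B ≠ ⊤ := measure_ball_lt_top.ne
  have h1 : 0 < (volume (Metric.ball (0 : E N) K⁻¹)).toReal :=
    ENNReal.toReal_pos (Metric.measure_ball_pos volume _ (inv_pos.2 hK)).ne' measure_ball_lt_top.ne
  have h2 : 0 < (volume B).toReal := ENNReal.toReal_pos hB0 hBt
  refine ⟨(volume (Metric.ball (0 : E N) K⁻¹)).toReal / (volume B).toReal,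
    (volume (Metric.ball (0 : E N) K)).toReal / (volume B).toReal, div_pos h1 h2, ?_⟩
  intro M hM1 hM2
  have key := Measure.addHaar_image_continuousLinearMap volume M B
  have key2 : (volume (M '' B)).toReal = |M.det| * (volume B).toReal := by
    rw [key, ENNReal.toReal_mul, ENNReal.toReal_ofReal (abs_nonneg _)]
  have hinj : Function.Injective (M : E N →ₗ[ℝ] E N) := by
    rw [← LinearMap.ker_eq_bot, LinearMap.ker_eq_bot']
    intro v hv
    have := hM2 v
    have hv' : M v = 0 := hv
    rw [hv', norm_zero, mul_zero] at this
    exact norm_le_zero_iff.1 this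
  have hsurj := LinearMap.injective_iff_surjective.1 hinj
  have hs1 : Metric.ball (0 : E N) K⁻¹ ⊆ M '' B := by
    intro y hy
    obtain ⟨v, hv⟩ := hsurj y
    have hv' : M v = y := hv
    refine ⟨v, ?_, hv'⟩
    have h3 := hM2 v
    rw [hv'] at h3
    simp only [hB, Metric.mem_ball, dist_zero_right] at hy ⊢
    calc ‖v‖ ≤ K * ‖y‖ := h3
      _ < K * K⁻¹ := by gcongr
      _ = 1 := mul_inv_cancel₀ hK.ne'
  have hs2 : M '' B ⊆ Metric.ball (0 : E N) K := by
    rintro _ ⟨v, hv, rfl⟩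
    simp only [hB, Metric.mem_ball, dist_zero_right] at hv ⊢
    calc ‖M v‖ ≤ K * ‖v‖ := hM1 v
      _ < K * 1 := by gcongr
      _ = K := mul_one K
  have hfin : volume (M '' B) ≠ ⊤ := ne_top_of_le_ne_top measure_ball_lt_top.ne (measure_mono hs2)
  constructor
  · rw [div_le_iff₀ h2, ← key2]
    exact ENNReal.toReal_mono hfin (measure_mono hs1)
  · rw [le_div_iff₀ h2, ← key2]
    exact ENNReal.toReal_mono measure_ball_lt_top.ne (measure_mono hs2)

theorem IsBiLipschitz.exists_const {U : Set (E N)} {χ : E N → E N} (h : IsBiLipschitz U χ) :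
    ∃ K : ℝ≥0, 0 < K ∧ LipschitzOnWith K χ U ∧
      ∀ x ∈ U, ∀ y ∈ U, dist x y ≤ K * dist (χ x) (χ y) := by
  obtain ⟨K₁, h1⟩ := h.lipschitz
  obtain ⟨K₂, h2⟩ := h.lipschitz_inv
  refine ⟨max 1 (max K₁ K₂), lt_max_of_lt_left one_pos,
    h1.weaken ((le_max_left _ _).trans (le_max_right _ _)), fun x hx y hy => (h2 x hx y hy).trans ?_⟩
  gcongr
  exact (le_max_right K₁ K₂).trans (le_max_right _ _)

theorem IsBiLipschitz.injOn {U : Set (E N)} {χ : E N → E N} (h : IsBiLipschitz U χ) :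
    InjOn χ U := by
  obtain ⟨K, -, -, h2⟩ := h.exists_const
  intro x hx y hy hxy
  have := h2 x hx y hy
  rw [hxy, dist_self, mul_zero] at this
  exact dist_le_zero.1 this

theorem IsBiLipschitz.ae_differentiableAt {U : Set (E N)} (hU : IsOpen U) {χ : E N → E N}
    (h : IsBiLipschitz U χ) : ∀ᵐ x ∂volume.restrict U, x ∈ U ∧ DifferentiableAt ℝ χ x := by
  obtain ⟨K, h1⟩ := h.lipschitz
  filter_upwards [h1.ae_differentiableWithinAt (μ := volume) hU.measurableSet,
    ae_restrict_mem hU.measurableSet] with x hx hxU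
  exact ⟨hxU, hx.differentiableAt (hU.mem_nhds hxU)⟩

/-- The lower bound holds for the difference quotients in direction `v` and passes to the limit. -/
theorem fderiv_bounds {U : Set (E N)} (hU : IsOpen U) {χ : E N → E N} {K : ℝ≥0}
    (h1 : LipschitzOnWith K χ U) (h2 : ∀ x ∈ U, ∀ y ∈ U, dist x y ≤ K * dist (χ x) (χ y))
    {x : E N} (hx : x ∈ U) (hd : DifferentiableAt ℝ χ x) (v : E N) :
    ‖fderiv ℝ χ x v‖ ≤ K * ‖v‖ ∧ ‖v‖ ≤ K * ‖fderiv ℝ χ x v‖ := by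
  constructor
  · refine (ContinuousLinearMap.le_opNorm _ _).trans ?_
    gcongr
    exact norm_fderiv_le_of_lipschitzOn ℝ (hU.mem_nhds hx) h1
  · have hl : HasLineDerivAt ℝ χ (fderiv ℝ χ x v) x v := hd.hasFDerivAt.hasLineDerivAt v
    have ht := hl.tendsto_slope_zero
    have ht2 : Filter.Tendsto (fun t : ℝ => (K : ℝ) * ‖t⁻¹ • (χ (x + t • v) - χ x)‖)
        (nhdsWithin 0 {0}ᶜ) (nhds (K * ‖fderiv ℝ χ x v‖)) := ht.norm.const_mul _
    refine ge_of_tendsto ht2 ?_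
    have hcont : Filter.Tendsto (fun t : ℝ => x + t • v) (nhds 0) (nhds x) := by
      have : Continuous (fun t : ℝ => x + t • v) := by fun_prop
      simpa using this.tendsto 0
    have hmem : ∀ᶠ t : ℝ in nhdsWithin 0 {0}ᶜ, x + t • v ∈ U :=
      (hcont.eventually (hU.mem_nhds hx)).filter_mono nhdsWithin_le_nhds
    filter_upwards [hmem, self_mem_nhdsWithin] with t ht ht0
    have ht0' : t ≠ 0 := ht0
    have := h2 _ ht x hx
    rw [dist_eq_norm, dist_eq_norm, add_sub_cancel_left, norm_smul] at this
    rw [norm_smul, norm_inv]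
    have hp : 0 < ‖t‖ := norm_pos_iff.2 ht0'
    rw [mul_left_comm, ← div_eq_inv_mul, le_div_iff₀ hp]
    linarith

theorem IsBiLipschitz.jacDet_bounds {U : Set (E N)} (hU : IsOpen U) {χ : E N → E N}
    (h : IsBiLipschitz U χ) : ∃ c C : ℝ, 0 < c ∧ 0 < C ∧ ∀ᵐ x ∂volume.restrict U,
      x ∈ U ∧ DifferentiableAt ℝ χ x ∧ c ≤ jacDet χ x ∧ jacDet χ x ≤ C ∧
        ∀ i j, |jacobian χ x i j| ≤ C := by
  obtain ⟨K, hK, h1, h2⟩ := h.exists_const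
  obtain ⟨c, C, hc, hcC⟩ := abs_det_bounds N K (NNReal.coe_pos.2 hK)
  refine ⟨c, max C K, hc, lt_max_of_lt_right (NNReal.coe_pos.2 hK), ?_⟩
  filter_upwards [h.ae_differentiableAt hU] with x ⟨hx, hd⟩
  have hb := fun v => fderiv_bounds hU h1 h2 hx hd v
  obtain ⟨h3, h4⟩ := hcC (fderiv ℝ χ x) (fun v => (hb v).1) (fun v => (hb v).2)
  rw [jacDet_eq_abs_det]
  refine ⟨hx, hd, h3, h4.trans (le_max_left _ _), fun i j => ?_⟩
  have h5 := (hb (stdVec j)).1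
  have h6 : ‖stdVec j‖ = 1 := by simp [stdVec]
  rw [h6, mul_one] at h5
  exact ((PiLp.norm_apply_le (p := 2) (fderiv ℝ χ x (stdVec j)) i).trans h5).trans
    (le_max_right _ _)

theorem IsBiLipschitz.ae_jacDet_pos {U : Set (E N)} (hU : IsOpen U) {χ : E N → E N}
    (h : IsBiLipschitz U χ) : ∀ᵐ x ∂volume.restrict U, 0 < jacDet χ x := by
  obtain ⟨c, C, hc, -, h1⟩ := h.jacDet_bounds hU
  filter_upwards [h1] with x hx
  exact hc.trans_le hx.2.2.1

/-- Lipschitz maps enlarge Hausdorff measure by at most a constant factor, and the N-dimensional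
Hausdorff measure has the same null sets as the volume. -/
theorem volume_image_eq_zero {s : Set (E N)} {χ : E N → E N} {K : ℝ≥0}
    (h : LipschitzOnWith K χ s) (hs : volume s = 0) : volume (χ '' s) = 0 := by
  set H : Measure (E N) := Measure.hausdorffMeasure (Module.finrank ℝ (E N)) with hH
  have hac1 : H ≪ volume := Measure.absolutelyContinuous_isAddHaarMeasure _ _
  have hac2 : (volume : Measure (E N)) ≪ H := Measure.absolutelyContinuous_isAddHaarMeasure _ _
  apply hac2
  have := h.hausdorffMeasure_image_le (d := Module.finrank ℝ (E N)) (Nat.cast_nonneg _)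
  rw [← hH, hac1 hs, mul_zero] at this
  exact le_antisymm this zero_le

/-- The area formula applies to the set of differentiability points. Its complement in `U` is null
by Rademacher's theorem, and so is the image of that complement. -/
theorem IsBiLipschitz.lintegral_image {U : Set (E N)} (hU : IsOpen U) {χ : E N → E N}
    (h : IsBiLipschitz U χ) (f : E N → ℝ≥0∞) :
    ∫⁻ y in χ '' U, f y = ∫⁻ x in U, ENNReal.ofReal (jacDet χ x) * f (χ x) := by
  obtain ⟨K, h1⟩ := h.lipschitz
  set D := U ∩ {x | DifferentiableAt ℝ χ x} with hD
  have hDm : MeasurableSet D := hU.measurableSet.inter (measurableSet_of_differentiableAt ℝ χ)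
  have hnull : volume (U \ D) = 0 := by
    have := h.ae_differentiableAt hU
    rw [ae_restrict_iff' hU.measurableSet] at this
    refine measure_mono_null ?_ this
    intro x hx hx2
    exact hx.2 ⟨hx.1, (hx2 hx.1).2⟩
  have hnull2 : volume (χ '' (U \ D)) = 0 :=
    volume_image_eq_zero (h1.mono sdiff_subset) hnull
  have e1 : (volume.restrict (χ '' U)) = volume.restrict (χ '' D) := by
    refine Measure.restrict_congr_set ?_
    have : χ '' U = χ '' D ∪ χ '' (U \ D) := by
      rw [← image_union, union_sdiff_self, union_eq_self_of_subset_left inter_subset_left]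
    rw [this]
    exact union_ae_eq_left_of_ae_eq_empty (ae_eq_empty.2 hnull2)
  have e2 : volume.restrict U = volume.restrict D := by
    refine Measure.restrict_congr_set ?_
    have : U = D ∪ (U \ D) := by
      rw [union_sdiff_self, union_eq_self_of_subset_left inter_subset_left]
    conv_lhs => rw [this]
    exact union_ae_eq_left_of_ae_eq_empty (ae_eq_empty.2 hnull)
  rw [e1, e2, lintegral_image_eq_lintegral_abs_det_fderiv_mul volume hDm
    (f' := fun x => fderiv ℝ χ x) (fun x hx => hx.2.hasFDerivAt.hasFDerivWithinAt)
    (h.injOn.mono inter_subset_left)]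
  simp_rw [jacDet_eq_abs_det]

/-- A globally Lipschitz function which agrees with `χ` on `U`. -/
theorem IsBiLipschitz.exists_extension {U : Set (E N)} {χ : E N → E N} (h : IsBiLipschitz U χ) :
    ∃ χ' : E N → E N, (∃ K, LipschitzWith K χ') ∧ EqOn χ χ' U := by
  obtain ⟨K, h1⟩ := h.lipschitz
  have h2 : LipschitzOnWith (1 * K) (fun x i => χ x i) U :=
    (PiLp.lipschitzWith_ofLp 2 (fun _ : Fin N => ℝ)).comp_lipschitzOnWith h1
  obtain ⟨g, hg, hgU⟩ := h2.extend_pi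
  exact ⟨fun x => WithLp.toLp 2 (g x), ⟨_, (PiLp.lipschitzWith_toLp 2 (fun _ : Fin N => ℝ)).comp hg⟩,
    fun x hx => congrArg (WithLp.toLp 2) (hgU hx)⟩

/-- Off `U` the map `χ` is arbitrary and possibly not measurable, so statements on measurable maps
are applied to a global Lipschitz extension `χ'`. -/
theorem IsBiLipschitz.measurePreserving {U : Set (E N)} (hU : IsOpen U) {χ χ' : E N → E N}
    (h : IsBiLipschitz U χ) (hm : Measurable χ') (he : EqOn χ χ' U) :
    MeasurePreserving χ' (weightedMeasure U χ) (volume.restrict (χ '' U)) := by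
  refine ⟨hm, ?_⟩
  ext s hs
  rw [Measure.map_apply hm hs, weightedMeasure, withDensity_apply _ (hm hs), ← lintegral_indicator_one hs,
    h.lintegral_image hU, ← lintegral_indicator (hm hs)]
  refine setLIntegral_congr_fun hU.measurableSet fun x hx => ?_
  have : χ' x = χ x := (he hx).symm
  by_cases hxs : χ x ∈ s <;> simp [indicator, this, hxs]

theorem ae_weightedMeasure_iff {U : Set (E N)} (hU : IsOpen U) {χ : E N → E N}
    (h : IsBiLipschitz U χ) {P : E N → Prop} :
    (∀ᵐ x ∂weightedMeasure U χ, P x) ↔ ∀ᵐ x ∂volume.restrict U, P x := by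
  rw [weightedMeasure, ae_withDensity_iff (measurable_jacDet χ).ennreal_ofReal]
  have := h.ae_jacDet_pos hU
  constructor <;> intro h1 <;> filter_upwards [h1, this] with x hx hx2
  · exact hx (ENNReal.ofReal_pos.2 hx2).ne'
  · exact fun _ => hx

theorem ae_weightedMeasure {U : Set (E N)} (hU : IsOpen U) {χ : E N → E N}
    (h : IsBiLipschitz U χ) : ae (weightedMeasure U χ) = ae (volume.restrict U) := by
  ext s
  exact ae_weightedMeasure_iff hU h (P := fun x => x ∈ s)

theorem IsBiLipschitz.ae_comp {U : Set (E N)} (hU : IsOpen U) {χ : E N → E N}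
    (h : IsBiLipschitz U χ) {P : E N → Prop} (hP : ∀ᵐ y ∂volume.restrict (χ '' U), P y) :
    ∀ᵐ x ∂volume.restrict U, P (χ x) := by
  obtain ⟨χ', ⟨K, hK⟩, he⟩ := h.exists_extension
  have hmp := h.measurePreserving hU hK.continuous.measurable he
  have := hmp.quasiMeasurePreserving.ae hP
  rw [ae_weightedMeasure_iff hU h] at this
  filter_upwards [this, ae_restrict_mem hU.measurableSet] with x hx hxU
  rwa [he hxU]

theorem IsBiLipschitz.aestronglyMeasurable_comp {V : Type*} [TopologicalSpace V]
    {U : Set (E N)} (hU : IsOpen U) {χ : E N → E N} (h : IsBiLipschitz U χ) {f : E N → V}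
    (hf : AEStronglyMeasurable f (volume.restrict (χ '' U))) :
    AEStronglyMeasurable (fun x => f (χ x)) (volume.restrict U) := by
  obtain ⟨g, hg, hfg⟩ := hf
  obtain ⟨χ', ⟨K, hK⟩, he⟩ := h.exists_extension
  refine ⟨fun x => g (χ' x), hg.comp_measurable hK.continuous.measurable, ?_⟩
  filter_upwards [h.ae_comp hU hfg, ae_restrict_mem hU.measurableSet] with x hx hxU
  rw [hx, he hxU]

theorem IsBiLipschitz.integral_image {V : Type*} [NormedAddCommGroup V] [NormedSpace ℝ V]
    {U : Set (E N)} (hU : IsOpen U) {χ : E N → E N}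
    (h : IsBiLipschitz U χ) {f : E N → V}
    (hf : AEStronglyMeasurable f (volume.restrict (χ '' U))) :
    ∫ y in χ '' U, f y = ∫ x in U, jacDet χ x • f (χ x) := by
  obtain ⟨χ', ⟨K, hK⟩, he⟩ := h.exists_extension
  have hmp := h.measurePreserving hU hK.continuous.measurable he
  rw [← hmp.map_eq] at hf ⊢
  rw [integral_map hmp.measurable.aemeasurable hf, weightedMeasure,
    integral_withDensity_eq_integral_toReal_smul (measurable_jacDet χ).ennreal_ofReal (by simp)]
  refine setIntegral_congr_fun hU.measurableSet fun x hx => ?_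
  simp only [ENNReal.toReal_ofReal (jacDet_nonneg χ x), he hx]

theorem IsBiLipschitz.integral_weighted {V : Type*} [NormedAddCommGroup V] [NormedSpace ℝ V]
    {U : Set (E N)} (hU : IsOpen U) {χ : E N → E N}
    (h : IsBiLipschitz U χ) {f : E N → V}
    (hf : AEStronglyMeasurable f (volume.restrict (χ '' U))) :
    ∫ x, f (χ x) ∂weightedMeasure U χ = ∫ y in χ '' U, f y := by
  rw [h.integral_image hU hf, weightedMeasure,
    integral_withDensity_eq_integral_toReal_smul (measurable_jacDet χ).ennreal_ofReal (by simp)]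
  simp only [ENNReal.toReal_ofReal (jacDet_nonneg χ _)]

theorem IsBiLipschitz.integrable_weighted_iff {V : Type*} [NormedAddCommGroup V]
    {U : Set (E N)} (hU : IsOpen U) {χ : E N → E N}
    (h : IsBiLipschitz U χ) {f : E N → V}
    (hf : AEStronglyMeasurable f (volume.restrict (χ '' U))) :
    Integrable (fun x => f (χ x)) (weightedMeasure U χ) ↔ IntegrableOn f (χ '' U) := by
  obtain ⟨χ', ⟨K, hK⟩, he⟩ := h.exists_extension
  have hmp := h.measurePreserving hU hK.continuous.measurable he
  rw [IntegrableOn]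
  rw [← hmp.map_eq] at hf ⊢
  rw [integrable_map_measure hf hmp.measurable.aemeasurable]
  refine integrable_congr ?_
  rw [Filter.EventuallyEq, ae_weightedMeasure_iff hU h]
  filter_upwards [ae_restrict_mem hU.measurableSet] with x hx
  simp [he hx]

theorem IsBiLipschitz.eLpNorm_weighted {V : Type*} [NormedAddCommGroup V]
    {U : Set (E N)} (hU : IsOpen U) {χ : E N → E N}
    (h : IsBiLipschitz U χ) {f : E N → V} (p : ℝ≥0∞)
    (hf : AEStronglyMeasurable f (volume.restrict (χ '' U))) :
    eLpNorm (fun x => f (χ x)) p (weightedMeasure U χ) = eLpNorm f p (volume.restrict (χ '' U)) := by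
  obtain ⟨χ', ⟨K, hK⟩, he⟩ := h.exists_extension
  have hmp := h.measurePreserving hU hK.continuous.measurable he
  rw [← eLpNorm_comp_measurePreserving hf hmp]
  refine eLpNorm_congr_ae ?_
  rw [Filter.EventuallyEq, ae_weightedMeasure_iff hU h]
  filter_upwards [ae_restrict_mem hU.measurableSet] with x hx
  simp [he hx]

/-- A right inverse of `χ` on `χ '' U`. -/
def invMap (U : Set (E N)) (χ : E N → E N) : E N → E N := Function.invFunOn χ U

theorem IsBiLipschitz.invMap_apply {U : Set (E N)} {χ : E N → E N} (h : IsBiLipschitz U χ)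
    {x : E N} (hx : x ∈ U) : invMap U χ (χ x) = x := h.injOn.leftInvOn_invFunOn hx

theorem IsBiLipschitz.invMap_image {U : Set (E N)} {χ : E N → E N} (h : IsBiLipschitz U χ) :
    invMap U χ '' (χ '' U) = U := by
  rw [image_image]
  exact (image_congr fun x hx => h.invMap_apply hx).trans (image_id' U)

theorem IsBiLipschitz.inverse {U : Set (E N)} (hU : IsOpen U) {χ : E N → E N}
    (h : IsBiLipschitz U χ) : IsBiLipschitz (χ '' U) (invMap U χ) := by
  obtain ⟨K, -, h1, h2⟩ := h.exists_const
  refine ⟨by rwa [h.invMap_image], ⟨K, ?_⟩, ⟨K, ?_⟩⟩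
  · refine LipschitzOnWith.of_dist_le_mul ?_
    rintro _ ⟨x, hx, rfl⟩ _ ⟨y, hy, rfl⟩
    rw [h.invMap_apply hx, h.invMap_apply hy]
    exact h2 x hx y hy
  · rintro _ ⟨x, hx, rfl⟩ _ ⟨y, hy, rfl⟩
    rw [h.invMap_apply hx, h.invMap_apply hy]
    exact h1.dist_le_mul x hx y hy

theorem IsBiLipschitz.comp {U : Set (E N)} {χ κ : E N → E N}
    (h : IsBiLipschitz U χ) (k : IsBiLipschitz (χ '' U) κ) : IsBiLipschitz U (κ ∘ χ) := by
  obtain ⟨K, -, h1, h2⟩ := h.exists_const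
  obtain ⟨M, -, k1, k2⟩ := k.exists_const
  refine ⟨by rw [image_comp]; exact k.isOpen_image, ⟨M * K, k1.comp h1 (mapsTo_image χ U)⟩,
    ⟨K * M, fun x hx y hy => (h2 x hx y hy).trans ?_⟩⟩
  rw [NNReal.coe_mul, mul_assoc]
  gcongr
  exact k2 _ (mem_image_of_mem χ hx) _ (mem_image_of_mem χ hy)


/-! ### Mollification -/

theorem integrable_of_bounded {G : Type*} [NormedAddCommGroup G] {f : E N → G}
    (hm : AEStronglyMeasurable f volume) {C : ℝ}
    (hC : ∀ᵐ y, ‖f y‖ ≤ C) {K : Set (E N)} (hK : IsCompact K) (h0 : ∀ y, y ∉ K → f y = 0) :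
    Integrable f := by
  have h1 : IntegrableOn f K :=
    Measure.integrableOn_of_bounded hK.measure_lt_top.ne hm (ae_restrict_of_ae hC)
  exact (integrableOn_iff_integrable_of_support_subset fun y hy => by_contra fun h => hy (h0 y h)).1 h1

section Mollification

variable {G : Type*} [NormedAddCommGroup G] [NormedSpace ℝ G]

/-- A sequence of bump functions with shrinking support. -/
def bump (N k : ℕ) : ContDiffBump (0 : E N) where
  rIn := 1 / ((k : ℝ) + 1)
  rOut := 2 / ((k : ℝ) + 1)
  rIn_pos := by positivity
  rIn_lt_rOut := by gcongr; norm_num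

/-- The mollifier `ρ_k`, supported in the ball of radius `2 / (k + 1)`. -/
def mollifier (k : ℕ) (x : E N) : ℝ := (bump N k).normed volume x

/-- The mollification `ρ_k * f`. -/
def mollify (k : ℕ) (f : E N → G) (x : E N) : G := ∫ y, mollifier k (x - y) • f y

open scoped Convolution in
theorem mollify_eq_convolution (k : ℕ) (f : E N → G) :
    mollify k f = (mollifier k : E N → ℝ) ⋆[ContinuousLinearMap.lsmul ℝ ℝ, volume] f := by
  funext x
  rw [convolution_eq_swap]
  rfl

theorem mollifier_contDiff (k : ℕ) : ContDiff ℝ ∞ (mollifier k : E N → ℝ) :=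
  (bump N k).contDiff_normed

theorem mollifier_hasCompactSupport (k : ℕ) : HasCompactSupport (mollifier k : E N → ℝ) :=
  (bump N k).hasCompactSupport_normed

theorem mollifier_nonneg (k : ℕ) (x : E N) : 0 ≤ mollifier k x := (bump N k).nonneg_normed x

theorem tsupport_mollifier (k : ℕ) :
    tsupport (mollifier k : E N → ℝ) = Metric.closedBall 0 (2 / ((k : ℝ) + 1)) :=
  (bump N k).tsupport_normed_eq

theorem mollifier_sub_contDiff (k : ℕ) (x : E N) :
    ContDiff ℝ ∞ (fun y : E N => mollifier k (x - y)) :=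
  (mollifier_contDiff k).comp (contDiff_const.sub contDiff_id)

theorem tsupport_mollifier_sub (k : ℕ) (x : E N) :
    tsupport (fun y : E N => mollifier k (x - y)) ⊆ Metric.closedBall x (2 / ((k : ℝ) + 1)) := by
  refine closure_minimal ?_ Metric.isClosed_closedBall
  intro y hy
  have : x - y ∈ tsupport (mollifier k : E N → ℝ) := subset_tsupport _ hy
  rw [tsupport_mollifier, mem_closedBall_zero_iff] at this
  rwa [Metric.mem_closedBall, dist_comm, dist_eq_norm]

theorem mollifier_sub_hasCompactSupport (k : ℕ) (x : E N) :
    HasCompactSupport (fun y : E N => mollifier k (x - y)) :=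
  (isCompact_closedBall x _).of_isClosed_subset (isClosed_tsupport _) (tsupport_mollifier_sub k x)

theorem tendsto_two_div : Filter.Tendsto (fun k : ℕ => 2 / ((k : ℝ) + 1)) Filter.atTop (nhds 0) := by
  have := (tendsto_one_div_add_atTop_nhds_zero_nat (𝕜 := ℝ)).const_mul 2
  simpa [div_eq_mul_inv] using this

theorem mollify_contDiff (k : ℕ) {f : E N → G} (hf : LocallyIntegrable f) :
    ContDiff ℝ ∞ (mollify k f) := by
  rw [mollify_eq_convolution]
  exact (mollifier_hasCompactSupport k).contDiff_convolution_left _ (mollifier_contDiff k) hf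

/-- Convergence at Lebesgue points; it needs a bounded ratio of outer to inner radius of the bumps,
here constantly 2. -/
theorem ae_tendsto_mollify [CompleteSpace G] {f : E N → G} (hf : LocallyIntegrable f) :
    ∀ᵐ x, Filter.Tendsto (fun k => mollify k f x) Filter.atTop (nhds (f x)) := by
  have := ContDiffBump.ae_convolution_tendsto_right_of_locallyIntegrable (μ := volume)
    (φ := fun k => bump N k) (l := Filter.atTop) (K := 2) tendsto_two_div
    (Filter.Eventually.of_forall fun k => by simp only [bump]; exact le_of_eq (by ring)) hf
  filter_upwards [this] with x hx
  refine hx.congr fun k => ?_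
  rw [mollify_eq_convolution]
  rfl

theorem norm_mollify_le (k : ℕ) {f : E N → G} {C : ℝ} (hC : ∀ᵐ y, ‖f y‖ ≤ C) (x : E N) :
    ‖mollify k f x‖ ≤ C := by
  have h1 : ∫ y, mollifier k (x - y) * C = C := by
    rw [integral_mul_const, integral_sub_left_eq_self (fun y => mollifier k y) volume x]
    unfold mollifier
    rw [(bump N k).integral_normed, one_mul]
  refine (norm_integral_le_of_norm_le (g := fun y => mollifier k (x - y) * C) ?_ ?_).trans h1.le
  · refine Integrable.mul_const ?_ _
    exact (mollifier_sub_contDiff k x).continuous.integrable_of_hasCompactSupport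
      (mollifier_sub_hasCompactSupport k x)
  · filter_upwards [hC] with y hy
    rw [norm_smul, Real.norm_of_nonneg (mollifier_nonneg k _)]
    exact mul_le_mul_of_nonneg_left hy (mollifier_nonneg k _)

theorem mollify_eq_zero (k : ℕ) {f : E N → G} {K : Set (E N)} (hf : ∀ y, y ∉ K → f y = 0)
    {x : E N} (hx : x ∉ Metric.cthickening (2 / ((k : ℝ) + 1)) K) : mollify k f x = 0 := by
  unfold mollify
  rw [integral_eq_zero_of_ae]
  refine Filter.Eventually.of_forall fun y => ?_
  by_cases hy : y ∈ K
  · have : mollifier k (x - y) = 0 := by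
      by_contra h0
      have h1 : y ∈ Metric.closedBall x (2 / ((k : ℝ) + 1)) :=
        tsupport_mollifier_sub k x (subset_tsupport _ h0)
      exact hx (Metric.mem_cthickening_of_dist_le x y _ _ hy (by rwa [dist_comm]))
    simp [this]
  · simp [hf y hy]

/-- The derivative is moved to the variable `y`, which produces the sign: in this form it can be
compared with the definition of a weak gradient, with y ↦ ρ_k(x - y) as test function. -/
theorem fderiv_mollify_apply [CompleteSpace G] (k : ℕ) {f : E N → G} (hf : LocallyIntegrable f) (x v : E N) :
    fderiv ℝ (mollify k f) x v =
      -∫ y, fderiv ℝ (fun y => mollifier k (x - y)) y v • f y := by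
  have h1 := (mollifier_hasCompactSupport (N := N) k).hasFDerivAt_convolution_left
    (ContinuousLinearMap.lsmul ℝ ℝ) ((mollifier_contDiff k).of_le (by simp)) hf x
  rw [mollify_eq_convolution, h1.fderiv, convolution_eq_swap]
  have h2 : Integrable (fun t => ((ContinuousLinearMap.lsmul ℝ ℝ : ℝ →L[ℝ] G →L[ℝ] G).precompL (E N))
      (fderiv ℝ (mollifier k) (x - t)) (f t)) := by
    have := ((mollifier_hasCompactSupport (N := N) k).fderiv ℝ).convolutionExists_left
      ((ContinuousLinearMap.lsmul ℝ ℝ : ℝ →L[ℝ] G →L[ℝ] G).precompL (E N))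
      ((mollifier_contDiff k).continuous_fderiv (by simp)) hf x
    exact this.integrable_swap
  rw [ContinuousLinearMap.integral_apply h2, ← integral_neg]
  refine integral_congr_ae (Filter.Eventually.of_forall fun y => ?_)
  have h3 : fderiv ℝ (fun y => mollifier k (x - y)) y v = - fderiv ℝ (mollifier k) (x - y) v := by
    have hd : DifferentiableAt ℝ (mollifier k : E N → ℝ) (x - y) :=
      ((mollifier_contDiff k).differentiable (by simp)) _
    have := hd.hasFDerivAt.comp y ((hasFDerivAt_id y).const_sub x)
    have h4 : HasFDerivAt (fun y => mollifier k (x - y)) _ y := this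
    rw [h4.fderiv]
    simp
  simp only [h3, neg_smul, neg_neg]
  rfl

theorem exists_cthickening {K V : Set (E N)} (hK : IsCompact K) (hV : IsOpen V) (h : K ⊆ V) :
    ∃ L : Set (E N), IsCompact L ∧ L ⊆ V ∧
      ∀ᶠ k : ℕ in Filter.atTop, Metric.cthickening (2 / ((k : ℝ) + 1)) K ⊆ L := by
  obtain ⟨δ, hδ, h1⟩ := hK.exists_cthickening_subset_open hV h
  refine ⟨Metric.cthickening δ K, hK.cthickening, h1, ?_⟩
  filter_upwards [tendsto_two_div.eventually (gt_mem_nhds hδ)] with k hk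
  exact Metric.cthickening_mono hk.le _

theorem exists_cutoff {K V : Set (E N)} (hK : IsCompact K) (hV : IsOpen V) (h : K ⊆ V) :
    ∃ ζ : E N → ℝ, ContDiff ℝ ∞ ζ ∧ HasCompactSupport ζ ∧ tsupport ζ ⊆ V ∧
      ∀ᶠ x in nhdsSet K, ζ x = 1 := by
  obtain ⟨δ, hδ, h1⟩ := hK.exists_cthickening_subset_open hV h
  obtain ⟨f, hf1, hf2, -⟩ := exists_contMDiffMap_one_nhds_of_subset_interior
    (modelWithCornersSelf ℝ (E N)) (n := ⊤) hK.isClosed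
    (t := Metric.cthickening δ K)
    ((Metric.self_subset_thickening hδ K).trans
      (interior_maximal (Metric.thickening_subset_cthickening δ K) Metric.isOpen_thickening))
  have hs : tsupport f ⊆ Metric.cthickening δ K :=
    closure_minimal (fun x hx => by_contra fun h => hx (hf2 x h)) Metric.isClosed_cthickening
  exact ⟨f, f.contMDiff.contDiff, hK.cthickening.of_isClosed_subset (isClosed_tsupport _) hs,
    hs.trans h1, hf1⟩

end Mollification


/-! ### The chain rule for bi-Lipschitz maps -/

/-- The Jacobian determinant is bounded below by a positive constant almost everywhere, so norms for
`g dx` control norms for `dx`. -/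
theorem IsBiLipschitz.restrict_le_smul {U : Set (E N)} (hU : IsOpen U) {χ : E N → E N}
    (h : IsBiLipschitz U χ) : ∃ C : ℝ≥0, volume.restrict U ≤ C • weightedMeasure U χ := by
  obtain ⟨c, C₀, hc, -, h1⟩ := h.jacDet_bounds hU
  refine ⟨(c.toNNReal)⁻¹, ?_⟩
  intro s
  rw [Measure.smul_apply]
  have hle : c.toNNReal • volume.restrict U ≤ weightedMeasure U χ := by
    have e : c.toNNReal • volume.restrict U
        = (volume.restrict U).withDensity fun _ => (c.toNNReal : ℝ≥0∞) := by
      rw [withDensity_const]; rfl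
    rw [e, weightedMeasure]
    refine withDensity_mono ?_
    filter_upwards [h1] with x hx
    exact ENNReal.ofReal_le_ofReal hx.2.2.1
  have h2 := hle s
  rw [Measure.smul_apply] at h2
  have hc0 : c.toNNReal ≠ 0 := (Real.toNNReal_pos.2 hc).ne'
  calc (volume.restrict U) s = (c.toNNReal)⁻¹ • (c.toNNReal • (volume.restrict U) s) := by
        rw [smul_smul, inv_mul_cancel₀ hc0, one_smul]
    _ ≤ _ := by gcongr

theorem IsBiLipschitz.memLp_comp {V : Type*} [NormedAddCommGroup V] {U : Set (E N)} (hU : IsOpen U)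
    {χ : E N → E N} (h : IsBiLipschitz U χ) {f : E N → V} {p : ℝ≥0∞}
    (hf : MemLp f p (volume.restrict (χ '' U))) :
    MemLp (fun x => f (χ x)) p (volume.restrict U) := by
  obtain ⟨C, hC⟩ := h.restrict_le_smul hU
  refine MemLp.of_measure_le_smul (c := C) (by simp) hC
    ⟨?_, by rw [h.eLpNorm_weighted hU p hf.1]; exact hf.2⟩
  have hm := h.aestronglyMeasurable_comp hU hf.1
  exact hm.mono_ac (withDensity_absolutelyContinuous _ _)

theorem IsBiLipschitz.exists_eLpNorm_comp_le {U : Set (E N)} (hU : IsOpen U)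
    {χ : E N → E N} (h : IsBiLipschitz U χ) : ∃ C : ℝ≥0, ∀ {V : Type} [NormedAddCommGroup V]
    (f : E N → V), AEStronglyMeasurable f (volume.restrict (χ '' U)) →
      eLpNorm (fun x => f (χ x)) 2 (volume.restrict U) ≤
        C * eLpNorm f 2 (volume.restrict (χ '' U)) := by
  obtain ⟨C, hC⟩ := h.restrict_le_smul hU
  refine ⟨C ^ ((2 : ℝ)⁻¹), fun f hf => ?_⟩
  refine (eLpNorm_mono_measure _ hC).trans ?_
  have : (C • weightedMeasure U χ : Measure (E N)) = (C : ℝ≥0∞) • weightedMeasure U χ := rfl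
  rw [this, eLpNorm_smul_measure_of_ne_top (by simp), h.eLpNorm_weighted hU 2 hf]
  simp [ENNReal.coe_rpow_of_nonneg]

theorem fderiv_apply_stdVec (χ : E N → E N) (x : E N) (i : Fin N) :
    fderiv ℝ χ x (stdVec i) = ∑ j, jacobian χ x j i • stdVec j := by
  ext k
  simp [jacobian, stdVec, Pi.single_apply]

/-- The gradient of a composition: `(∇χ)ᵗ F(χ)`. -/
def pullGrad (χ : E N → E N) (F : E N → CVec N) (x : E N) : CVec N :=
  WithLp.toLp 2 fun i => ∑ j, (jacobian χ x j i : ℂ) * F (χ x) j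

theorem pullGrad_apply (χ : E N → E N) (F : E N → CVec N) (x : E N) (i : Fin N) :
    pullGrad χ F x i = ∑ j, (jacobian χ x j i : ℂ) * F (χ x) j := rfl

theorem norm_le_sum_norm (v : CVec N) : ‖v‖ ≤ ∑ i, ‖v i‖ := by
  have : v = ∑ i, EuclideanSpace.single i (v i) := by
    ext j
    simp [Pi.single_apply]
  calc ‖v‖ = ‖∑ i, EuclideanSpace.single i (v i)‖ := by rw [← this]
    _ ≤ ∑ i, ‖EuclideanSpace.single i (v i)‖ := norm_sum_le _ _
    _ = ∑ i, ‖v i‖ := by simp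

theorem norm_pullGrad_le (χ : E N → E N) (F : E N → CVec N) (x : E N) {C : ℝ}
    (hC : ∀ i j, |jacobian χ x i j| ≤ C) : ‖pullGrad χ F x‖ ≤ (N * (N * C)) * ‖F (χ x)‖ := by
  have h1 : ∀ i, ‖pullGrad χ F x i‖ ≤ N * C * ‖F (χ x)‖ := by
    intro i
    rw [pullGrad_apply]
    refine (norm_sum_le _ _).trans ?_
    calc ∑ j, ‖(jacobian χ x j i : ℂ) * F (χ x) j‖ ≤ ∑ _j : Fin N, C * ‖F (χ x)‖ := by
          refine Finset.sum_le_sum fun j _ => ?_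
          rw [norm_mul, Complex.norm_real]
          exact mul_le_mul (hC j i) (PiLp.norm_apply_le _ j) (norm_nonneg _)
            ((abs_nonneg _).trans (hC j i))
      _ = N * C * ‖F (χ x)‖ := by simp; ring
  calc ‖pullGrad χ F x‖ ≤ ∑ i, ‖pullGrad χ F x i‖ := norm_le_sum_norm _
    _ ≤ ∑ _i : Fin N, N * C * ‖F (χ x)‖ := Finset.sum_le_sum fun i _ => h1 i
    _ = _ := by simp; ring

theorem aestronglyMeasurable_coord {μ : Measure (E N)} {F : E N → CVec N}
    (h : AEStronglyMeasurable F μ) (i : Fin N) : AEStronglyMeasurable (fun x => F x i) μ := by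
  have h2 : Continuous (fun v : CVec N => v i) := by fun_prop
  exact h2.comp_aestronglyMeasurable h

theorem aestronglyMeasurable_of_coord {μ : Measure (E N)} {F : E N → CVec N}
    (h : ∀ i, AEStronglyMeasurable (fun x => F x i) μ) : AEStronglyMeasurable F μ := by
  have h1 : AEMeasurable (fun x i => F x i) μ := aemeasurable_pi_iff.2 fun i => (h i).aemeasurable
  have h2 := (PiLp.continuous_toLp 2 (fun _ : Fin N => ℂ)).measurable.comp_aemeasurable h1
  exact h2.aestronglyMeasurable

theorem IsBiLipschitz.aestronglyMeasurable_pullGrad {U : Set (E N)} (hU : IsOpen U)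
    {χ : E N → E N} (h : IsBiLipschitz U χ) {F : E N → CVec N}
    (hF : AEStronglyMeasurable F (volume.restrict (χ '' U))) :
    AEStronglyMeasurable (pullGrad χ F) (volume.restrict U) := by
  refine aestronglyMeasurable_of_coord fun i => ?_
  simp only [pullGrad_apply]
  refine Finset.aestronglyMeasurable_fun_sum _ fun j _ => ?_
  refine AEStronglyMeasurable.mul ?_ (aestronglyMeasurable_coord (h.aestronglyMeasurable_comp hU hF) j)
  exact (Complex.measurable_ofReal.comp (measurable_jacobian χ j i)).aestronglyMeasurable

theorem IsBiLipschitz.exists_norm_pullGrad_le {U : Set (E N)} (hU : IsOpen U)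
    {χ : E N → E N} (h : IsBiLipschitz U χ) : ∃ C : ℝ≥0, ∀ F : E N → CVec N,
      ∀ᵐ x ∂volume.restrict U, ‖pullGrad χ F x‖ ≤ C * ‖F (χ x)‖ := by
  obtain ⟨c₀, C, -, hC, h1⟩ := h.jacDet_bounds hU
  refine ⟨(N * (N * C.toNNReal)), fun F => ?_⟩
  filter_upwards [h1] with x hx
  have := norm_pullGrad_le χ F x hx.2.2.2.2
  simpa [Real.coe_toNNReal _ hC.le] using this

theorem IsBiLipschitz.memLp_pullGrad {U : Set (E N)} (hU : IsOpen U)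
    {χ : E N → E N} (h : IsBiLipschitz U χ) {F : E N → CVec N} {p : ℝ≥0∞}
    (hF : MemLp F p (volume.restrict (χ '' U))) :
    MemLp (pullGrad χ F) p (volume.restrict U) := by
  obtain ⟨C, hC⟩ := h.exists_norm_pullGrad_le hU
  exact (h.memLp_comp hU hF).of_le_mul (h.aestronglyMeasurable_pullGrad hU hF.1) (hC F)

/-- Integration by parts for the Lipschitz function θ ∘ χ' against `η`, followed by the classical
chain rule at differentiability points of `χ`. It says that the push-forward of ∂ᵢη dx is, as a
distribution, the divergence of the push-forward of the field η ∂ᵢχ. -/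
theorem IsBiLipschitz.integral_test {U : Set (E N)} (hU : IsOpen U) {χ : E N → E N}
    (h : IsBiLipschitz U χ) {η θ : E N → ℝ} (hη : ContDiff ℝ ∞ η) (hηc : HasCompactSupport η)
    (hηU : tsupport η ⊆ U) (hθ : ContDiff ℝ ∞ θ) (hθc : HasCompactSupport θ) (i : Fin N) :
    ∫ x in U, fderiv ℝ η x (stdVec i) * θ (χ x) =
      -∫ x in U, ∑ j, (η x * jacobian χ x j i) * fderiv ℝ θ (χ x) (stdVec j) := by
  obtain ⟨χ', ⟨K, hK⟩, he⟩ := h.exists_extension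
  obtain ⟨C, hC⟩ := hθ.lipschitzWith_of_hasCompactSupport hθc (by simp)
  obtain ⟨D, hD⟩ := hη.lipschitzWith_of_hasCompactSupport hηc (by simp)
  have key := LipschitzWith.integral_lineDeriv_mul_eq (μ := volume) (hC.comp hK) hD hηc (stdVec i)
  have hη0 : ∀ x, x ∉ U → η x = 0 := fun x hx => image_eq_zero_of_notMem_tsupport fun h => hx (hηU h)
  have hη1 : ∀ x, x ∉ U → fderiv ℝ η x = 0 := fun x hx => by
    have : x ∉ tsupport (fderiv ℝ η) := fun h => hx (hηU (tsupport_fderiv_subset ℝ h))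
    exact image_eq_zero_of_notMem_tsupport this
  have hl : ∀ x, lineDeriv ℝ η x (-stdVec i) = - fderiv ℝ η x (stdVec i) := fun x => by
    rw [((hη.differentiable (by simp)) x).lineDeriv_eq_fderiv, map_neg]
  rw [← setIntegral_eq_integral_of_forall_compl_eq_zero (s := U)
      (f := fun x => lineDeriv ℝ (θ ∘ χ') x (stdVec i) * η x),
    ← setIntegral_eq_integral_of_forall_compl_eq_zero (s := U)
      (f := fun x => lineDeriv ℝ η x (-stdVec i) * (θ ∘ χ') x)] at key
  · have e1 : ∫ x in U, lineDeriv ℝ η x (-stdVec i) * (θ ∘ χ') x =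
        -∫ x in U, fderiv ℝ η x (stdVec i) * θ (χ x) := by
      rw [← integral_neg]
      refine setIntegral_congr_fun hU.measurableSet fun x hx => ?_
      simp [hl, he hx]
    rw [e1] at key
    rw [← neg_neg (∫ x in U, fderiv ℝ η x (stdVec i) * θ (χ x)), ← key]
    congr 1
    refine integral_congr_ae ?_
    filter_upwards [h.ae_differentiableAt hU] with x ⟨hx, hd⟩
    have heq : χ' =ᶠ[nhds x] χ := by
      filter_upwards [hU.mem_nhds hx] with y hy using (he hy).symm
    have hθd : DifferentiableAt ℝ θ (χ x) := (hθ.differentiable (by simp)) _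
    have h1 : (θ ∘ χ') =ᶠ[nhds x] θ ∘ χ := heq.fun_comp θ
    have h2 : HasFDerivAt (θ ∘ χ') ((fderiv ℝ θ (χ x)).comp (fderiv ℝ χ x)) x :=
      (hθd.hasFDerivAt.comp x hd.hasFDerivAt).congr_of_eventuallyEq h1
    rw [(h2.hasLineDerivAt _).lineDeriv, ContinuousLinearMap.comp_apply, fderiv_apply_stdVec,
      map_sum, Finset.sum_mul]
    refine Finset.sum_congr rfl fun j _ => ?_
    rw [map_smul, smul_eq_mul]
    ring
  · intro x hx
    simp [hl, hη1 x hx]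
  · intro x hx
    simp [hη0 x hx]

/-- The density of the push-forward under `χ` of the measure `h dx` on `U`. -/
def pushDensity (U : Set (E N)) (χ : E N → E N) (f : E N → ℝ) : E N → ℝ :=
  (χ '' U).indicator fun y => f (invMap U χ y) / jacDet χ (invMap U χ y)

theorem IsBiLipschitz.pushDensity_apply {U : Set (E N)} {χ : E N → E N} (h : IsBiLipschitz U χ)
    (f : E N → ℝ) {x : E N} (hx : x ∈ U) : pushDensity U χ f (χ x) = f x / jacDet χ x := by
  rw [pushDensity, indicator_of_mem (mem_image_of_mem χ hx), h.invMap_apply hx]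

theorem pushDensity_eq_zero {U K : Set (E N)} {χ : E N → E N} (h : IsBiLipschitz U χ)
    {f : E N → ℝ} (hf : ∀ x, x ∉ K → f x = 0) (y : E N) (hy : y ∉ χ '' (U ∩ K)) :
    pushDensity U χ f y = 0 := by
  by_cases hyU : y ∈ χ '' U
  · obtain ⟨x, hx, rfl⟩ := hyU
    rw [h.pushDensity_apply f hx, hf x (fun hK => hy ⟨x, ⟨hx, hK⟩, rfl⟩), zero_div]
  · rw [pushDensity, indicator_of_notMem hyU]

theorem IsBiLipschitz.aestronglyMeasurable_pushDensity {U : Set (E N)} (hU : IsOpen U)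
    {χ : E N → E N} (h : IsBiLipschitz U χ) {f : E N → ℝ} (hf : Measurable f) :
    AEStronglyMeasurable (pushDensity U χ f) volume := by
  rw [pushDensity, aestronglyMeasurable_indicator_iff h.isOpen_image.measurableSet]
  exact (h.inverse hU).aestronglyMeasurable_comp h.isOpen_image
    (hf.div (measurable_jacDet χ)).aestronglyMeasurable

theorem IsBiLipschitz.pushDensity_bound {U : Set (E N)} (hU : IsOpen U)
    {χ : E N → E N} (h : IsBiLipschitz U χ) {f : E N → ℝ} {C : ℝ}
    (hf : ∀ᵐ x ∂volume.restrict U, |f x| ≤ C) : ∃ C', ∀ᵐ y, ‖pushDensity U χ f y‖ ≤ C' := by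
  obtain ⟨c, C₀, hc, -, h1⟩ := h.jacDet_bounds hU
  have h2 : ∀ᵐ x ∂volume.restrict U, |f x / jacDet χ x| ≤ C / c := by
    filter_upwards [h1, hf] with x hx hfx
    rw [abs_div, abs_of_nonneg (jacDet_nonneg χ x)]
    exact div_le_div₀ ((abs_nonneg _).trans hfx) hfx hc hx.2.2.1
  have h3 : ∀ᵐ x ∂volume.restrict (invMap U χ '' (χ '' U)), |f x / jacDet χ x| ≤ C / c := by
    rwa [h.invMap_image]
  have h4 := (h.inverse hU).ae_comp h.isOpen_image h3
  rw [ae_restrict_iff' h.isOpen_image.measurableSet] at h4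
  refine ⟨max (C / c) 0, ?_⟩
  filter_upwards [h4] with y hy
  by_cases hyU : y ∈ χ '' U
  · rw [pushDensity, indicator_of_mem hyU, Real.norm_eq_abs]
    exact (hy hyU).trans (le_max_left _ _)
  · rw [pushDensity, indicator_of_notMem hyU, norm_zero]
    exact le_max_right _ _

theorem IsBiLipschitz.integral_pushDensity {V : Type*} [NormedAddCommGroup V] [NormedSpace ℝ V]
    {U : Set (E N)} (hU : IsOpen U) {χ : E N → E N} (h : IsBiLipschitz U χ) {f : E N → ℝ}
    (hf : Measurable f) {u : E N → V} (hu : AEStronglyMeasurable u (volume.restrict (χ '' U))) :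
    ∫ y in χ '' U, pushDensity U χ f y • u y = ∫ x in U, f x • u (χ x) := by
  rw [h.integral_image hU (f := fun y => pushDensity U χ f y • u y)
    ((h.aestronglyMeasurable_pushDensity hU hf).restrict.smul hu)]
  refine integral_congr_ae ?_
  filter_upwards [h.ae_jacDet_pos hU, ae_restrict_mem hU.measurableSet] with x hx hxU
  rw [h.pushDensity_apply f hxU, smul_smul, mul_div_cancel₀ _ hx.ne']

/-- Dominated convergence: boundedness of `b` bounds all its mollifications and their supports
eventually lie in one compact set, so local integrability of `u` suffices. -/
theorem tendsto_integral_mollify_smul {V : Set (E N)} (hV : IsOpen V) {b : E N → ℝ}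
    (hb : AEStronglyMeasurable b volume) {C : ℝ} (hC : ∀ᵐ y, ‖b y‖ ≤ C) {K : Set (E N)}
    (hK : IsCompact K) (hKV : K ⊆ V) (h0 : ∀ y, y ∉ K → b y = 0) {u : E N → ℂ}
    (hu : LocallyIntegrableOn u V) :
    Filter.Tendsto (fun k => ∫ y in V, mollify k b y • u y) Filter.atTop
      (nhds (∫ y in V, b y • u y)) := by
  obtain ⟨L, hL, hLV, hk⟩ := exists_cthickening hK hV hKV
  have hbi : LocallyIntegrable b := (integrable_of_bounded hb hC hK h0).locallyIntegrable
  have huL : IntegrableOn u L := hu.integrableOn_compact_subset hLV hL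
  have huL2 : Integrable (L.indicator fun y => C * ‖u y‖) (volume.restrict V) :=
    ((integrable_indicator_iff hL.measurableSet).2 (huL.norm.const_mul C)).restrict
  have hum : AEStronglyMeasurable u (volume.restrict V) := hu.aestronglyMeasurable
  refine tendsto_integral_filter_of_dominated_convergence _ ?_ ?_ huL2 ?_
  · exact Filter.Eventually.of_forall fun k =>
      (mollify_contDiff k hbi).continuous.aestronglyMeasurable.smul hum
  · filter_upwards [hk] with k hk
    refine Filter.Eventually.of_forall fun y => ?_
    by_cases hy : y ∈ L
    · rw [indicator_of_mem hy, norm_smul]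
      exact mul_le_mul_of_nonneg_right (norm_mollify_le k hC y) (norm_nonneg _)
    · rw [indicator_of_notMem hy, mollify_eq_zero k h0 (fun h => hy (hk h)), zero_smul, norm_zero]
  · filter_upwards [ae_restrict_of_ae (ae_tendsto_mollify hbi)] with y hy
    exact hy.smul_const _

theorem mollify_test {V : Set (E N)} (hV : IsOpen V) {G : Type*} [NormedAddCommGroup G]
    [NormedSpace ℝ G] {b : E N → G} {K : Set (E N)}
    (hK : IsCompact K) (hKV : K ⊆ V) (h0 : ∀ y, y ∉ K → b y = 0) : ∀ᶠ k in Filter.atTop,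
      HasCompactSupport (mollify k b) ∧ tsupport (mollify k b) ⊆ V := by
  obtain ⟨L, hL, hLV, hk⟩ := exists_cthickening hK hV hKV
  filter_upwards [hk] with k hk
  have hs : tsupport (mollify k b) ⊆ L := by
    refine closure_minimal (fun _ hx => by_contra fun h => ?_) hL.isClosed
    exact hx (mollify_eq_zero k h0 (fun h2 => h (hk h2)))
  exact ⟨hL.of_isClosed_subset (isClosed_tsupport _) hs, hs.trans hLV⟩

theorem MemLp.locallyIntegrableOn_of_restrict {V : Type*} [NormedAddCommGroup V] {U : Set (E N)}
    {f : E N → V} (hf : MemLp f 2 (volume.restrict U)) : LocallyIntegrableOn f U :=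
  locallyIntegrableOn_of_locallyIntegrable_restrict (hf.locallyIntegrable (by norm_num))

theorem memLp_coord {μ : Measure (E N)} {F : E N → CVec N} {p : ℝ≥0∞}
    (h : MemLp F p μ) (i : Fin N) : MemLp (fun x => F x i) p μ :=
  h.of_le (aestronglyMeasurable_coord h.1 i) (Filter.Eventually.of_forall fun _ => PiLp.norm_apply_le _ i)

/-- The chain rule for a Sobolev function and a bi-Lipschitz map. -/
theorem IsBiLipschitz.comp_mem_sobolev {U : Set (E N)} (hU : IsOpen U) {χ : E N → E N}
    (h : IsBiLipschitz U χ) {q : (E N → ℂ) × (E N → CVec N)} (hq : q ∈ sobolev (χ '' U)) :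
    (q.1 ∘ χ, pullGrad χ q.2) ∈ sobolev U := by
  obtain ⟨hq1, hq2, hu, hF, hw⟩ := hq
  have m1 : MemLp (fun x => q.1 (χ x)) 2 (volume.restrict U) := h.memLp_comp hU hq1
  have m2 : MemLp (pullGrad χ q.2) 2 (volume.restrict U) := h.memLp_pullGrad hU hq2
  refine ⟨m1, m2, MemLp.locallyIntegrableOn_of_restrict m1,
    fun i => MemLp.locallyIntegrableOn_of_restrict (memLp_coord m2 i), ?_⟩
  intro η hη hηc hηU i
  have hV := h.isOpen_image
  set K := U ∩ tsupport η with hKdef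
  have hKeq : K = tsupport η := inter_eq_self_of_subset_right hηU
  have hK : IsCompact (χ '' K) := by
    rw [hKeq]
    obtain ⟨C, hC⟩ := h.lipschitz
    exact hηc.isCompact.image_of_continuousOn (hC.continuousOn.mono hηU)
  have hKV : χ '' K ⊆ χ '' U := image_mono inter_subset_left
  -- Duality replaces an approximation of the Sobolev function: the test function is pushed forward
  -- to χ(U). The densities of `f0` and `f j` there are bounded with compact support, but not
  -- smooth.
  set f0 : E N → ℝ := fun x => fderiv ℝ η x (stdVec i) with hf0
  set f : Fin N → E N → ℝ := fun j x => η x * jacobian χ x j i with hf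
  have f0c := continuous_partial hη (stdVec i)
  have hf0m : Measurable f0 := f0c.measurable
  have hfm : ∀ j, Measurable (f j) := fun j =>
    hη.continuous.measurable.mul (measurable_jacobian χ j i)
  have hf00 : ∀ x, x ∉ tsupport η → f0 x = 0 := fun x hx =>
    image_eq_zero_of_notMem_tsupport fun h => hx (tsupport_partial η (stdVec i) h)
  have hfj0 : ∀ j x, x ∉ tsupport η → f j x = 0 := fun j x hx => by
    simp [hf, image_eq_zero_of_notMem_tsupport hx]
  obtain ⟨c₀, C, -, hC, hb⟩ := h.jacDet_bounds hU
  obtain ⟨D0, hD0⟩ := f0c.bounded_above_of_compact_support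
    (hηc.of_isClosed_subset (isClosed_tsupport _) (tsupport_partial η (stdVec i)))
  obtain ⟨D, hD⟩ := hη.continuous.bounded_above_of_compact_support hηc
  obtain ⟨B0, hB0⟩ := h.pushDensity_bound hU (f := f0) (C := D0) (Filter.Eventually.of_forall hD0)
  have hBj : ∀ j, ∃ B, ∀ᵐ y, ‖pushDensity U χ (f j) y‖ ≤ B := fun j => by
    refine h.pushDensity_bound hU (f := f j) (C := D * C) ?_
    filter_upwards [hb] with x hx
    simp only [hf, abs_mul]
    exact mul_le_mul (hD x) (hx.2.2.2.2 j i) (abs_nonneg _) ((norm_nonneg _).trans (hD x))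
  choose B hB using hBj
  have hz0 := pushDensity_eq_zero h hf00
  have hzj := fun j => pushDensity_eq_zero h (hfj0 j)
  rw [← hKdef] at hz0
  have am0 := h.aestronglyMeasurable_pushDensity hU hf0m
  have amj := fun j => h.aestronglyMeasurable_pushDensity hU (hfm j)
  have li0 : LocallyIntegrable (pushDensity U χ f0) :=
    (integrable_of_bounded am0 hB0 hK hz0).locallyIntegrable
  have lij : ∀ j, LocallyIntegrable (pushDensity U χ (f j)) := fun j =>
    (integrable_of_bounded (amj j) (hB j) hK (hzj j)).locallyIntegrable
  have hoff : ∀ (g : E N → ℝ) (y : E N), y ∉ χ '' U → pushDensity U χ g y = 0 := fun g y hy => by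
    rw [pushDensity, indicator_of_notMem hy]
  -- `integral_test` states that the density of `f0` is the divergence of the densities of the `f j`
  -- in the sense of distributions. After mollification this is an identity of smooth functions, to
  -- which the weak gradient of `q.1` may be applied.
  have hdiv : ∀ k y, ∑ j, fderiv ℝ (mollify k (pushDensity U χ (f j))) y (stdVec j) =
      mollify k (pushDensity U χ f0) y := by
    intro k y
    have hθ := mollifier_sub_contDiff k y
    have hθc := mollifier_sub_hasCompactSupport k y
    have e1 : mollify k (pushDensity U χ f0) y = ∫ x in U, f0 x * mollifier k (y - χ x) := by
      have := h.integral_pushDensity hU hf0m (u := fun z => mollifier k (y - z))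
        hθ.continuous.aestronglyMeasurable
      simp only [smul_eq_mul] at this
      rw [← this, mollify, ← setIntegral_eq_integral_of_forall_compl_eq_zero (s := χ '' U)]
      · simp only [smul_eq_mul, mul_comm]
      · intro z hz
        simp [hoff _ z hz]
    have e2 : ∀ j, fderiv ℝ (mollify k (pushDensity U χ (f j))) y (stdVec j) =
        -∫ x in U, f j x * fderiv ℝ (fun z => mollifier k (y - z)) (χ x) (stdVec j) := by
      intro j
      have := h.integral_pushDensity hU (hfm j)
        (u := fun z => fderiv ℝ (fun z => mollifier k (y - z)) z (stdVec j))
        (continuous_partial hθ _).aestronglyMeasurable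
      simp only [smul_eq_mul] at this
      rw [fderiv_mollify_apply k (lij j), ← this,
        ← setIntegral_eq_integral_of_forall_compl_eq_zero (s := χ '' U)]
      · simp only [smul_eq_mul, mul_comm]
      · intro z hz
        simp [hoff _ z hz]
    rw [e1, h.integral_test hU hη hηc hηU hθ hθc i, integral_finsetSum, ← Finset.sum_neg_distrib]
    · exact Finset.sum_congr rfl fun j _ => e2 j
    · intro j _
      have hcont := continuous_partial hθ (stdVec j)
      obtain ⟨D', hD'⟩ := hcont.bounded_above_of_compact_support
        (hθc.of_isClosed_subset (isClosed_tsupport _) (tsupport_partial _ (stdVec j)))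
      have hint : Integrable (f j) (volume.restrict U) := by
        rw [← IntegrableOn, integrableOn_iff_integrable_of_support_subset]
        · refine integrable_of_bounded (K := tsupport η) (C := D * C)
            (f := U.indicator (f j)) ?_ ?_ hηc.isCompact ?_ |>.congr ?_
          · exact ((hfm j).indicator hU.measurableSet).aestronglyMeasurable
          · rw [ae_restrict_iff' hU.measurableSet] at hb
            filter_upwards [hb] with x hx
            by_cases hxU : x ∈ U
            · rw [indicator_of_mem hxU, Real.norm_eq_abs]
              simp only [hf, abs_mul]
              exact mul_le_mul (hD x) ((hx hxU).2.2.2.2 j i) (abs_nonneg _)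
                ((norm_nonneg _).trans (hD x))
            · rw [indicator_of_notMem hxU, norm_zero]
              exact mul_nonneg ((norm_nonneg _).trans (hD x)) hC.le
          · intro x hx
            simp [indicator, hfj0 j x hx]
          · refine Filter.Eventually.of_forall fun x => ?_
            by_cases hxU : x ∈ U
            · simp [hxU]
            · simp [hxU, hfj0 j x (fun h => hxU (hηU h))]
        · exact fun x hx => hηU (by_contra fun h => hx (hfj0 j x h))
      refine (hint.norm.mul_const D').mono' ?_ (Filter.Eventually.of_forall fun x => ?_)
      · refine (hfm j).aestronglyMeasurable.mul ?_
        exact h.aestronglyMeasurable_comp hU (f := fun z =>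
          fderiv ℝ (fun z => mollifier k (y - z)) z (stdVec j)) hcont.aestronglyMeasurable
      · rw [norm_mul]
        exact mul_le_mul_of_nonneg_left (hD' _) (norm_nonneg _)
  have hlim0 := tendsto_integral_mollify_smul hV am0 hB0 hK hKV hz0 hu
  have hlimj := fun j => tendsto_integral_mollify_smul hV (amj j) (hB j) hK hKV (hzj j) (hF j)
  have hsum := tendsto_finsetSum Finset.univ fun j _ => (hlimj j).neg
  have hev : ∀ᶠ k in Filter.atTop, ∑ j, -∫ y in χ '' U, mollify k (pushDensity U χ (f j)) y • q.2 y j =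
      ∫ y in χ '' U, mollify k (pushDensity U χ f0) y • q.1 y := by
    have := fun j => mollify_test hV hK hKV (hzj j)
    filter_upwards [Filter.eventually_all.2 this] with k hk
    have e := fun j => hw (mollify k (pushDensity U χ (f j))) (mollify_contDiff k (lij j))
      (hk j).1 (hk j).2 j
    simp_rw [← e, ← hdiv, Finset.sum_smul]
    rw [integral_finsetSum]
    intro j _
    have hs := tsupport_partial (mollify k (pushDensity U χ (f j))) (stdVec j)
    exact integrable_test_smul hu (continuous_partial (mollify_contDiff k (lij j)) _)
      ((hk j).1.of_isClosed_subset (isClosed_tsupport _) hs) (hs.trans (hk j).2)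
  -- The identity for mollified densities passes to the limit; a change of variables then brings
  -- both sides back to `U`.
  have hfin := tendsto_nhds_unique (hlim0.congr' (hev.mono fun k hk => hk.symm)) hsum
  rw [h.integral_pushDensity hU hf0m hu.aestronglyMeasurable] at hfin
  have e3 : ∀ j, ∫ y in χ '' U, pushDensity U χ (f j) y • q.2 y j = ∫ x in U, f j x • q.2 (χ x) j :=
    fun j => h.integral_pushDensity hU (hfm j) (hF j).aestronglyMeasurable
  simp_rw [e3] at hfin
  refine hfin.trans ?_
  rw [Finset.sum_neg_distrib, ← integral_finsetSum]
  · congr 1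
    refine integral_congr_ae (Filter.Eventually.of_forall fun x => ?_)
    simp only [pullGrad_apply, hf, Finset.smul_sum, Complex.real_smul, Complex.ofReal_mul]
    exact Finset.sum_congr rfl fun j _ => by ring
  · intro j _
    have hint : Integrable (fun x => η x • q.2 (χ x) j) (volume.restrict U) :=
      integrable_test_smul (MemLp.locallyIntegrableOn_of_restrict (memLp_coord (h.memLp_comp hU hq2) j))
        hη.continuous hηc hηU
    refine (hint.norm.const_mul C).mono' ?_ ?_
    · exact (hfm j).aestronglyMeasurable.smul
        (memLp_coord (h.memLp_comp hU hq2) j).1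
    · filter_upwards [hb] with x hx
      simp only [hf, norm_smul, norm_mul]
      have := hx.2.2.2.2 j i
      rw [mul_comm C, mul_right_comm]
      exact mul_le_mul_of_nonneg_left this (by positivity)


/-! ### Sobolev functions: uniqueness of gradients, test functions, pull-back of form domains -/

theorem mem_sobolev_congr {U : Set (E N)} {p p' : (E N → ℂ) × (E N → CVec N)}
    (hp : p ∈ sobolev U) (h1 : p.1 =ᵐ[volume.restrict U] p'.1)
    (h2 : p.2 =ᵐ[volume.restrict U] p'.2) : p' ∈ sobolev U := by
  obtain ⟨a, b, -, -, e⟩ := hp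
  have a' := a.ae_eq h1
  have b' := b.ae_eq h2
  refine ⟨a', b', MemLp.locallyIntegrableOn_of_restrict a',
    fun i => MemLp.locallyIntegrableOn_of_restrict (memLp_coord b' i), fun η k1 k2 k3 i => ?_⟩
  have e1 := e η k1 k2 k3 i
  have e2 : ∫ x in U, fderiv ℝ η x (stdVec i) • p.1 x = ∫ x in U, fderiv ℝ η x (stdVec i) • p'.1 x :=
    integral_congr_ae (by filter_upwards [h1] with x hx; rw [hx])
  have e3 : ∫ x in U, η x • p.2 x i = ∫ x in U, η x • p'.2 x i :=
    integral_congr_ae (by filter_upwards [h2] with x hx; rw [hx])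
  rw [← e2, e1, e3]

/-- The formulation with ε lets approximations be composed without extracting diagonal sequences. -/
theorem mem_sobolevZero_iff {U : Set (E N)} {p : (E N → ℂ) × (E N → CVec N)} :
    p ∈ sobolevZero U ↔ p ∈ sobolev U ∧ ∀ ε : ℝ≥0∞, ε ≠ 0 → ∃ η, IsTestFunction U η ∧
      eLpNorm (p.1 - η) 2 (volume.restrict U) ≤ ε ∧
      eLpNorm (p.2 - classicalGrad η) 2 (volume.restrict U) ≤ ε := by
  constructor
  · rintro ⟨hp, η, h1, h2, h3⟩
    refine ⟨hp, fun ε hε => ?_⟩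
    have hpos : 0 < ε := pos_iff_ne_zero.2 hε
    obtain ⟨k, hk1, hk2⟩ := ((h2.eventually (ge_mem_nhds hpos)).and
      (h3.eventually (ge_mem_nhds hpos))).exists
    exact ⟨η k, h1 k, hk1, hk2⟩
  · rintro ⟨hp, h⟩
    have h' := fun k : ℕ => h ((k : ℝ≥0∞)⁻¹) (by simp)
    choose η h1 h2 h3 using h'
    refine ⟨hp, η, h1, ?_, ?_⟩
    · exact tendsto_of_tendsto_of_tendsto_of_le_of_le tendsto_const_nhds
        ENNReal.tendsto_inv_nat_nhds_zero (fun _ => zero_le) h2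
    · exact tendsto_of_tendsto_of_tendsto_of_le_of_le tendsto_const_nhds
        ENNReal.tendsto_inv_nat_nhds_zero (fun _ => zero_le) h3

theorem IsWeakGradient.ae_unique {U : Set (E N)} (hU : IsOpen U) {u u' : E N → ℂ}
    {F F' : E N → CVec N} (h : IsWeakGradient U u F) (h' : IsWeakGradient U u' F')
    (hu : u =ᵐ[volume.restrict U] u') : F =ᵐ[volume.restrict U] F' := by
  have key : ∀ i, ∀ᵐ x, x ∈ U → F x i - F' x i = 0 := fun i => by
    refine hU.ae_eq_zero_of_integral_contDiff_smul_eq_zero ((h.2.1 i).sub (h'.2.1 i)) ?_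
    intro η h1 h2 h3
    have e1 := h.2.2 η h1 h2 h3 i
    have e2 := h'.2.2 η h1 h2 h3 i
    have e3 : ∫ x in U, fderiv ℝ η x (stdVec i) • u x = ∫ x in U, fderiv ℝ η x (stdVec i) • u' x :=
      integral_congr_ae (by filter_upwards [hu] with x hx; rw [hx])
    have e4 : ∫ x in U, η x • F x i = ∫ x in U, η x • F' x i := by
      rw [e1, e2] at e3
      exact neg_injective e3
    rw [← setIntegral_eq_integral_of_forall_compl_eq_zero (s := U)]
    · simp only [smul_sub]
      rw [integral_sub (integrable_test_smul (h.2.1 i) h1.continuous h2 h3)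
        (integrable_test_smul (h'.2.1 i) h1.continuous h2 h3), e4, sub_self]
    · intro x hx
      rw [image_eq_zero_of_notMem_tsupport (fun hh => hx (h3 hh)), zero_smul]
  rw [Filter.EventuallyEq, ae_restrict_iff' hU.measurableSet]
  filter_upwards [ae_all_iff.2 key] with x hx hxU
  ext i
  exact sub_eq_zero.1 (hx i hxU)

theorem IsTestFunction.mem_sobolev {U : Set (E N)} {η : E N → ℂ} (h : IsTestFunction U η) :
    (η, classicalGrad η) ∈ sobolev U := by
  obtain ⟨h1, h2, h3⟩ := h
  have hs : tsupport (classicalGrad η) ⊆ tsupport η := by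
    refine closure_minimal (fun x hx => by_contra fun hx2 => hx ?_) (isClosed_tsupport _)
    have : fderiv ℝ η x = 0 :=
      image_eq_zero_of_notMem_tsupport (fun h => hx2 (tsupport_fderiv_subset ℝ h))
    ext i
    simp [classicalGrad, this]
  have hg := continuous_classicalGrad h1
  have m1 : MemLp η 2 (volume.restrict U) := (h1.continuous.memLp_of_hasCompactSupport h2).restrict U
  have m2 : MemLp (classicalGrad η) 2 (volume.restrict U) :=
    (hg.memLp_of_hasCompactSupport (h2.of_isClosed_subset (isClosed_tsupport _) hs)).restrict U
  refine ⟨m1, m2, MemLp.locallyIntegrableOn_of_restrict m1,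
    fun i => MemLp.locallyIntegrableOn_of_restrict (memLp_coord m2 i), fun θ k1 k2 k3 i => ?_⟩
  have hc1 := continuous_partial k1 (stdVec i)
  have hc2 : Continuous (fun x => fderiv ℝ η x (stdVec i)) :=
    (h1.continuous_fderiv (by simp)).clm_apply continuous_const
  have key := integral_smul_fderiv_eq_neg_fderiv_smul_of_integrable (μ := volume) (f := θ) (g := η)
    (v := stdVec i)
    ((hc1.smul h1.continuous).integrable_of_hasCompactSupport h2.smul_left)
    ((k1.continuous.smul hc2).integrable_of_hasCompactSupport k2.smul_right)
    ((k1.continuous.smul h1.continuous).integrable_of_hasCompactSupport k2.smul_right)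
    (fun x _ => (k1.differentiable (by simp)) x) (fun x _ => (h1.differentiable (by simp)) x)
  have e1 : ∫ x in U, fderiv ℝ θ x (stdVec i) • η x = ∫ x, fderiv ℝ θ x (stdVec i) • η x :=
    setIntegral_eq_integral_of_forall_compl_eq_zero fun x hx => by
      rw [image_eq_zero_of_notMem_tsupport (fun hh => hx (h3 hh)), smul_zero]
  have e2 : ∫ x in U, θ x • classicalGrad η x i = ∫ x, θ x • fderiv ℝ η x (stdVec i) :=
    setIntegral_eq_integral_of_forall_compl_eq_zero fun x hx => by
      rw [image_eq_zero_of_notMem_tsupport (fun hh => hx (k3 hh)), zero_smul]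
  change ∫ x in U, fderiv ℝ θ x (stdVec i) • η x = -∫ x in U, θ x • classicalGrad η x i
  rw [e1, e2, key, neg_neg]

theorem IsTestFunction.mem_sobolevZero {U : Set (E N)} {η : E N → ℂ} (h : IsTestFunction U η) :
    (η, classicalGrad η) ∈ sobolevZero U :=
  mem_sobolevZero_iff.2 ⟨h.mem_sobolev, fun ε _ => ⟨η, h, by simp, by simp⟩⟩

theorem formDomain_le_sobolev (bc : BoundaryCondition) (U : Set (E N)) :
    formDomain bc U ≤ sobolev U := by
  cases bc
  · exact fun p hp => hp.1
  · exact le_rfl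

theorem IsTestFunction.mem_formDomain {U : Set (E N)} {η : E N → ℂ} (h : IsTestFunction U η)
    (bc : BoundaryCondition) : (η, classicalGrad η) ∈ formDomain bc U := by
  cases bc
  · exact h.mem_sobolevZero
  · exact h.mem_sobolev

/-- Dominated convergence again, with a constant on a compact set as the dominating function. -/
theorem tendsto_eLpNorm_sub_mollify {G : Type*} [NormedAddCommGroup G] [NormedSpace ℝ G]
    [CompleteSpace G] {b : E N → G} (hb : AEStronglyMeasurable b volume)
    {C : ℝ} (hC : ∀ᵐ y, ‖b y‖ ≤ C) {K : Set (E N)} (hK : IsCompact K)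
    (h0 : ∀ y, y ∉ K → b y = 0) (μ : Measure (E N)) (hμ : μ ≤ volume) :
    Filter.Tendsto (fun k => eLpNorm (b - mollify k b) 2 μ) Filter.atTop (nhds 0) := by
  obtain ⟨L, hL, -, hk⟩ := exists_cthickening hK isOpen_univ (subset_univ K)
  have hbi : LocallyIntegrable b := (integrable_of_bounded hb hC hK h0).locallyIntegrable
  have key : Filter.Tendsto (fun k => ∫⁻ x, ‖(b - mollify k b) x‖ₑ ^ (2 : ℝ)) Filter.atTop
      (nhds (∫⁻ _ : E N, 0)) := by
    refine tendsto_lintegral_filter_of_dominated_convergence'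
      ((L ∪ K).indicator fun _ => (ENNReal.ofReal (C + C)) ^ (2 : ℝ)) ?_ ?_ ?_ ?_
    · refine Filter.Eventually.of_forall fun k => ?_
      have := hb.sub (mollify_contDiff k hbi).continuous.aestronglyMeasurable
      exact this.enorm.pow_const _
    · filter_upwards [hk] with k hk
      filter_upwards [hC] with x hx
      by_cases hxL : x ∈ L ∪ K
      · rw [indicator_of_mem hxL]
        gcongr
        rw [← ofReal_norm]
        refine ENNReal.ofReal_le_ofReal ((norm_sub_le _ _).trans ?_)
        exact add_le_add hx (norm_mollify_le k hC x)
      · rw [indicator_of_notMem hxL]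
        have h1 : x ∉ L := fun h => hxL (Or.inl h)
        have h2 : x ∉ K := fun h => hxL (Or.inr h)
        simp [h0 x h2, mollify_eq_zero k h0 (fun h => h1 (hk h))]
    · rw [lintegral_indicator (hL.union hK).measurableSet, setLIntegral_const]
      exact ENNReal.mul_ne_top (by finiteness) (hL.union hK).measure_lt_top.ne
    · filter_upwards [ae_tendsto_mollify hbi] with x hx
      have h1 : Filter.Tendsto (fun k => (b - mollify k b) x) Filter.atTop (nhds 0) := by
        have := (tendsto_const_nhds (x := b x)).sub hx
        rwa [sub_self] at this
      have h2 := (ENNReal.continuous_rpow_const (y := 2)).continuousAt.tendsto.comp h1.enorm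
      simpa [Function.comp_def] using h2
  rw [lintegral_zero] at key
  have key2 := (ENNReal.continuous_rpow_const (y := 1 / 2)).continuousAt.tendsto.comp key
  rw [ENNReal.zero_rpow_of_pos (by norm_num)] at key2
  refine tendsto_of_tendsto_of_tendsto_of_le_of_le tendsto_const_nhds key2 (fun _ => zero_le)
    (fun k => (eLpNorm_mono_measure _ hμ).trans (le_of_eq ?_))
  rw [eLpNorm_eq_lintegral_rpow_enorm_toReal (by norm_num) (by norm_num)]
  simp

/-- A Sobolev function which is bounded, with bounded gradient, and vanishes outside of a compact
subset of `U` belongs to `W_0^{1,2}(U)`. -/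
theorem mem_sobolevZero_of_bounded {U : Set (E N)} (hU : IsOpen U)
    {p : (E N → ℂ) × (E N → CVec N)} (hp : p ∈ sobolev U) {K : Set (E N)} (hK : IsCompact K)
    (hKU : K ⊆ U) (h1 : ∀ y, y ∉ K → p.1 y = 0) (h2 : ∀ y, y ∉ K → p.2 y = 0) {C D : ℝ}
    (hC : ∀ᵐ y, ‖p.1 y‖ ≤ C) (hD : ∀ᵐ y, ‖p.2 y‖ ≤ D) : p ∈ sobolevZero U := by
  have ext0 : ∀ {V : Type} [NormedAddCommGroup V] (f : E N → V),
      AEStronglyMeasurable f (volume.restrict U) → (∀ y, y ∉ K → f y = 0) →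
      AEStronglyMeasurable f volume := by
    intro V _ f hf h0
    rw [← aestronglyMeasurable_indicator_iff hU.measurableSet] at hf
    convert! hf using 1
    funext x
    by_cases hx : x ∈ U
    · simp [hx]
    · simp [hx, h0 x (fun h => hx (hKU h))]
  have m1 := ext0 p.1 hp.1.1 h1
  have m2 := ext0 p.2 hp.2.1.1 h2
  have i1 := integrable_of_bounded m1 hC hK h1
  have i2 := integrable_of_bounded m2 hD hK h2
  obtain ⟨ζ, z1, z2, z3, z4⟩ := exists_cutoff hK hU hKU
  -- Multiplication by a cutoff equal to 1 near `K` frees the test function from its support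
  -- condition. Hence `p.2` is a weak gradient of `p.1` on the whole space, and mollification
  -- commutes with the gradient.
  have hw : ∀ θ : E N → ℝ, ContDiff ℝ ∞ θ → ∀ i,
      ∫ x, fderiv ℝ θ x (stdVec i) • p.1 x = -∫ x, θ x • p.2 x i := by
    intro θ hθ i
    have hs : tsupport (ζ * θ) ⊆ tsupport ζ := tsupport_mul_subset_left
    have e := hp.2.2.2.2 (ζ * θ) (z1.mul hθ) (z2.mul_right) (hs.trans z3) i
    rw [setIntegral_eq_integral_of_forall_compl_eq_zero,
      setIntegral_eq_integral_of_forall_compl_eq_zero] at e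
    · convert! e using 1
      · refine integral_congr_ae (Filter.Eventually.of_forall fun x => ?_)
        by_cases hx : x ∈ K
        · have hz : ζ =ᶠ[nhds x] fun _ => 1 := Filter.Eventually.filter_mono (nhds_le_nhdsSet hx) z4
          have : (ζ * θ) =ᶠ[nhds x] θ := by
            filter_upwards [hz] with y hy
            simp [hy]
          simp only [this.fderiv_eq]
        · simp [h1 x hx]
      · congr 1
        refine integral_congr_ae (Filter.Eventually.of_forall fun x => ?_)
        by_cases hx : x ∈ K
        · simp [z4.self_of_nhdsSet x hx]
        · simp [h2 x hx]
    · intro x hx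
      simp [h2 x (fun h => hx (hKU h))]
    · intro x hx
      simp [h1 x (fun h => hx (hKU h))]
  have hgrad : ∀ k, classicalGrad (mollify k p.1) = mollify k p.2 := by
    intro k
    funext x
    ext i
    have hθ := mollifier_sub_contDiff k x
    have e1 : classicalGrad (mollify k p.1) x i = fderiv ℝ (mollify k p.1) x (stdVec i) := rfl
    rw [e1, fderiv_mollify_apply k i1.locallyIntegrable, hw _ hθ, neg_neg]
    have i3 : Integrable (fun y => mollifier k (x - y) • p.2 y) := by
      obtain ⟨D', hD'⟩ := hθ.continuous.bounded_above_of_compact_support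
        (mollifier_sub_hasCompactSupport k x)
      exact i2.bdd_smul _ hθ.continuous.aestronglyMeasurable (Filter.Eventually.of_forall hD')
    have := (EuclideanSpace.proj (𝕜 := ℂ) i : CVec N →L[ℂ] ℂ).integral_comp_comm i3
    simpa [mollify] using this
  have t1 := tendsto_eLpNorm_sub_mollify m1 hC hK h1 _ (Measure.restrict_le_self (s := U))
  have t2 := tendsto_eLpNorm_sub_mollify m2 hD hK h2 _ (Measure.restrict_le_self (s := U))
  refine mem_sobolevZero_iff.2 ⟨hp, fun ε hε => ?_⟩
  have hpos : 0 < ε := pos_iff_ne_zero.2 hε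
  obtain ⟨k, hk1, hk2, hk3⟩ := ((t1.eventually (ge_mem_nhds hpos)).and
    ((t2.eventually (ge_mem_nhds hpos)).and (mollify_test hU hK hKU h1))).exists
  refine ⟨mollify k p.1, ⟨mollify_contDiff k i1.locallyIntegrable, hk3⟩, hk1, ?_⟩
  rw [hgrad]
  exact hk2

theorem pullGrad_sub (χ : E N → E N) (F G : E N → CVec N) :
    pullGrad χ F - pullGrad χ G = pullGrad χ (F - G) := by
  funext x
  ext i
  simp [pullGrad_apply, mul_sub]

theorem IsBiLipschitz.exists_eLpNorm_pullGrad_le {U : Set (E N)} (hU : IsOpen U)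
    {χ : E N → E N} (h : IsBiLipschitz U χ) : ∃ C : ℝ≥0, ∀ F : E N → CVec N,
      AEStronglyMeasurable F (volume.restrict (χ '' U)) →
      eLpNorm (pullGrad χ F) 2 (volume.restrict U) ≤
        C * eLpNorm F 2 (volume.restrict (χ '' U)) := by
  obtain ⟨C, hC⟩ := h.exists_norm_pullGrad_le hU
  obtain ⟨D, hD⟩ := h.exists_eLpNorm_comp_le hU
  refine ⟨C * D, fun F hF => ?_⟩
  calc eLpNorm (pullGrad χ F) 2 (volume.restrict U)
      ≤ C • eLpNorm (fun x => F (χ x)) 2 (volume.restrict U) :=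
        eLpNorm_le_nnreal_smul_eLpNorm_of_ae_le_mul (by
          filter_upwards [hC F] with x hx
          exact_mod_cast hx) 2
    _ ≤ C * (D * eLpNorm F 2 (volume.restrict (χ '' U))) := by
        rw [ENNReal.smul_def, smul_eq_mul]
        gcongr
        exact hD F hF
    _ = _ := by rw [ENNReal.coe_mul, mul_assoc]

/-- η ∘ χ is only Lipschitz, hence not a test function itself; but it is bounded with bounded
gradient, and vanishes in `U` off the compact preimage of the support of `η`. The indicators remove
the arbitrary values of `χ` off `U`. -/
theorem IsBiLipschitz.comp_test_mem_sobolevZero {U : Set (E N)} (hU : IsOpen U) {χ : E N → E N}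
    (h : IsBiLipschitz U χ) {η : E N → ℂ} (hη : IsTestFunction (χ '' U) η) :
    (U.indicator (η ∘ χ), U.indicator (pullGrad χ (classicalGrad η))) ∈ sobolevZero U := by
  have hs := h.comp_mem_sobolev hU hη.mem_sobolev
  have e1 : η ∘ χ =ᵐ[volume.restrict U] U.indicator (η ∘ χ) := by
    filter_upwards [ae_restrict_mem hU.measurableSet] with x hx
    rw [indicator_of_mem hx]
  have e2 : pullGrad χ (classicalGrad η) =ᵐ[volume.restrict U]
      U.indicator (pullGrad χ (classicalGrad η)) := by
    filter_upwards [ae_restrict_mem hU.measurableSet] with x hx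
    rw [indicator_of_mem hx]
  have hK : IsCompact (invMap U χ '' tsupport η) := by
    obtain ⟨C, hC⟩ := (h.inverse hU).lipschitz
    exact hη.2.1.isCompact.image_of_continuousOn (hC.continuousOn.mono hη.2.2)
  have hgz : ∀ y, y ∉ tsupport η → classicalGrad η y = 0 := fun y hy => by
    have : fderiv ℝ η y = 0 :=
      image_eq_zero_of_notMem_tsupport (fun h => hy (tsupport_fderiv_subset ℝ h))
    ext i
    simp [classicalGrad, this]
  have hgc : HasCompactSupport (classicalGrad η) :=
    HasCompactSupport.intro hη.2.1.isCompact hgz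
  obtain ⟨C, hC⟩ := hη.1.continuous.bounded_above_of_compact_support hη.2.1
  obtain ⟨D, hD⟩ := (continuous_classicalGrad hη.1).bounded_above_of_compact_support hgc
  obtain ⟨B, hB⟩ := h.exists_norm_pullGrad_le hU
  have hC0 : 0 ≤ C := (norm_nonneg _).trans (hC 0)
  have hD0 : 0 ≤ D := (norm_nonneg _).trans (hD 0)
  refine mem_sobolevZero_of_bounded hU (mem_sobolev_congr hs e1 e2) hK
    (C := C) (D := B * D) ?_ ?_ ?_ ?_ ?_
  · rintro _ ⟨y, hy, rfl⟩
    obtain ⟨x, hx, rfl⟩ := hη.2.2 hy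
    rwa [h.invMap_apply hx]
  · intro x hx
    by_cases hxU : x ∈ U
    · have : χ x ∉ tsupport η := fun hh => hx ⟨χ x, hh, h.invMap_apply hxU⟩
      simp [hxU, image_eq_zero_of_notMem_tsupport this]
    · simp [hxU]
  · intro x hx
    by_cases hxU : x ∈ U
    · have : χ x ∉ tsupport η := fun hh => hx ⟨χ x, hh, h.invMap_apply hxU⟩
      simp only [indicator_of_mem hxU]
      ext i
      simp [pullGrad_apply, hgz _ this]
    · simp [hxU]
  · refine Filter.Eventually.of_forall fun x => ?_
    by_cases hxU : x ∈ U
    · simpa [hxU] using hC (χ x)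
    · simpa [hxU] using hC0
  · have := hB (classicalGrad η)
    rw [ae_restrict_iff' hU.measurableSet] at this
    filter_upwards [this] with x hx
    by_cases hxU : x ∈ U
    · simp only [indicator_of_mem hxU]
      exact (hx hxU).trans (mul_le_mul_of_nonneg_left (hD _) B.2)
    · simp only [indicator_of_notMem hxU, norm_zero]
      exact mul_nonneg B.2 hD0

theorem IsBiLipschitz.comp_mem_sobolevZero {U : Set (E N)} (hU : IsOpen U) {χ : E N → E N}
    (h : IsBiLipschitz U χ) {q : (E N → ℂ) × (E N → CVec N)} (hq : q ∈ sobolevZero (χ '' U)) :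
    (q.1 ∘ χ, pullGrad χ q.2) ∈ sobolevZero U := by
  rw [mem_sobolevZero_iff] at hq ⊢
  obtain ⟨hqs, hqa⟩ := hq
  refine ⟨h.comp_mem_sobolev hU hqs, fun ε hε => ?_⟩
  obtain ⟨B, hB⟩ := h.exists_eLpNorm_comp_le hU
  obtain ⟨C, hC⟩ := h.exists_eLpNorm_pullGrad_le hU
  -- Half of ε pays for approximating `q` by a test function η on χ(U), where composition with `χ`
  -- loses a factor at most `D`; the other half for approximating η ∘ χ by a test function on `U`.
  -- The summand 1 keeps `D` non-zero.
  set D := B + C + 1 with hD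
  have hD0 : (D : ℝ≥0∞) ≠ 0 := by simp [hD]
  obtain ⟨η, h1, h2, h3⟩ := hqa (ε / 2 / D)
    (ENNReal.div_pos (ENNReal.div_pos hε (by simp)).ne' (by simp)).ne'
  obtain ⟨-, h4⟩ := mem_sobolevZero_iff.1 (h.comp_test_mem_sobolevZero hU h1)
  obtain ⟨ξ, k1, k2, k3⟩ := h4 (ε / 2) (ENNReal.div_pos hε (by simp)).ne'
  have hb : ∀ t : ℝ≥0, t ≤ D → (t : ℝ≥0∞) * (ε / 2 / D) ≤ ε / 2 := fun t ht => by
    calc (t : ℝ≥0∞) * (ε / 2 / D) ≤ D * (ε / 2 / D) := by gcongr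
      _ = ε / 2 := ENNReal.mul_div_cancel hD0 (by simp)
  have hin : ∀ {V : Type} [NormedAddCommGroup V] (f : E N → V),
      U.indicator f =ᵐ[volume.restrict U] f := fun f => by
    filter_upwards [ae_restrict_mem hU.measurableSet] with x hx
    rw [indicator_of_mem hx]
  have hηs := h1.mem_sobolev
  have hm1 : AEStronglyMeasurable (U.indicator (η ∘ χ)) (volume.restrict U) :=
    (h.comp_test_mem_sobolevZero hU h1).1.1.1
  have hm2 : AEStronglyMeasurable (U.indicator (pullGrad χ (classicalGrad η))) (volume.restrict U) :=
    (h.comp_test_mem_sobolevZero hU h1).1.2.1.1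
  refine ⟨ξ, k1, ?_, ?_⟩
  · have e : q.1 ∘ χ - ξ = (q.1 ∘ χ - U.indicator (η ∘ χ)) + (U.indicator (η ∘ χ) - ξ) := by abel
    dsimp only
    rw [e]
    refine (eLpNorm_add_le ((h.memLp_comp hU hqs.1).1.sub hm1)
      (hm1.sub k1.1.continuous.aestronglyMeasurable) (by norm_num)).trans ?_
    refine (add_le_add ?_ k2).trans (ENNReal.add_halves ε).le
    have e2 : q.1 ∘ χ - U.indicator (η ∘ χ) =ᵐ[volume.restrict U] fun x => (q.1 - η) (χ x) := by
      filter_upwards [hin (η ∘ χ)] with x hx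
      simp [hx]
    refine (eLpNorm_congr_ae e2).trans_le ?_
    refine (hB (q.1 - η) (hqs.1.1.sub hηs.1.1)).trans (le_trans ?_ (hb B ?_))
    · gcongr
    · rw [hD, add_assoc]; exact le_self_add
  · have e : pullGrad χ q.2 - classicalGrad ξ =
      (pullGrad χ q.2 - U.indicator (pullGrad χ (classicalGrad η))) +
        (U.indicator (pullGrad χ (classicalGrad η)) - classicalGrad ξ) := by abel
    dsimp only
    rw [e]
    refine (eLpNorm_add_le ((h.memLp_pullGrad hU hqs.2.1).1.sub hm2)
      (hm2.sub (continuous_classicalGrad k1.1).aestronglyMeasurable) (by norm_num)).trans ?_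
    refine (add_le_add ?_ k3).trans (ENNReal.add_halves ε).le
    have e2 : pullGrad χ q.2 - U.indicator (pullGrad χ (classicalGrad η)) =ᵐ[volume.restrict U]
        pullGrad χ (q.2 - classicalGrad η) := by
      rw [← pullGrad_sub]
      exact Filter.EventuallyEq.rfl.sub (hin _)
    rw [eLpNorm_congr_ae e2]
    refine (hC _ (hqs.2.1.1.sub hηs.2.1.1)).trans (le_trans ?_ (hb C ?_))
    · gcongr
    · rw [hD, add_assoc, add_left_comm]; exact le_self_add

theorem IsBiLipschitz.comp_mem_formDomain {U : Set (E N)} (hU : IsOpen U) {χ : E N → E N}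
    (h : IsBiLipschitz U χ) {bc : BoundaryCondition} {q : (E N → ℂ) × (E N → CVec N)}
    (hq : q ∈ formDomain bc (χ '' U)) : (q.1 ∘ χ, pullGrad χ q.2) ∈ formDomain bc U := by
  cases bc
  · exact h.comp_mem_sobolevZero hU hq
  · exact h.comp_mem_sobolev hU hq

/-- An element of the pulled-back form domain comes from the form domain on the image. -/
theorem exists_of_mem_pullbackDomain {bc : BoundaryCondition} {U : Set (E N)} (hU : IsOpen U)
    {χ : E N → E N} (h : IsBiLipschitz U χ) {p : (E N → ℂ) × (E N → CVec N)}
    (hp : p ∈ pullbackDomain bc U χ) : ∃ q ∈ formDomain bc (χ '' U),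
      p.1 =ᵐ[volume.restrict U] (fun x => q.1 (χ x)) ∧ p.2 =ᵐ[volume.restrict U] pullGrad χ q.2 := by
  obtain ⟨hw, q, hq, hpq⟩ := hp
  have hs := h.comp_mem_sobolev hU (formDomain_le_sobolev bc _ hq)
  exact ⟨q, hq, hpq, hw.ae_unique hU hs.2.2 hpq⟩

theorem pullback_mem_pullbackDomain {bc : BoundaryCondition} {U : Set (E N)} (hU : IsOpen U)
    {χ : E N → E N} (h : IsBiLipschitz U χ) {q : (E N → ℂ) × (E N → CVec N)}
    (hq : q ∈ formDomain bc (χ '' U)) : (q.1 ∘ χ, pullGrad χ q.2) ∈ pullbackDomain bc U χ :=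
  ⟨(h.comp_mem_sobolev hU (formDomain_le_sobolev bc _ hq)).2.2, q, hq, Filter.EventuallyEq.rfl⟩

/-- A function v ∘ φ equals (v ∘ φ ∘ φ̃⁻¹) ∘ φ̃, and the transition map φ ∘ φ̃⁻¹ between the two
images is bi-Lipschitz, so it preserves the form domain. -/
theorem pullbackDomain_le {bc : BoundaryCondition} {U : Set (E N)} (hU : IsOpen U)
    {φ φt : E N → E N} (h : IsBiLipschitz U φ) (ht : IsBiLipschitz U φt) :
    pullbackDomain bc U φ ≤ pullbackDomain bc U φt := by
  rintro p ⟨hw, q, hq, hpq⟩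
  refine ⟨hw, ?_⟩
  have hinv := ht.inverse hU
  have h1 : IsBiLipschitz (φt '' U) (φ ∘ invMap U φt) :=
    hinv.comp (by rwa [ht.invMap_image])
  have himg : (φ ∘ invMap U φt) '' (φt '' U) = φ '' U := by
    rw [image_comp, ht.invMap_image]
  refine ⟨_, h1.comp_mem_formDomain ht.isOpen_image (by rwa [himg]), ?_⟩
  filter_upwards [hpq, ae_restrict_mem hU.measurableSet] with x hx hxU
  rw [hx]
  simp [ht.invMap_apply hxU]

theorem pullbackDomain_eq {bc : BoundaryCondition} {U : Set (E N)} (hU : IsOpen U)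
    {φ φt : E N → E N} (h : IsBiLipschitz U φ) (ht : IsBiLipschitz U φt) :
    pullbackDomain bc U φ = pullbackDomain bc U φt :=
  le_antisymm (pullbackDomain_le hU h ht) (pullbackDomain_le hU ht h)

/-- Near an interior point the mollifications of `u` have vanishing classical gradient, so they are
constant on a ball; their almost everywhere limit is constant as well. -/
theorem exists_ball_ae_const {U : Set (E N)} (hU : IsOpen U) {u : E N → ℂ} {F : E N → CVec N}
    (h : IsWeakGradient U u F) (hF : F =ᵐ[volume.restrict U] 0) {x₀ : E N} (hx₀ : x₀ ∈ U) :
    ∃ r > 0, ∃ c : ℂ, ∀ᵐ y ∂volume.restrict (Metric.ball x₀ r), u y = c := by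
  obtain ⟨R, hR, hRU⟩ := Metric.isOpen_iff.1 hU x₀ hx₀
  -- Points within `r` of a point of the `r`-ball stay in the closed ball of radius `2 * r`, which
  -- is compact in `U`: kernels of radius below `r` are then admissible test functions.
  set r := R / 3 with hr
  have hr0 : 0 < r := by positivity
  have hsub : Metric.closedBall x₀ (2 * r) ⊆ U :=
    (Metric.closedBall_subset_ball (by rw [hr]; linarith)).trans hRU
  refine ⟨r, hr0, ?_⟩
  set v := (Metric.closedBall x₀ (2 * r)).indicator u with hv
  have hvi : LocallyIntegrable v := by
    have : IntegrableOn u (Metric.closedBall x₀ (2 * r)) :=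
      h.1.integrableOn_compact_subset hsub (isCompact_closedBall _ _)
    exact ((integrable_indicator_iff Metric.isClosed_closedBall.measurableSet).2 this).locallyIntegrable
  have hconst : ∀ᶠ k : ℕ in Filter.atTop, ∀ x ∈ Metric.ball x₀ r, ∀ y ∈ Metric.ball x₀ r,
      mollify k v x = mollify k v y := by
    filter_upwards [tendsto_two_div.eventually (gt_mem_nhds hr0)] with k hk x hx y hy
    have hd : ContDiff ℝ ∞ (mollify k v) := mollify_contDiff k hvi
    refine Metric.isOpen_ball.is_const_of_fderiv_eq_zero (𝕜 := ℝ)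
      (convex_ball x₀ r).isPreconnected (hd.differentiable (by simp)).differentiableOn ?_ hx hy
    intro z hz
    have hball : Metric.closedBall z (2 / ((k : ℝ) + 1)) ⊆ Metric.closedBall x₀ (2 * r) := by
      intro t ht
      rw [Metric.mem_closedBall] at ht ⊢
      rw [Metric.mem_ball] at hz
      linarith [dist_triangle t z x₀]
    have hθ := mollifier_sub_contDiff k z
    have hθs := (tsupport_mollifier_sub k z).trans hball
    refine ContinuousLinearMap.coe_injective
      ((EuclideanSpace.basisFun (Fin N) ℝ).toBasis.ext fun i => ?_)
    rw [ContinuousLinearMap.coe_coe, Pi.zero_apply, ContinuousLinearMap.toLinearMap_zero,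
      LinearMap.zero_apply]
    have e0 : (EuclideanSpace.basisFun (Fin N) ℝ).toBasis i = stdVec i := by simp [stdVec]
    rw [e0, fderiv_mollify_apply k hvi]
    have e1 := h.2.2 _ hθ (mollifier_sub_hasCompactSupport k z) (hθs.trans hsub) i
    have e2 : ∫ y in U, mollifier k (z - y) • F y i = 0 := by
      refine integral_eq_zero_of_ae ?_
      filter_upwards [hF] with y hy
      simp [hy]
    rw [e2, setIntegral_eq_integral_of_forall_compl_eq_zero] at e1
    · have e3 : ∀ y, fderiv ℝ (fun y => mollifier k (z - y)) y (stdVec i) • v y =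
          fderiv ℝ (fun y => mollifier k (z - y)) y (stdVec i) • u y := fun y => by
        by_cases hy : y ∈ Metric.closedBall x₀ (2 * r)
        · simp [hv, hy]
        · rw [image_eq_zero_of_notMem_tsupport
            (fun hh => hy (hθs (tsupport_partial _ (stdVec i) hh))), zero_smul, zero_smul]
      simp_rw [e3, e1]
      simp
    · intro y hy
      rw [image_eq_zero_of_notMem_tsupport
        (fun hh => hy (hsub (hθs (tsupport_partial _ (stdVec i) hh)))), zero_smul]
  have hae : ∀ᵐ y ∂volume.restrict (Metric.ball x₀ r), y ∈ Metric.ball x₀ r ∧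
      Filter.Tendsto (fun k => mollify k v y) Filter.atTop (nhds (u y)) := by
    filter_upwards [ae_restrict_of_ae (ae_tendsto_mollify hvi),
      ae_restrict_mem Metric.isOpen_ball.measurableSet] with y hy hyb
    refine ⟨hyb, ?_⟩
    have : y ∈ Metric.closedBall x₀ (2 * r) := by
      rw [Metric.mem_ball] at hyb
      rw [Metric.mem_closedBall]
      linarith
    rwa [hv, indicator_of_mem this] at hy
  have hne : (ae (volume.restrict (Metric.ball x₀ r))).NeBot := by
    rw [ae_restrict_neBot]
    exact (Metric.measure_ball_pos volume x₀ hr0).ne'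
  obtain ⟨y₀, hy₀, hlim₀⟩ := hae.exists
  refine ⟨u y₀, ?_⟩
  filter_upwards [hae] with y ⟨hy, hlim⟩
  refine tendsto_nhds_unique (hlim.congr' ?_) hlim₀
  filter_upwards [hconst] with k hk
  exact hk y hy y₀ hy₀

/-- A function with vanishing weak gradient in a connected open set is constant. -/
theorem ae_const_of_weakGradient_eq_zero {U : Set (E N)} (hU : IsOpen U) (hc : IsConnected U)
    {u : E N → ℂ} {F : E N → CVec N} (h : IsWeakGradient U u F)
    (hF : F =ᵐ[volume.restrict U] 0) : ∃ c : ℂ, u =ᵐ[volume.restrict U] fun _ => c := by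
  have hl : ∀ x : E N, ∃ r > 0, ∃ c : ℂ, x ∈ U →
      ∀ᵐ y ∂volume.restrict (Metric.ball x r), u y = c := fun x => by
    by_cases hx : x ∈ U
    · obtain ⟨r, hr, c, h1⟩ := exists_ball_ae_const hU h hF hx
      exact ⟨r, hr, c, fun _ => h1⟩
    · exact ⟨1, one_pos, 0, fun h => absurd h hx⟩
  choose r hr c hcc using hl
  obtain ⟨x₀, hx₀⟩ := hc.nonempty
  have hall : ∀ x ∈ U, c x = c x₀ := by
    intro x hx
    refine hc.isPreconnected.induction₂ (fun x y => c x = c y) ?_ (fun _ _ _ _ _ _ h1 h2 => h1.trans h2)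
      (fun _ _ _ _ h => h.symm) hx hx₀
    intro x hx
    filter_upwards [self_mem_nhdsWithin, mem_nhdsWithin_of_mem_nhds (Metric.ball_mem_nhds x (hr x))]
      with y hyU hyb
    -- The balls around neighbouring points overlap in a set of positive measure, where both
    -- constants are attained; connectedness propagates the equality.
    set O := Metric.ball x (r x) ∩ Metric.ball y (r y) with hO
    have hOo : IsOpen O := Metric.isOpen_ball.inter Metric.isOpen_ball
    have hne : (ae (volume.restrict O)).NeBot := by
      rw [ae_restrict_neBot]
      exact (hOo.measure_pos volume ⟨y, hyb, Metric.mem_ball_self (hr y)⟩).ne'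
    have h1 := ae_restrict_of_ae_restrict_of_subset (inter_subset_left : O ⊆ _) (hcc x hx)
    have h2 := ae_restrict_of_ae_restrict_of_subset (inter_subset_right : O ⊆ _) (hcc y hyU)
    obtain ⟨z, hz1, hz2⟩ := (h1.and h2).exists
    rw [← hz1, ← hz2]
  refine ⟨c x₀, ?_⟩
  rw [Filter.EventuallyEq, ae_restrict_iff' hU.measurableSet, ae_iff]
  refine measure_null_of_locally_null _ fun x hx => ?_
  have hxU : x ∈ U := by
    by_contra h
    exact hx (fun h' => absurd h' h)
  refine ⟨{a | ¬(a ∈ U → u a = c x₀)} ∩ Metric.ball x (r x), ?_, ?_⟩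
  · exact Filter.inter_mem self_mem_nhdsWithin
      (mem_nhdsWithin_of_mem_nhds (Metric.ball_mem_nhds x (hr x)))
  · have h1 := hcc x hxU
    rw [ae_restrict_iff' Metric.isOpen_ball.measurableSet] at h1
    refine measure_mono_null ?_ h1
    rintro y ⟨hy1, hy2⟩ hy3
    exact hy1 fun _ => by rw [hy3 hy2, hall x hxU]

/-- A square integrable function which is orthogonal to all test functions vanishes. -/
theorem eq_zero_of_forall_test {U : Set (E N)} (hU : IsOpen U) {f : Lp ℂ 2 (volume.restrict U)}
    (h : ∀ η : E N → ℝ, ContDiff ℝ ∞ η → HasCompactSupport η → tsupport η ⊆ U →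
      ∫ x in U, η x • f x = 0) : f = 0 := by
  have hl : LocallyIntegrableOn f U := MemLp.locallyIntegrableOn_of_restrict (Lp.memLp f)
  have := hU.ae_eq_zero_of_integral_contDiff_smul_eq_zero hl (fun η h1 h2 h3 => by
    rw [← setIntegral_eq_integral_of_forall_compl_eq_zero (s := U)]
    · exact h η h1 h2 h3
    · intro x hx
      rw [image_eq_zero_of_notMem_tsupport (fun hh => hx (h3 hh)), zero_smul])
  rw [Lp.eq_zero_iff_ae_eq_zero, Filter.EventuallyEq, ae_restrict_iff' hU.measurableSet]
  exact this


/-! ### Perturbation of eigenvalues and eigenvectors of quadratic forms -/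

section FormPerturbation

variable {V H : Type*} [AddCommGroup V] [Module ℂ V] [NormedAddCommGroup H] [InnerProductSpace ℂ H]

/-- A non-negative Hermitian form. -/
structure IsNonnegForm (q : V →ₗ⋆[ℂ] V →ₗ[ℂ] ℂ) : Prop where
  symm : ∀ x y, conj (q x y) = q y x
  nonneg : ∀ x, 0 ≤ (q x x).re

/-- `x` is an eigenvector of the form `q` relative to `‖J ·‖²`, for the eigenvalue `t`. -/
def IsFormEigen (q : V →ₗ⋆[ℂ] V →ₗ[ℂ] ℂ) (J : V →ₗ[ℂ] H) (t : ℝ) (x : V) : Prop :=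
  ∀ y, q y x = t * inner ℂ (J y) (J x)

/-- A complete orthonormal system of eigenvectors of a form, in increasing order. -/
structure IsEigenbasis (q : V →ₗ⋆[ℂ] V →ₗ[ℂ] ℂ) (J : V →ₗ[ℂ] H) (lam : ℕ → ℝ) (e : ℕ → V) :
    Prop where
  eigen : ∀ k, IsFormEigen q J (lam k) (e k)
  orthonormal : Orthonormal ℂ fun k => J (e k)
  complete : ∀ h : H, (∀ k, inner ℂ (J (e k)) h = 0) → h = 0
  mono : Monotone lam

theorem IsFormEigen.nonneg {q : V →ₗ⋆[ℂ] V →ₗ[ℂ] ℂ} (hq : IsNonnegForm q) {J : V →ₗ[ℂ] H} {t : ℝ}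
    {x : V} (h : IsFormEigen q J t x) (hx : ‖J x‖ = 1) : 0 ≤ t := by
  have h1 := hq.nonneg x
  rw [h x, inner_self_eq_norm_sq_to_K, hx] at h1
  simpa using h1

theorem IsFormEigen.inner_eq_zero {q : V →ₗ⋆[ℂ] V →ₗ[ℂ] ℂ} (hq : IsNonnegForm q) {J : V →ₗ[ℂ] H}
    {t t' : ℝ} {x x' : V} (h : IsFormEigen q J t x) (h' : IsFormEigen q J t' x') (hne : t ≠ t') :
    inner ℂ (J x) (J x') = 0 := by
  have h1 := hq.symm x' x
  rw [h x', h' x, map_mul, Complex.conj_ofReal, inner_conj_symm, ← sub_eq_zero, ← sub_mul] at h1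
  rcases mul_eq_zero.1 h1 with h2 | h2
  · rw [← Complex.ofReal_sub, Complex.ofReal_eq_zero, sub_eq_zero] at h2
    exact absurd h2 hne
  · exact h2

theorem IsEigenbasis.apply_sum {q : V →ₗ⋆[ℂ] V →ₗ[ℂ] ℂ} {J : V →ₗ[ℂ] H} {ι : Type*} {t : ι → ℝ}
    {e : ι → V} (h : ∀ k, IsFormEigen q J (t k) (e k)) (s : Finset ι) (c : ι → ℂ) (y : V) :
    q y (∑ k ∈ s, c k • e k) = ∑ k ∈ s, (c k * t k) * inner ℂ (J y) (J (e k)) := by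
  rw [map_sum]
  refine Finset.sum_congr rfl fun k _ => ?_
  rw [map_smul, h k y, smul_eq_mul, mul_assoc]

theorem IsEigenbasis.apply_sum_sum {q : V →ₗ⋆[ℂ] V →ₗ[ℂ] ℂ} {J : V →ₗ[ℂ] H} {ι : Type*} {t : ι → ℝ}
    {e : ι → V} (h : ∀ k, IsFormEigen q J (t k) (e k)) (ho : Orthonormal ℂ fun k => J (e k))
    (s : Finset ι) (c : ι → ℂ) :
    (q (∑ k ∈ s, c k • e k) (∑ k ∈ s, c k • e k)).re = ∑ k ∈ s, t k * ‖c k‖ ^ 2 := by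
  rw [IsEigenbasis.apply_sum h, Complex.re_sum]
  refine Finset.sum_congr rfl fun k hk => ?_
  have : J (∑ k ∈ s, c k • e k) = ∑ k ∈ s, c k • J (e k) := by simp
  rw [this, ho.inner_left_sum c hk]
  have h2 : c k * (t k : ℂ) * conj (c k) = ((t k * ‖c k‖ ^ 2 : ℝ) : ℂ) := by
    rw [mul_right_comm, Complex.mul_conj, Complex.normSq_eq_norm_sq]
    push_cast
    ring
  rw [h2, Complex.ofReal_re]

theorem norm_sq_sum_smul {ι : Type*} {ψ : ι → H} (ho : Orthonormal ℂ ψ) (s : Finset ι) (c : ι → ℂ) :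
    ‖∑ k ∈ s, c k • ψ k‖ ^ 2 = ∑ k ∈ s, ‖c k‖ ^ 2 := by
  have h1 := ho.inner_sum c c s
  rw [inner_self_eq_norm_sq_to_K] at h1
  have h2 : ∑ k ∈ s, conj (c k) * c k = ((∑ k ∈ s, ‖c k‖ ^ 2 : ℝ) : ℂ) := by
    push_cast
    refine Finset.sum_congr rfl fun k _ => ?_
    rw [Complex.conj_mul']
  rw [h2] at h1
  have h3 : ((‖∑ k ∈ s, c k • ψ k‖ : ℝ) : ℂ) ^ 2 = ((∑ k ∈ s, ‖c k‖ ^ 2 : ℝ) : ℂ) := h1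
  exact_mod_cast h3

/-- Bessel's inequality for the form. -/
theorem IsEigenbasis.bessel {q : V →ₗ⋆[ℂ] V →ₗ[ℂ] ℂ} (hq : IsNonnegForm q) {J : V →ₗ[ℂ] H}
    {lam : ℕ → ℝ} {e : ℕ → V} (h : IsEigenbasis q J lam e) (s : Finset ℕ) (x : V) :
    ∑ k ∈ s, lam k * ‖inner ℂ (J (e k)) (J x)‖ ^ 2 ≤ (q x x).re := by
  set c : ℕ → ℂ := fun k => inner ℂ (J (e k)) (J x) with hc
  set z := ∑ k ∈ s, c k • e k with hz
  have h1 := hq.nonneg (x - z)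
  have h2 : (q z z).re = ∑ k ∈ s, lam k * ‖c k‖ ^ 2 :=
    IsEigenbasis.apply_sum_sum h.eigen h.orthonormal s c
  have h3 : (q x z).re = ∑ k ∈ s, lam k * ‖c k‖ ^ 2 := by
    rw [hz, IsEigenbasis.apply_sum h.eigen, Complex.re_sum]
    refine Finset.sum_congr rfl fun k _ => ?_
    rw [← inner_conj_symm (J x)]
    have h4 : c k * (lam k : ℂ) * conj (c k) = ((lam k * ‖c k‖ ^ 2 : ℝ) : ℂ) := by
      rw [mul_right_comm, Complex.mul_conj, Complex.normSq_eq_norm_sq]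
      push_cast
      ring
    rw [h4, Complex.ofReal_re]
  have h5 : (q z x).re = (q x z).re := by
    rw [← hq.symm x z, Complex.conj_re]
  have h6 : (q (x - z) (x - z)).re = (q x x).re - (q x z).re - ((q z x).re - (q z z).re) := by
    simp only [map_sub, LinearMap.sub_apply, Complex.sub_re]
    ring
  rw [h6, h5, h3, h2] at h1
  linarith

theorem IsEigenbasis.hasSum {q : V →ₗ⋆[ℂ] V →ₗ[ℂ] ℂ} {J : V →ₗ[ℂ] H} [CompleteSpace H]
    {lam : ℕ → ℝ} {e : ℕ → V} (h : IsEigenbasis q J lam e) (x : H) :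
    HasSum (fun k => ‖inner ℂ (J (e k)) x‖ ^ 2) (‖x‖ ^ 2) := by
  have hbot : (Submodule.span ℂ (range fun k => J (e k)))ᗮ = ⊥ := by
    rw [Submodule.eq_bot_iff]
    intro y hy
    refine h.complete y fun k => ?_
    exact (Submodule.mem_orthogonal _ y).1 hy _ (Submodule.subset_span (mem_range_self k))
  set b := HilbertBasis.mkOfOrthogonalEqBot h.orthonormal hbot with hb
  have h1 := b.hasSum_inner_mul_inner x x
  have h2 : ∀ k, inner ℂ x (b k) * inner ℂ (b k) x = ((‖inner ℂ (J (e k)) x‖ ^ 2 : ℝ) : ℂ) := fun k => by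
    have : b k = J (e k) := by simp [hb]
    rw [this, ← inner_conj_symm x, Complex.conj_mul']
    push_cast
    rfl
  simp only [h2] at h1
  rw [inner_self_eq_norm_sq_to_K] at h1
  have h3 : HasSum (fun k => ((‖inner ℂ (J (e k)) x‖ ^ 2 : ℝ) : ℂ)) ((‖x‖ ^ 2 : ℝ) : ℂ) := by
    convert! h1 using 1
    push_cast
    rfl
  exact Complex.hasSum_ofReal.1 h3

/-- Parseval's identity writes the left side as a series, whose partial sums are dominated by
Bessel's inequality: coefficients below `l` vanish, and the remaining ones have `lam k ≥ lam l`. -/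
theorem IsEigenbasis.mul_norm_sq_le [CompleteSpace H] {q : V →ₗ⋆[ℂ] V →ₗ[ℂ] ℂ}
    (hq : IsNonnegForm q) {J : V →ₗ[ℂ] H} {lam : ℕ → ℝ} {e : ℕ → V} (h : IsEigenbasis q J lam e)
    {l : ℕ} {x : V} (hx : ∀ k < l, inner ℂ (J (e k)) (J x) = 0) :
    lam l * ‖J x‖ ^ 2 ≤ (q x x).re := by
  refine hasSum_le_of_sum_le ((h.hasSum (J x)).mul_left (lam l)) fun s => ?_
  refine le_trans (Finset.sum_le_sum fun k _ => ?_) (h.bessel hq s x)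
  by_cases hk : k < l
  · simp [hx k hk]
  · exact mul_le_mul_of_nonneg_right (h.mono (not_lt.1 hk)) (by positivity)

/-- The min-max principle: an upper bound for the eigenvalues. -/
theorem IsEigenbasis.le_of_forall [CompleteSpace H] {q : V →ₗ⋆[ℂ] V →ₗ[ℂ] ℂ}
    (hq : IsNonnegForm q) {J : V →ₗ[ℂ] H} {lam : ℕ → ℝ} {e : ℕ → V} (h : IsEigenbasis q J lam e)
    {l : ℕ} (X : (Fin (l + 1) → ℂ) →ₗ[ℂ] V) {T : ℝ}
    (hX : ∀ c, c ≠ 0 → (q (X c) (X c)).re ≤ T * ‖J (X c)‖ ^ 2)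
    (hX0 : ∀ c, c ≠ 0 → J (X c) ≠ 0) : lam l ≤ T := by
  -- The `l` orthogonality conditions have a non-trivial solution in a space of dimension `l + 1`.
  let A : (Fin (l + 1) → ℂ) →ₗ[ℂ] (Fin l → ℂ) :=
    LinearMap.pi fun k => (innerₛₗ ℂ (J (e k))) ∘ₗ J ∘ₗ X
  have hker : LinearMap.ker A ≠ ⊥ := by
    apply LinearMap.ker_ne_bot_of_finrank_lt
    simp
  obtain ⟨c, hc, hc0⟩ := Submodule.exists_mem_ne_zero_of_ne_bot hker
  have h1 : ∀ k < l, inner ℂ (J (e k)) (J (X c)) = 0 := fun k hk =>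
    congrFun (LinearMap.mem_ker.1 hc) ⟨k, hk⟩
  have h2 := (h.mul_norm_sq_le hq h1).trans (hX c hc0)
  have h3 : 0 < ‖J (X c)‖ ^ 2 := by
    have := norm_pos_iff.2 (hX0 c hc0)
    positivity
  exact le_of_mul_le_mul_right h2 h3

/-- Comparison of the eigenvalues of two forms by means of trial vectors which are eigenvectors of
the first one. -/
theorem IsEigenbasis.le_of_trial [CompleteSpace H] {q₁ q₂ : V →ₗ⋆[ℂ] V →ₗ[ℂ] ℂ}
    (hq₂ : IsNonnegForm q₂) {J₁ J₂ : V →ₗ[ℂ] H} {lam₂ : ℕ → ℝ} {e₂ : ℕ → V}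
    (h : IsEigenbasis q₂ J₂ lam₂ e₂) {l : ℕ} {t : Fin (l + 1) → ℝ} {f : Fin (l + 1) → V}
    (hf : ∀ j, IsFormEigen q₁ J₁ (t j) (f j)) (ho : Orthonormal ℂ fun j => J₁ (f j)) {T ε : ℝ}
    (hT : ∀ j, t j ≤ T) (hT0 : 0 ≤ T) (hε : 0 ≤ ε)
    (h1 : ∀ j y, ‖q₁ y (f j) - q₂ y (f j)‖ ≤ ε * √(q₂ y y).re)
    (h2 : ∀ j, ‖J₁ (f j) - J₂ (f j)‖ ≤ ε) (hsmall : (l + 1) * ε ≤ 1 / 6) :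
    lam₂ l ≤ T + (l + 1) * ε * (6 * T + 4) := by
  set ε' := ((l : ℝ) + 1) * ε with hε'
  have hε'0 : 0 ≤ ε' := by positivity
  let X : (Fin (l + 1) → ℂ) →ₗ[ℂ] V := Fintype.linearCombination ℂ f
  have hXa : ∀ c, X c = ∑ j, c j • f j := fun c => Fintype.linearCombination_apply ℂ f c
  have hJX : ∀ c, J₁ (X c) = ∑ j, c j • J₁ (f j) := fun c => by simp [hXa]
  have hnorm : ∀ c, ‖J₁ (X c)‖ ^ 2 = ∑ j, ‖c j‖ ^ 2 := fun c => by
    rw [hJX, norm_sq_sum_smul ho]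
  have hcj : ∀ c j, ‖c j‖ ≤ ‖J₁ (X c)‖ := fun c j => by
    refine le_of_sq_le_sq ?_ (norm_nonneg _)
    rw [hnorm]
    exact Finset.single_le_sum (f := fun j => ‖c j‖ ^ 2) (fun _ _ => by positivity) (Finset.mem_univ j)
  have hsum : ∀ (c : Fin (l + 1) → ℂ) (R : ℝ), 0 ≤ R → ∑ j, ‖c j‖ * (ε * R) ≤ ε' * ‖J₁ (X c)‖ * R := by
    intro c R hR
    calc ∑ j, ‖c j‖ * (ε * R) ≤ ∑ _j : Fin (l + 1), ‖J₁ (X c)‖ * (ε * R) :=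
          Finset.sum_le_sum fun j _ => mul_le_mul_of_nonneg_right (hcj c j) (by positivity)
      _ = ε' * ‖J₁ (X c)‖ * R := by simp [hε']; ring
  have hq12 : ∀ c, ‖q₁ (X c) (X c) - q₂ (X c) (X c)‖ ≤
      ε' * ‖J₁ (X c)‖ * √(q₂ (X c) (X c)).re := by
    intro c
    have e1 : q₁ (X c) (X c) - q₂ (X c) (X c) = ∑ j, c j • (q₁ (X c) (f j) - q₂ (X c) (f j)) := by
      conv_lhs => rw [show q₁ (X c) (X c) = q₁ (X c) (∑ j, c j • f j) by rw [← hXa],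
        show q₂ (X c) (X c) = q₂ (X c) (∑ j, c j • f j) by rw [← hXa]]
      simp only [map_sum, map_smul, smul_sub, Finset.sum_sub_distrib]
    rw [e1]
    refine (norm_sum_le _ _).trans (le_trans (Finset.sum_le_sum fun j _ => ?_)
      (hsum c _ (Real.sqrt_nonneg _)))
    rw [norm_smul]
    exact mul_le_mul_of_nonneg_left (h1 j _) (norm_nonneg _)
  have hJ12 : ∀ c, ‖J₁ (X c) - J₂ (X c)‖ ≤ ε' * ‖J₁ (X c)‖ := by
    intro c
    have e1 : J₁ (X c) - J₂ (X c) = ∑ j, c j • (J₁ (f j) - J₂ (f j)) := by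
      simp only [hXa, map_sum, map_smul, smul_sub, Finset.sum_sub_distrib]
    rw [e1]
    refine (norm_sum_le _ _).trans (le_trans (Finset.sum_le_sum fun j _ => ?_)
      ((hsum c 1 zero_le_one).trans (mul_one _).le))
    rw [norm_smul, mul_one]
    exact mul_le_mul_of_nonneg_left (h2 j) (norm_nonneg _)
  have hJ0 : ∀ c, c ≠ 0 → 0 < ‖J₁ (X c)‖ := by
    intro c hc
    rw [norm_pos_iff]
    intro h0
    refine hc (funext fun j => ?_)
    have := hcj c j
    rw [h0, norm_zero] at this
    exact norm_le_zero_iff.1 this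
  have hlow : ∀ c, (1 - ε') * ‖J₁ (X c)‖ ≤ ‖J₂ (X c)‖ := fun c => by
    have h3 := norm_sub_norm_le (J₁ (X c)) (J₂ (X c))
    have h4 := hJ12 c
    linarith
  -- The product of ‖J₁X‖ and √q₂(X, X) is split by the arithmetic-geometric inequality, and the
  -- part of q₂ so produced is absorbed on the left.
  have hup : ∀ c, (1 - ε') * (q₂ (X c) (X c)).re ≤ (T + ε') * ‖J₁ (X c)‖ ^ 2 := by
    intro c
    have e1 : (q₁ (X c) (X c)).re ≤ T * ‖J₁ (X c)‖ ^ 2 := by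
      rw [hXa, IsEigenbasis.apply_sum_sum hf ho, ← hXa, hnorm, Finset.mul_sum]
      exact Finset.sum_le_sum fun j _ => mul_le_mul_of_nonneg_right (hT j) (by positivity)
    have e2 : (q₂ (X c) (X c)).re - (q₁ (X c) (X c)).re ≤
        ε' * ‖J₁ (X c)‖ * √(q₂ (X c) (X c)).re := by
      refine le_trans ?_ (hq12 c)
      rw [norm_sub_rev, ← Complex.sub_re]
      exact Complex.re_le_norm _
    have e3 := Real.sq_sqrt (hq₂.nonneg (X c))
    have e4 : ‖J₁ (X c)‖ * √(q₂ (X c) (X c)).re ≤ ‖J₁ (X c)‖ ^ 2 + (q₂ (X c) (X c)).re := by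
      nlinarith [sq_nonneg (‖J₁ (X c)‖ - √(q₂ (X c) (X c)).re), norm_nonneg (J₁ (X c)),
        Real.sqrt_nonneg (q₂ (X c) (X c)).re]
    have e5 := mul_le_mul_of_nonneg_left e4 hε'0
    nlinarith
  have hε1 : 0 < 1 - ε' := by linarith
  -- One factor 1 - ε' comes from the absorption in `hup`, two from ‖J₂X‖² ≥ (1 - ε')²‖J₁X‖².
  have key : lam₂ l ≤ (T + ε') / (1 - ε') ^ 3 := by
    refine h.le_of_forall hq₂ X (fun c hc => ?_) (fun c hc h0 => ?_)
    · rw [div_mul_eq_mul_div, le_div_iff₀ (by positivity)]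
      have h3 := hup c
      have h4 : ((1 - ε') * ‖J₁ (X c)‖) ^ 2 ≤ ‖J₂ (X c)‖ ^ 2 :=
        pow_le_pow_left₀ (by positivity) (hlow c) 2
      calc (q₂ (X c) (X c)).re * (1 - ε') ^ 3
          = ((1 - ε') * (q₂ (X c) (X c)).re) * (1 - ε') ^ 2 := by ring
        _ ≤ ((T + ε') * ‖J₁ (X c)‖ ^ 2) * (1 - ε') ^ 2 := by gcongr
        _ = (T + ε') * ((1 - ε') * ‖J₁ (X c)‖) ^ 2 := by ring
        _ ≤ (T + ε') * ‖J₂ (X c)‖ ^ 2 := by gcongr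
    · have h3 := hlow c
      rw [h0, norm_zero] at h3
      exact absurd h3 (not_le.2 (mul_pos hε1 (hJ0 c hc)))
  refine key.trans ?_
  rw [div_le_iff₀ (by positivity)]
  -- With the cube replaced by 1 - 3ε', the claim T + ε' ≤ (T + ε'(6T + 4))(1 - 3ε') follows from ε'
  -- ≤ 1/6.
  have hcube : 1 - 3 * ε' ≤ (1 - ε') ^ 3 := by nlinarith [sq_nonneg ε', mul_nonneg hε'0 (sq_nonneg ε')]
  have hpos : 0 ≤ T + ε' * (6 * T + 4) := by positivity
  refine le_trans ?_ (mul_le_mul_of_nonneg_left hcube hpos)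
  have h7 : 0 ≤ ε' * (1 - 6 * ε') := mul_nonneg hε'0 (by linarith)
  nlinarith [mul_nonneg h7 hT0]

/-- An eigenvector of `(q, J)` is close to the span of the eigenvectors of `(q', J')` for the
eigenvalues which are close to its own one. -/
theorem IsEigenbasis.dist_span_le [CompleteSpace H] {q q' : V →ₗ⋆[ℂ] V →ₗ[ℂ] ℂ}
    (hq' : IsNonnegForm q') {J J' : V →ₗ[ℂ] H} {lam' : ℕ → ℝ} {e' : ℕ → V}
    (h : IsEigenbasis q' J' lam' e') {t : ℝ} {u : V} (hu : IsFormEigen q J t u)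
    (ht : 0 ≤ t) {ε d Λ : ℝ} (htΛ : t ≤ Λ) (hε : 0 ≤ ε)
    (h1 : ∀ y, ‖q y u - q' y u‖ ≤ ε * √(q' y y).re) (h2 : ‖J u - J' u‖ ≤ ε)
    (h3 : ∀ z, ‖inner ℂ (J z - J' z) (J u)‖ ≤ ε * ‖J' z‖) (hd : 0 < d) (I : Finset ℕ)
    (hgap : ∀ k, k ∉ I → d ≤ |t - lam' k|) :
    ‖J u - ∑ k ∈ I, (inner ℂ (J' (e' k)) (J u)) • J' (e' k)‖ ≤
      ((1 + (1 + Λ / d) / d) + Λ / d + (1 + Λ / d)) * ε := by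
  set C := (1 + (1 + Λ / d) / d) + Λ / d + (1 + Λ / d) with hC
  have hΛ : 0 ≤ Λ := ht.trans htΛ
  have hC0 : 0 ≤ C := by positivity
  set a : ℕ → ℂ := fun k => inner ℂ (J' (e' k)) (J u) with ha
  have hlam0 : ∀ k, 0 ≤ lam' k := fun k => (h.eigen k).nonneg hq' (h.orthonormal.1 k)
  have hlam : ∀ k, k ∉ I → lam' k / |t - lam' k| ≤ 1 + Λ / d := by
    intro k hk
    have hg := hgap k hk
    have hpos : 0 < |t - lam' k| := hd.trans_le hg
    have e1 : lam' k ≤ |t - lam' k| + t := by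
      have := neg_abs_le (t - lam' k)
      linarith
    calc lam' k / |t - lam' k| ≤ (|t - lam' k| + t) / |t - lam' k| := by gcongr
      _ = 1 + t / |t - lam' k| := by rw [add_div, div_self hpos.ne']
      _ ≤ 1 + Λ / d := by gcongr
  have hfin : ∀ s : Finset ℕ, (∀ k ∈ s, k ∉ I) → ∑ k ∈ s, ‖a k‖ ^ 2 ≤ (C * ε) ^ 2 := by
    intro s hs
    set R := √(∑ k ∈ s, ‖a k‖ ^ 2) with hR
    have hR2 : R ^ 2 = ∑ k ∈ s, ‖a k‖ ^ 2 := Real.sq_sqrt (Finset.sum_nonneg fun _ _ => by positivity)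
    have hR0 : 0 ≤ R := Real.sqrt_nonneg _
    -- Resolvent-type test vector: `z` has the coefficients of `J u` divided by t - λ'_k, and `z2`
    -- is the operator of (q', J') applied to `z`.
    set c : ℕ → ℂ := fun k => a k / ((t - lam' k : ℝ) : ℂ) with hc
    set z := ∑ k ∈ s, c k • e' k with hz
    set z2 := ∑ k ∈ s, (lam' k * c k) • e' k with hz2
    have hne : ∀ k ∈ s, ((t - lam' k : ℝ) : ℂ) ≠ 0 := fun k hk => by
      rw [Complex.ofReal_ne_zero]
      intro h0
      have := hgap k (hs k hk)
      rw [h0, abs_zero] at this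
      linarith
    have hcn : ∀ k, ‖c k‖ = ‖a k‖ / |t - lam' k| := fun k => by
      simp only [hc]
      rw [norm_div, Complex.norm_real, Real.norm_eq_abs]
    have hq1 : q z u = t * inner ℂ (J z) (J u) := hu z
    have hq2 : q' z u = inner ℂ (J' z2) (J' u) := by
      rw [← hq'.symm u z, hz, IsEigenbasis.apply_sum h.eigen, map_sum, hz2, map_sum, sum_inner]
      refine Finset.sum_congr rfl fun k _ => ?_
      rw [map_smul, inner_smul_left, map_mul, inner_conj_symm, mul_comm (c k)]
    -- Since (t - λ'_k) c_k = a_k, the leading terms of q(z, u) - q'(z, u) combine to R². What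
    -- remains are three differences, each controlled by a hypothesis as a multiple of εR.
    have hkey : q z u - q' z u = ((R ^ 2 : ℝ) : ℂ) + t * inner ℂ (J z - J' z) (J u)
        + inner ℂ (J' z2) (J u - J' u) := by
      have e1 : (t : ℂ) * inner ℂ (J' z) (J u) - inner ℂ (J' z2) (J u) = ((R ^ 2 : ℝ) : ℂ) := by
        rw [hR2, hz, hz2, map_sum, map_sum, sum_inner, sum_inner, Finset.mul_sum,
          ← Finset.sum_sub_distrib]
        push_cast
        refine Finset.sum_congr rfl fun k hk => ?_
        rw [map_smul, map_smul, inner_smul_left, inner_smul_left, map_mul, Complex.conj_ofReal]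
        have e2 : conj (c k) * ((t - lam' k : ℝ) : ℂ) = conj (a k) := by
          rw [← Complex.conj_ofReal (t - lam' k), ← map_mul, hc, div_mul_cancel₀ _ (hne k hk)]
        have e3 : inner ℂ (J' (e' k)) (J u) = a k := rfl
        rw [e3, ← Complex.conj_mul', ← e2]
        push_cast
        ring
      rw [hq1, hq2, inner_sub_left, inner_sub_right, ← e1]
      ring
    have hz2n : ‖J' z2‖ ≤ (1 + Λ / d) * R := by
      refine le_of_sq_le_sq ?_ (by positivity)
      have e1 : J' z2 = ∑ k ∈ s, (lam' k * c k) • J' (e' k) := by simp [hz2]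
      rw [e1, norm_sq_sum_smul h.orthonormal, mul_pow, hR2, Finset.mul_sum]
      refine Finset.sum_le_sum fun k hk => ?_
      rw [← mul_pow]
      refine pow_le_pow_left₀ (norm_nonneg _) ?_ 2
      rw [norm_mul, hcn, Complex.norm_real, Real.norm_of_nonneg (hlam0 k), ← mul_div_assoc,
        mul_div_right_comm]
      exact mul_le_mul_of_nonneg_right (hlam k (hs k hk)) (norm_nonneg _)
    have hzn : ‖J' z‖ ≤ d⁻¹ * R := by
      refine le_of_sq_le_sq ?_ (by positivity)
      have e1 : J' z = ∑ k ∈ s, c k • J' (e' k) := by simp [hz]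
      rw [e1, norm_sq_sum_smul h.orthonormal, mul_pow, hR2, Finset.mul_sum]
      refine Finset.sum_le_sum fun k hk => ?_
      rw [← mul_pow]
      refine pow_le_pow_left₀ (norm_nonneg _) ?_ 2
      rw [hcn, div_eq_inv_mul]
      gcongr
      exact hgap k (hs k hk)
    -- With X = (1 + Λ/d)/d the bound √X ≤ 1 + X keeps the constant free of square roots.
    have hqz : √(q' z z).re ≤ (1 + (1 + Λ / d) / d) * R := by
      have e1 : (q' z z).re ≤ ((1 + Λ / d) / d) * R ^ 2 := by
        rw [hz, IsEigenbasis.apply_sum_sum h.eigen h.orthonormal, hR2, Finset.mul_sum]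
        refine Finset.sum_le_sum fun k hk => ?_
        have hg := hgap k (hs k hk)
        have hpos : 0 < |t - lam' k| := hd.trans_le hg
        calc lam' k * ‖c k‖ ^ 2 = (lam' k / |t - lam' k|) / |t - lam' k| * ‖a k‖ ^ 2 := by
              rw [hcn]
              field_simp
          _ ≤ ((1 + Λ / d) / d) * ‖a k‖ ^ 2 := by
              gcongr
              exact hlam k (hs k hk)
      rw [Real.sqrt_le_left (by positivity)]
      refine e1.trans ?_
      rw [mul_pow]
      have : 0 ≤ (1 + Λ / d) / d := by positivity
      gcongr
      nlinarith
    have hfinal : R ^ 2 ≤ C * ε * R := by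
      have e1 : ‖((R ^ 2 : ℝ) : ℂ)‖ ≤ ‖q z u - q' z u‖ + t * ‖inner ℂ (J z - J' z) (J u)‖
          + ‖inner ℂ (J' z2) (J u - J' u)‖ := by
        have e2 : ((R ^ 2 : ℝ) : ℂ) = (q z u - q' z u) - t * inner ℂ (J z - J' z) (J u)
          - inner ℂ (J' z2) (J u - J' u) := by rw [hkey]; ring
        rw [e2]
        refine (norm_sub_le _ _).trans (add_le_add_left ((norm_sub_le _ _).trans
          (add_le_add_right (le_of_eq ?_) _)) _)
        rw [norm_mul, Complex.norm_real, Real.norm_of_nonneg ht]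
      rw [Complex.norm_real, Real.norm_of_nonneg (by positivity)] at e1
      have e3 : ‖q z u - q' z u‖ ≤ ε * ((1 + (1 + Λ / d) / d) * R) :=
        (h1 z).trans (mul_le_mul_of_nonneg_left hqz hε)
      have e4 : t * ‖inner ℂ (J z - J' z) (J u)‖ ≤ Λ * (ε * (d⁻¹ * R)) :=
        mul_le_mul htΛ ((h3 z).trans (mul_le_mul_of_nonneg_left hzn hε)) (norm_nonneg _) hΛ
      have e5 : ‖inner ℂ (J' z2) (J u - J' u)‖ ≤ ((1 + Λ / d) * R) * ε :=
        (norm_inner_le_norm _ _).trans (mul_le_mul hz2n h2 (norm_nonneg _) (by positivity))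
      calc R ^ 2 ≤ _ := e1
        _ ≤ ε * ((1 + (1 + Λ / d) / d) * R) + Λ * (ε * (d⁻¹ * R)) + ((1 + Λ / d) * R) * ε := by
            gcongr
        _ = C * ε * R := by rw [hC]; ring
    rw [← hR2]
    have hRle : R ≤ C * ε := by
      rcases hR0.eq_or_lt with h0 | h0
      · rw [← h0]; positivity
      · rw [sq] at hfinal
        exact le_of_mul_le_mul_right hfinal h0
    exact pow_le_pow_left₀ hR0 hRle 2
  -- By Parseval's identity the squared distance is the sum of the squared coefficients outside `I`,
  -- and `hfin` bounds all its finite partial sums.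
  refine le_of_sq_le_sq ?_ (by positivity)
  refine hasSum_le_of_sum_le (h.hasSum _) fun s => ?_
  have e1 : ∀ k, inner ℂ (J' (e' k)) (J u - ∑ k ∈ I, a k • J' (e' k)) = if k ∈ I then 0 else a k := by
    intro k
    rw [inner_sub_right]
    by_cases hk : k ∈ I
    · rw [h.orthonormal.inner_right_sum a hk, if_pos hk, sub_self]
    · rw [if_neg hk, inner_sum, Finset.sum_eq_zero, sub_zero]
      intro j hj
      rw [inner_smul_right, h.orthonormal.2 (fun hkj : k = j => hk (by rw [hkj]; exact hj)), mul_zero]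
  calc ∑ k ∈ s, ‖inner ℂ (J' (e' k)) (J u - ∑ k ∈ I, a k • J' (e' k))‖ ^ 2
      = ∑ k ∈ s, if k ∈ I then 0 else ‖a k‖ ^ 2 := by
        refine Finset.sum_congr rfl fun k _ => ?_
        rw [e1]
        split_ifs <;> simp
    _ = ∑ k ∈ s with k ∉ I, ‖a k‖ ^ 2 := by
        rw [Finset.sum_filter]
        refine Finset.sum_congr rfl fun k _ => ?_
        by_cases hk : k ∈ I <;> simp [hk]
    _ ≤ _ := hfin _ fun k hk => (Finset.mem_filter.1 hk).2

end FormPerturbation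


/-! ### Orthonormal families close to a subspace -/

section Orthonormalization

/-- Normalization moves `z` by |‖z‖ - 1|, which is no more than its distance to the unit vector `v`.
-/
theorem norm_sub_normalize_le {H : Type*} [NormedAddCommGroup H] [InnerProductSpace ℂ H]
    {z v : H} {D : ℝ} (hv : ‖v‖ = 1) (h : ‖z - v‖ ≤ D) (hD : D < 1) :
    z ≠ 0 ∧ ‖((‖z‖⁻¹ : ℝ) : ℂ) • z - v‖ ≤ 2 * D := by
  have h1 : |‖z‖ - 1| ≤ D := by
    rw [← hv]
    exact (abs_norm_sub_norm_le z v).trans h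
  have hz : 0 < ‖z‖ := by
    have := (abs_le.1 h1).1
    linarith
  refine ⟨norm_pos_iff.1 hz, ?_⟩
  have h2 : ‖((‖z‖⁻¹ : ℝ) : ℂ) • z - z‖ = |‖z‖ - 1| := by
    have : ((‖z‖⁻¹ : ℝ) : ℂ) • z - z = ((‖z‖⁻¹ - 1 : ℝ) : ℂ) • z := by
      push_cast
      rw [sub_smul, one_smul]
    rw [this, norm_smul, Complex.norm_real, Real.norm_eq_abs]
    calc |‖z‖⁻¹ - 1| * ‖z‖ = |‖z‖⁻¹ - 1| * |‖z‖| := by rw [abs_of_pos hz]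
      _ = |1 - ‖z‖| := by rw [← abs_mul, sub_mul, inv_mul_cancel₀ hz.ne', one_mul]
      _ = _ := abs_sub_comm _ _
  calc ‖((‖z‖⁻¹ : ℝ) : ℂ) • z - v‖ ≤ ‖((‖z‖⁻¹ : ℝ) : ℂ) • z - z‖ + ‖z - v‖ := norm_sub_le_norm_sub_add_norm_sub _ _ _
    _ ≤ 2 * D := by rw [h2]; linarith

/-- An orthonormal family close to a subspace is close to an orthonormal family in the subspace. -/
theorem exists_orthonormal_near (m : ℕ) : ∃ C : ℝ, 0 ≤ C ∧
    ∀ {H : Type} [NormedAddCommGroup H] [InnerProductSpace ℂ H] (U : Submodule ℂ H) (v : Fin m → H)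
      (η : ℝ), 0 ≤ η → C * η < 1 → Orthonormal ℂ v → (∀ j, ∃ x ∈ U, ‖x - v j‖ ≤ η) →
      ∃ y : Fin m → H, Orthonormal ℂ y ∧ (∀ j, y j ∈ U) ∧ ∀ j, ‖y j - v j‖ ≤ C * η := by
  induction m with
  | zero =>
    refine ⟨0, le_rfl, fun U v η _ _ _ _ => ⟨v, ?_, fun j => j.elim0, fun j => j.elim0⟩⟩
    exact ⟨fun j => j.elim0, fun j => j.elim0⟩
  | succ m ih =>
    obtain ⟨C, hC, ih⟩ := ih
    -- The vector `x` approximating the last member of `v` is made orthogonal to the `m` vectors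
    -- already found. Its component along each is at most (C + 1)η, so the total error is Dη,
    -- doubled by normalization.
    set D := 1 + m * (C + 1) with hD
    have hD0 : 0 ≤ D := by positivity
    refine ⟨C + 2 * D, by positivity, fun {H} _ _ U v η hη hsmall hv hx => ?_⟩
    have hCη : 0 ≤ C * η := by positivity
    have hDη : 0 ≤ D * η := by positivity
    have hexp : (C + 2 * D) * η = C * η + 2 * (D * η) := by ring
    rw [hexp] at hsmall ⊢
    obtain ⟨y, hy1, hy2, hy3⟩ := ih U (fun j : Fin m => v j.castSucc) η hη (by linarith)
      (hv.comp _ (Fin.castSucc_injective m)) (fun j => hx _)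
    obtain ⟨x, hxU, hxv⟩ := hx (Fin.last m)
    set w := v (Fin.last m) with hw
    have hwn : ‖w‖ = 1 := hv.1 _
    set z := x - ∑ i, (inner ℂ (y i) x) • y i with hz
    have hzU : z ∈ U := U.sub_mem hxU (U.sum_mem fun i _ => U.smul_mem _ (hy2 i))
    -- The component of `x` along `y i` is small because `y i` is close to `v i`, `x` is close to
    -- `w`, and `v i` is orthogonal to `w`.
    have hin : ∀ i, ‖inner ℂ (y i) x‖ ≤ (C + 1) * η := by
      intro i
      have e1 : inner ℂ (v i.castSucc) w = 0 := hv.2 (Fin.castSucc_lt_last i).ne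
      have e2 : inner ℂ (y i) x = inner ℂ (y i - v i.castSucc) w + inner ℂ (y i) (x - w) := by
        rw [inner_sub_left, inner_sub_right, e1]
        ring
      rw [e2]
      refine (norm_add_le _ _).trans ?_
      have e3 := (norm_inner_le_norm (𝕜 := ℂ) (y i - v i.castSucc) w).trans
        (mul_le_mul_of_nonneg_right (hy3 i) (norm_nonneg _))
      have e4 := (norm_inner_le_norm (𝕜 := ℂ) (y i) (x - w)).trans
        (mul_le_mul_of_nonneg_left hxv (norm_nonneg _))
      rw [hwn] at e3
      rw [hy1.1 i] at e4
      linarith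
    have hzw : ‖z - w‖ ≤ D * η := by
      have e1 : z - w = (x - w) - ∑ i, (inner ℂ (y i) x) • y i := by rw [hz]; abel
      rw [e1]
      refine (norm_sub_le _ _).trans ?_
      have e2 : ‖∑ i, (inner ℂ (y i) x) • y i‖ ≤ ∑ _i : Fin m, (C + 1) * η := by
        refine (norm_sum_le _ _).trans (Finset.sum_le_sum fun i _ => ?_)
        rw [norm_smul, hy1.1 i, mul_one]
        exact hin i
      rw [Finset.sum_const, Finset.card_univ, Fintype.card_fin, nsmul_eq_mul] at e2
      calc _ ≤ η + m * ((C + 1) * η) := add_le_add hxv e2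
        _ = D * η := by rw [hD]; ring
    obtain ⟨hz0, hzn⟩ := norm_sub_normalize_le hwn hzw (by linarith)
    set y' := ((‖z‖⁻¹ : ℝ) : ℂ) • z with hy'
    have horth : ∀ i, inner ℂ (y i) y' = 0 := by
      intro i
      rw [hy', inner_smul_right, hz, inner_sub_right,
        hy1.inner_right_fintype (fun i => inner ℂ (y i) x) i, sub_self, mul_zero]
    have hy'n : ‖y'‖ = 1 := by
      rw [hy', norm_smul, Complex.norm_real, norm_inv, norm_norm,
        inv_mul_cancel₀ (norm_ne_zero_iff.2 hz0)]
    refine ⟨Fin.snoc y y', ⟨fun j => ?_, fun i j hij => ?_⟩, fun j => ?_, fun j => ?_⟩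
    · refine Fin.lastCases ?_ (fun j => ?_) j
      · simpa using hy'n
      · simpa using hy1.1 j
    · induction i using Fin.lastCases with
      | last =>
        induction j using Fin.lastCases with
        | last => exact absurd rfl hij
        | cast j =>
          simp only [Fin.snoc_last, Fin.snoc_castSucc]
          rw [← inner_conj_symm, horth, map_zero]
      | cast i =>
        induction j using Fin.lastCases with
        | last =>
          simp only [Fin.snoc_last, Fin.snoc_castSucc]
          exact horth i
        | cast j =>
          simp only [Fin.snoc_castSucc]
          exact hy1.2 fun h => hij (by rw [h])
    · refine Fin.lastCases ?_ (fun j => ?_) j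
      · simpa using U.smul_mem _ hzU
      · simpa using hy2 j
    · refine Fin.lastCases ?_ (fun j => ?_) j
      · simp only [Fin.snoc_last]
        linarith
      · simp only [Fin.snoc_castSucc]
        have := hy3 j
        linarith

/-- The size of the eigenvalue block is only known to be bounded, so the constant has to serve all
sizes up to `M`; the sum of the individual constants does. -/
theorem exists_orthonormal_near_le (M : ℕ) : ∃ C : ℝ, 0 ≤ C ∧ ∀ m ≤ M,
    ∀ {H : Type} [NormedAddCommGroup H] [InnerProductSpace ℂ H] (U : Submodule ℂ H) (v : Fin m → H)
      (η : ℝ), 0 ≤ η → C * η < 1 → Orthonormal ℂ v → (∀ j, ∃ x ∈ U, ‖x - v j‖ ≤ η) →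
      ∃ y : Fin m → H, Orthonormal ℂ y ∧ (∀ j, y j ∈ U) ∧ ∀ j, ‖y j - v j‖ ≤ C * η := by
  choose C hC h using exists_orthonormal_near
  refine ⟨∑ m ∈ Finset.range (M + 1), C m, Finset.sum_nonneg fun m _ => hC m,
    fun m hm {H} _ _ U v η hη hs hv hx => ?_⟩
  have hle : C m * η ≤ (∑ m ∈ Finset.range (M + 1), C m) * η :=
    mul_le_mul_of_nonneg_right (Finset.single_le_sum (fun m _ => hC m)
      (Finset.mem_range.2 (Nat.lt_succ_of_le hm))) hη
  obtain ⟨y, h1, h2, h3⟩ := h m U v η hη (hle.trans_lt hs) hv hx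
  exact ⟨y, h1, h2, fun j => (h3 j).trans hle⟩

theorem norm_sq_sub_proj {H : Type*} [NormedAddCommGroup H] [InnerProductSpace ℂ H] {m : ℕ}
    {u : Fin m → H} (hu : Orthonormal ℂ u) (x : H) :
    ‖x - ∑ j, (inner ℂ (u j) x) • u j‖ ^ 2 = ‖x‖ ^ 2 - ∑ j, ‖inner ℂ (u j) x‖ ^ 2 := by
  set p := ∑ j, (inner ℂ (u j) x) • u j with hp
  have h1 : inner ℂ (x - p) p = 0 := by
    rw [hp, inner_sum]
    refine Finset.sum_eq_zero fun j _ => ?_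
    have h3 : inner ℂ (u j) (x - p) = 0 := by
      rw [hp, inner_sub_right, hu.inner_right_fintype (fun j => inner ℂ (u j) x) j, sub_self]
    rw [← hp, inner_smul_right, inner_eq_zero_symm.1 h3, mul_zero]
  have h2 : ‖p‖ ^ 2 = ∑ j, ‖inner ℂ (u j) x‖ ^ 2 := norm_sq_sum_smul hu _ _
  have h3 := norm_add_sq_eq_norm_sq_add_norm_sq_of_inner_eq_zero (x - p) p h1
  rw [sub_add_cancel] at h3
  rw [← h2]
  simp only [sq]
  linarith

/-- By Pythagoras both sides equal m - Σ |⟨u_j, v_l⟩|². This symmetry turns closeness of one span to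
the other into the converse closeness. -/
theorem sum_norm_sq_sub_proj_comm {H : Type*} [NormedAddCommGroup H] [InnerProductSpace ℂ H] {m : ℕ}
    {u v : Fin m → H} (hu : Orthonormal ℂ u) (hv : Orthonormal ℂ v) :
    ∑ l, ‖v l - ∑ j, (inner ℂ (u j) (v l)) • u j‖ ^ 2 =
      ∑ j, ‖u j - ∑ l, (inner ℂ (v l) (u j)) • v l‖ ^ 2 := by
  simp only [norm_sq_sub_proj hu, norm_sq_sub_proj hv, Finset.sum_sub_distrib, hu.1, hv.1]
  rw [Finset.sum_comm (f := fun l j => ‖inner ℂ (u j) (v l)‖ ^ 2)]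
  simp only [norm_inner_symm]

/-- If `u` is close to the span of `b`, then the span of `b` is close to the span of `u`, for
orthonormal families of the same length. -/
theorem norm_sub_sum_sum_le {H : Type*} [NormedAddCommGroup H] [InnerProductSpace ℂ H] {m : ℕ}
    {u b : Fin m → H} (hu : Orthonormal ℂ u) (hb : Orthonormal ℂ b) {κ M : ℝ} (hκ : 0 ≤ κ)
    (hM : 0 ≤ M) (hm : (m : ℝ) ≤ M)
    (hub : ∀ j, ‖u j - ∑ l, (inner ℂ (b l) (u j)) • b l‖ ≤ κ) {x : H} (hx : ‖x‖ = 1)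
    (hspan : x = ∑ l, (inner ℂ (b l) x) • b l) :
    ‖∑ l, (inner ℂ (b l) x) • ∑ i, (inner ℂ (u i) (b l)) • u i - x‖ ≤ (M + 1) * ((M + 1) * κ) := by
  have hbu : ∀ l, ‖b l - ∑ j, (inner ℂ (u j) (b l)) • u j‖ ≤ (M + 1) * κ := by
    intro l
    refine le_of_sq_le_sq ?_ (by positivity)
    calc ‖b l - ∑ j, (inner ℂ (u j) (b l)) • u j‖ ^ 2
        ≤ ∑ l, ‖b l - ∑ j, (inner ℂ (u j) (b l)) • u j‖ ^ 2 :=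
          Finset.single_le_sum (f := fun l => ‖b l - ∑ j, (inner ℂ (u j) (b l)) • u j‖ ^ 2)
            (fun _ _ => by positivity) (Finset.mem_univ l)
      _ = ∑ j, ‖u j - ∑ l, (inner ℂ (b l) (u j)) • b l‖ ^ 2 := sum_norm_sq_sub_proj_comm hu hb
      _ ≤ ∑ _j : Fin m, κ ^ 2 :=
          Finset.sum_le_sum fun j _ => pow_le_pow_left₀ (norm_nonneg _) (hub j) 2
      _ = m * κ ^ 2 := by simp
      _ ≤ (M + 1) ^ 2 * κ ^ 2 := by
          have : (m : ℝ) ≤ (M + 1) ^ 2 := by nlinarith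
          gcongr
      _ = ((M + 1) * κ) ^ 2 := by ring
  rw [norm_sub_rev]
  have e1 : x - ∑ l, (inner ℂ (b l) x) • ∑ i, (inner ℂ (u i) (b l)) • u i =
      ∑ l, (inner ℂ (b l) x) • (b l - ∑ i, (inner ℂ (u i) (b l)) • u i) := by
    simp only [smul_sub, Finset.sum_sub_distrib]
    rw [← hspan]
  rw [e1]
  calc _ ≤ ∑ l : Fin m, ‖(inner ℂ (b l) x) • (b l - ∑ i, (inner ℂ (u i) (b l)) • u i)‖ :=
        norm_sum_le _ _
    _ ≤ ∑ _l : Fin m, (M + 1) * κ := by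
        refine Finset.sum_le_sum fun l _ => ?_
        rw [norm_smul]
        have h3 := norm_inner_le_norm (𝕜 := ℂ) (b l) x
        rw [hb.1, hx, mul_one] at h3
        calc _ ≤ 1 * ((M + 1) * κ) := mul_le_mul h3 (hbu l) (norm_nonneg _) zero_le_one
          _ = _ := one_mul _
    _ = m * ((M + 1) * κ) := by simp
    _ ≤ (M + 1) * ((M + 1) * κ) := by
        gcongr
        linarith

/-- A vector orthogonal to all but `m` consecutive members of a complete orthonormal sequence. -/
theorem eq_sum_of_forall_inner_eq_zero {H : Type*} [NormedAddCommGroup H] [InnerProductSpace ℂ H]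
    {f : ℕ → H} (hf : Orthonormal ℂ f) (hc : ∀ h : H, (∀ k, inner ℂ (f k) h = 0) → h = 0)
    {n m : ℕ} {x : H} (hx : ∀ k, k ∉ Finset.Ico n (n + m) → inner ℂ (f k) x = 0) :
    x = ∑ l : Fin m, (inner ℂ (f (n + l)) x) • f (n + l) := by
  rw [← sub_eq_zero, ← Finset.sum_range (fun l => (inner ℂ (f (n + l)) x) • f (n + l))]
  have h1 := Finset.sum_Ico_eq_sum_range (fun l => (inner ℂ (f l) x) • f l) n (n + m)
  rw [Nat.add_sub_cancel_left] at h1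
  rw [← h1]
  refine hc _ fun k => ?_
  rw [inner_sub_right]
  by_cases hk : k ∈ Finset.Ico n (n + m)
  · rw [hf.inner_right_sum (fun l => inner ℂ (f l) x) hk, sub_self]
  · rw [hx k hk, inner_sum, Finset.sum_eq_zero, sub_zero]
    intro j hj
    rw [inner_smul_right, hf.2 (fun hkj : k = j => hk (by rw [hkj]; exact hj)), mul_zero]

end Orthonormalization

/-! ### Stability of eigenvalues and eigenvectors of two forms with two embeddings -/

section Abstract

/-- The positions `n, …, n + m - 1` of `lam` carry the value `lamVal`, and the neighbouring values
are `lamPrev` and `lamNext`. -/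
structure IsBlock (lam : ℕ → ℝ) (n m : ℕ) (lamPrev lamVal lamNext : ℝ) : Prop where
  eq : ∀ j, n ≤ j → j < n + m → lam j = lamVal
  prev : ∀ j, j + 1 = n → lam j = lamPrev
  next : lam (n + m) = lamNext

/-- The comparison hypotheses on two forms `q`, `q'` and two embeddings `J`, `J'`, for eigenvectors
belonging to eigenvalues up to `Λ`. -/
structure IsClose {V H : Type*} [AddCommGroup V] [Module ℂ V] [NormedAddCommGroup H]
    [InnerProductSpace ℂ H] (q q' : V →ₗ⋆[ℂ] V →ₗ[ℂ] ℂ) (J J' : V →ₗ[ℂ] H) (Λ ε : ℝ) : Prop where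
  form_left : ∀ t x, t ≤ Λ → IsFormEigen q J t x → ‖J x‖ = 1 →
    ∀ y, ‖q y x - q' y x‖ ≤ ε * √(q' y y).re
  embed_left : ∀ t x, t ≤ Λ → IsFormEigen q J t x → ‖J x‖ = 1 → ‖J x - J' x‖ ≤ ε
  inner_left : ∀ t x, t ≤ Λ → IsFormEigen q J t x → ‖J x‖ = 1 →
    ∀ z, ‖inner ℂ (J z - J' z) (J x)‖ ≤ ε * ‖J' z‖
  embed_right : ∀ t x, t ≤ Λ → IsFormEigen q' J' t x → ‖J' x‖ = 1 → ‖J x - J' x‖ ≤ ε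
  form_mixed : ∀ t x, t ≤ Λ → IsFormEigen q' J t x → ‖J x‖ = 1 →
    ∀ y, ‖q y x - q' y x‖ ≤ ε * √(q y y).re

variable {V H : Type} [AddCommGroup V] [Module ℂ V] [NormedAddCommGroup H] [InnerProductSpace ℂ H]
  [CompleteSpace H]

/-- One direction compares (q, J) with (q', J') directly. The way back goes through (q', J), so that
first only the embedding and then only the form changes: the hypotheses contain no estimate of the
form difference on eigenvectors of (q', J'). -/
theorem eigenvalue_close {q q' : V →ₗ⋆[ℂ] V →ₗ[ℂ] ℂ} {J J' : V →ₗ[ℂ] H} {lam lam' lamh : ℕ → ℝ}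
    {e e' eh : ℕ → V} (hq : IsNonnegForm q) (hq' : IsNonnegForm q') (h : IsEigenbasis q J lam e)
    (h' : IsEigenbasis q' J' lam' e') (hh : IsEigenbasis q' J lamh eh) {Λ ε η : ℝ} {M : ℕ}
    (hΛ : 0 ≤ Λ) (hε : 0 ≤ ε) (hη1 : η ≤ 1 / 3) (hεM : (M : ℝ) * ε ≤ 1 / 6)
    (hεη : (M : ℝ) * ε * (6 * (Λ + 1) + 4) ≤ η) (hc : IsClose q q' J J' (Λ + 1) ε) {l : ℕ} (hl : l < M)
    (hb : lam l ≤ Λ ∨ lam' l ≤ Λ) : lam' l ≤ lam l + η ∧ lam l ≤ lam' l + 2 * η := by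
  have hlM : ((l : ℝ) + 1) * ε ≤ M * ε := by
    gcongr
    exact_mod_cast hl
  have hs := hlM.trans hεM
  have hη0 : 0 ≤ η := le_trans (by positivity) hεη
  have hbound : ∀ T : ℝ, 0 ≤ T → T ≤ Λ + 1 → T + (l + 1) * ε * (6 * T + 4) ≤ T + η := by
    intro T hT0 hT
    have h1 : ((l : ℝ) + 1) * ε * (6 * T + 4) ≤ M * ε * (6 * (Λ + 1) + 4) := by gcongr
    linarith
  have hn : ∀ k, 0 ≤ lam k := fun k => (h.eigen k).nonneg hq (h.orthonormal.1 k)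
  have hn' : ∀ k, 0 ≤ lam' k := fun k => (h'.eigen k).nonneg hq' (h'.orthonormal.1 k)
  have hnh : ∀ k, 0 ≤ lamh k := fun k => (hh.eigen k).nonneg hq' (hh.orthonormal.1 k)
  have hle : ∀ j : Fin (l + 1), (j : ℕ) ≤ l := fun j => Nat.lt_succ_iff.1 j.2
  have step1 : lam l ≤ Λ + 1 → lam' l ≤ lam l + η := fun hlam =>
    (h'.le_of_trial hq' (q₁ := q) (J₁ := J) (t := fun j : Fin (l + 1) => lam j) (f := fun j => e j)
      (fun j => h.eigen j) (h.orthonormal.comp _ Fin.val_injective) (fun j => h.mono (hle j)) (hn l) hε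
      (fun j => hc.form_left _ _ ((h.mono (hle j)).trans hlam) (h.eigen j) (h.orthonormal.1 j))
      (fun j => hc.embed_left _ _ ((h.mono (hle j)).trans hlam) (h.eigen j) (h.orthonormal.1 j)) hs).trans
      (hbound _ (hn l) hlam)
  have step2 : lam' l ≤ Λ + 1 → lamh l ≤ lam' l + η := fun hlam =>
    (hh.le_of_trial hq' (q₁ := q') (J₁ := J') (t := fun j : Fin (l + 1) => lam' j) (f := fun j => e' j)
      (fun j => h'.eigen j) (h'.orthonormal.comp _ Fin.val_injective) (fun j => h'.mono (hle j)) (hn' l) hε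
      (fun j y => by rw [sub_self, norm_zero]; positivity)
      (fun j => by
        rw [norm_sub_rev]
        exact hc.embed_right _ _ ((h'.mono (hle j)).trans hlam) (h'.eigen j) (h'.orthonormal.1 j))
      hs).trans (hbound _ (hn' l) hlam)
  have step3 : lamh l ≤ Λ + 1 → lam l ≤ lamh l + η := fun hlam =>
    (h.le_of_trial hq (q₁ := q') (J₁ := J) (t := fun j : Fin (l + 1) => lamh j) (f := fun j => eh j)
      (fun j => hh.eigen j) (hh.orthonormal.comp _ Fin.val_injective) (fun j => hh.mono (hle j)) (hnh l) hε
      (fun j y => by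
        rw [norm_sub_rev]
        exact hc.form_mixed _ _ ((hh.mono (hle j)).trans hlam) (hh.eigen j) (hh.orthonormal.1 j) y)
      (fun j => by rw [sub_self, norm_zero]; exact hε) hs).trans (hbound _ (hnh l) hlam)
  -- The cycle is entered at the sequence known to be at most Λ. Each step raises the bound by η ≤
  -- 1/3, so the range up to Λ + 1 is never left.
  rcases hb with hb | hb
  · have h1 := step1 (by linarith)
    have h2 := step2 (by linarith)
    have h3 := step3 (by linarith)
    exact ⟨h1, by linarith⟩
  · have h2 := step2 (by linarith)
    have h3 := step3 (by linarith)
    have h1 := step1 (by linarith)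
    exact ⟨h1, by linarith⟩

theorem sum_Ico_eq_sum_fin {A : Type*} [AddCommMonoid A] (n m : ℕ) (f : ℕ → A) :
    ∑ k ∈ Finset.Ico n (n + m), f k = ∑ j : Fin m, f (n + j) := by
  rw [Finset.sum_Ico_eq_sum_range, Nat.add_sub_cancel_left, Finset.sum_range]

set_option maxHeartbeats 1000000 in
/-- Stability of eigenvectors: a block of eigenvectors of one of the two forms can be matched by an
orthonormal system of eigenvectors of the other one. -/
theorem exists_eigenvector_stability_const {lamPrev lamVal lamNext : ℝ} (h0 : 0 ≤ lamVal)
    (h1 : lamVal < lamNext) (M : ℕ) : ∃ C ε₀ : ℝ, 0 < C ∧ 0 < ε₀ ∧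
    ∀ {V H : Type} [AddCommGroup V] [Module ℂ V] [NormedAddCommGroup H] [InnerProductSpace ℂ H]
      [CompleteSpace H] {q q' : V →ₗ⋆[ℂ] V →ₗ[ℂ] ℂ} {J J' : V →ₗ[ℂ] H} {lam lam' lamh : ℕ → ℝ}
      {e e' eh : ℕ → V} (_ : IsNonnegForm q) (_ : IsNonnegForm q') (_ : IsEigenbasis q J lam e)
      (_ : IsEigenbasis q' J' lam' e') (_ : IsEigenbasis q' J lamh eh) {ε : ℝ}
      (_ : 0 ≤ ε) (_ : ε ≤ ε₀) (_ : IsClose q q' J J' (lamNext + 1) ε) {n m : ℕ} (_ : n + m < M)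
      (_ : 0 < n → lamPrev < lamVal),
      (IsBlock lam n m lamPrev lamVal lamNext → ∀ v : Fin m → V,
        (∀ j : Fin m, IsFormEigen q' J' (lam' (n + (j : ℕ))) (v j)) → (Orthonormal ℂ fun j => J' (v j)) →
        ∃ y : Fin m → H, Orthonormal ℂ y ∧
          (∀ j, y j ∈ Submodule.span ℂ (range fun i : Fin m => J (e (n + i)))) ∧
          ∀ j, ‖y j - J' (v j)‖ ≤ C * ε) ∧
      (IsBlock lam' n m lamPrev lamVal lamNext → ∀ v : Fin m → V,
        (∀ j : Fin m, IsFormEigen q J (lam (n + (j : ℕ))) (v j)) → (Orthonormal ℂ fun j => J (v j)) →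
        ∃ y : Fin m → H, Orthonormal ℂ y ∧
          (∀ j, y j ∈ Submodule.span ℂ (range fun i : Fin m => J' (e' (n + i)))) ∧
          ∀ j, ‖y j - J (v j)‖ ≤ C * ε) := by
  obtain ⟨G, hG0, hG⟩ := exists_orthonormal_near_le M
  -- `d` is the gap from the eigenvalue to its neighbours. The value 1 serves the case n = 0, where
  -- `lamPrev` is not a neighbour.
  set d : ℝ := min (lamNext - lamVal) (if lamPrev < lamVal then lamVal - lamPrev else 1) with hd
  have hd0 : 0 < d := by
    rw [hd]
    refine lt_min (by linarith) ?_
    split_ifs with h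
    · linarith
    · exact one_pos
  have hd1 : d ≤ lamNext - lamVal := min_le_left _ _
  have hd2 : lamPrev < lamVal → d ≤ lamVal - lamPrev := fun h => by
    rw [hd, if_pos h]
    exact min_le_right _ _
  set Λ := lamNext with hΛdef
  have hΛ : 0 ≤ Λ := by linarith
  -- Eigenvalues move by at most 2η ≤ d/4, so a gap of at least d/2 survives and blocks are not
  -- mixed; 1/3 is required by `eigenvalue_close`.
  set η := min (d / 8) (1 / 3) with hηdef
  have hη0 : 0 < η := lt_min (by positivity) (by norm_num)
  have hη1 : η ≤ 1 / 3 := min_le_right _ _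
  have hηd : η ≤ d / 8 := min_le_left _ _
  -- The constant of `IsEigenbasis.dist_span_le` for the gap d/2 and eigenvalues up to Λ + 1.
  set K := (1 + (1 + (Λ + 1) / (d / 2)) / (d / 2)) + (Λ + 1) / (d / 2) + (1 + (Λ + 1) / (d / 2)) with hK
  have hK0 : 0 < K := by positivity
  -- The factor (M + 1)² is the cost of exchanging the two spans in `norm_sub_sum_sum_le`.
  set B := ((M : ℝ) + 1) * ((M + 1) * K) with hB
  have hB0 : 0 < B := by positivity
  have hKB : K ≤ B := by
    have : (1 : ℝ) ≤ (M + 1) * (M + 1) := by nlinarith [(Nat.cast_nonneg M : (0 : ℝ) ≤ M)]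
    nlinarith
  -- The first bound makes the eigenvalues move by no more than `η` per comparison, the second makes
  -- the orthonormalization applicable.
  set ε₀ := min (η / ((M + 1) * (6 * (Λ + 1) + 4))) (1 / 2 / ((G + 1) * B)) with hε₀
  refine ⟨(G + 1) * B, ε₀, by positivity, lt_min (by positivity) (by positivity), ?_⟩
  intro V H _ _ _ _ _ q q' J J' lam lam' lamh e e' eh hq hq' h h' hh ε hε hεε₀ hc n m hnm hprev
  have hε1 : (M : ℝ) * ε * (6 * (Λ + 1) + 4) ≤ η := by
    have h2 : ε ≤ η / ((M + 1) * (6 * (Λ + 1) + 4)) := hεε₀.trans (min_le_left _ _)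
    rw [le_div_iff₀ (by positivity)] at h2
    have h3 : 0 ≤ ε * (6 * (Λ + 1) + 4) := by positivity
    nlinarith
  have hε2 : (M : ℝ) * ε ≤ 1 / 6 := by
    have h3 : 0 ≤ (M : ℝ) * ε := by positivity
    nlinarith
  have hε3 : (G + 1) * (B * ε) < 1 := by
    have h2 : ε ≤ 1 / 2 / ((G + 1) * B) := hεε₀.trans (min_le_right _ _)
    rw [le_div_iff₀ (by positivity)] at h2
    nlinarith
  have hGB : G * (B * ε) ≤ (G + 1) * B * ε := by
    have : 0 ≤ B * ε := by positivity
    nlinarith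
  have hGB1 : G * (B * ε) < 1 := by
    have : 0 ≤ B * ε := by positivity
    nlinarith
  have hclose : (∀ l ≤ n + m, lam l ≤ Λ ∨ lam' l ≤ Λ) →
      ∀ l ≤ n + m, lam' l ≤ lam l + η ∧ lam l ≤ lam' l + 2 * η := fun hb l hl =>
    eigenvalue_close hq hq' h h' hh hΛ hε hη1 hε2 hε1 hc (hl.trans_lt hnm) (hb l hl)
  have hmM : m ≤ M := by omega
  have hdist : ∀ (t : ℝ) (u : V), IsFormEigen q J t u → ‖J u‖ = 1 → t ≤ Λ + 1 →
      (∀ k, k ∉ Finset.Ico n (n + m) → d / 2 ≤ |t - lam' k|) →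
      ‖J u - ∑ j : Fin m, (inner ℂ (J' (e' (n + j))) (J u)) • J' (e' (n + j))‖ ≤ K * ε := by
    intro t u hu hun ht hgap
    have := h'.dist_span_le hq' hu (hu.nonneg hq hun) ht hε (hc.form_left t u ht hu hun)
      (hc.embed_left t u ht hu hun) (hc.inner_left t u ht hu hun) (by positivity) _ hgap
    rwa [sum_Ico_eq_sum_fin] at this
  have hprev' : ∀ {lam₁ : ℕ → ℝ}, Monotone lam₁ → IsBlock lam₁ n m lamPrev lamVal Λ → ∀ k < n,
      lam₁ (n - 1) = lamPrev ∧ d ≤ lamVal - lamPrev := by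
    intro lam₁ _ hb k hk
    exact ⟨hb.prev _ (by omega), hd2 (hprev (by omega))⟩
  constructor
  -- Here the given vectors belong to (q', J'), whereas `dist_span_le` applies to eigenvectors of
  -- (q, J). So the eigenvectors `u` of (q, J) are shown to be close to the span of `b`, the given
  -- vectors lie in that span, and the roles of the spans are exchanged.
  · intro hb v hv hvo
    have hcl := hclose fun l hl => Or.inl ((h.mono hl).trans hb.next.le)
    have hgap : ∀ k, k ∉ Finset.Ico n (n + m) → (k < n ∧ lam' k ≤ lamVal - d + η) ∨
        (n + m ≤ k ∧ lamVal + d - 2 * η ≤ lam' k) := by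
      intro k hk
      rw [Finset.mem_Ico, not_and_or, not_le, not_lt] at hk
      rcases hk with hk | hk
      · left
        obtain ⟨h3, h4⟩ := hprev' h.mono hb k hk
        have h5 := h'.mono (show k ≤ n - 1 by omega)
        have h6 := (hcl (n - 1) (by omega)).1
        exact ⟨hk, by linarith⟩
      · right
        have h5 := h'.mono hk
        have h6 := (hcl (n + m) le_rfl).2
        rw [hb.next] at h6
        exact ⟨hk, by linarith⟩
    have hval : ∀ j : Fin m, lam (n + j) = lamVal := fun j => hb.eq _ (by omega) (by omega)
    set u : Fin m → H := fun j => J (e (n + j)) with hu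
    set b : Fin m → H := fun j => J' (e' (n + j)) with hbdef
    have huo : Orthonormal ℂ u := h.orthonormal.comp (fun j : Fin m => n + (j : ℕ))
      (fun i j hij => Fin.ext (by simpa using hij))
    have hbo : Orthonormal ℂ b := h'.orthonormal.comp (fun j : Fin m => n + (j : ℕ))
      (fun i j hij => Fin.ext (by simpa using hij))
    have hub : ∀ j, ‖u j - ∑ l, (inner ℂ (b l) (u j)) • b l‖ ≤ K * ε := fun j => by
      refine hdist _ (e (n + j)) (h.eigen _) (h.orthonormal.1 _) (by rw [hval]; linarith) fun k hk => ?_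
      rw [hval]
      rcases hgap k hk with h3 | h3
      · exact le_trans (by linarith [h3.2]) (le_abs_self _)
      · exact le_trans (by linarith [h3.2]) (neg_le_abs _)
    have hspan : ∀ j, J' (v j) = ∑ l, (inner ℂ (b l) (J' (v j))) • b l := by
      intro j
      refine eq_sum_of_forall_inner_eq_zero h'.orthonormal h'.complete fun k hk => ?_
      have h4 := hcl (n + j) (by omega)
      rw [hval] at h4
      refine (h'.eigen k).inner_eq_zero hq' (hv j) ?_
      rcases hgap k hk with h5 | h5
      · exact ne_of_lt (by linarith [h5.2])
      · exact ne_of_gt (by linarith [h5.2])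
    have hmM' : (m : ℝ) ≤ M := by exact_mod_cast hmM
    obtain ⟨y, hy1, hy2, hy3⟩ := hG m hmM (Submodule.span ℂ (range u)) (fun j => J' (v j)) (B * ε)
      (by positivity) hGB1 hvo fun j =>
        ⟨∑ l, (inner ℂ (b l) (J' (v j))) • ∑ i, (inner ℂ (u i) (b l)) • u i,
          Submodule.sum_mem _ fun l _ => Submodule.smul_mem _ _ (Submodule.sum_mem _ fun i _ =>
            Submodule.smul_mem _ _ (Submodule.subset_span (mem_range_self i))),
          (norm_sub_sum_sum_le huo hbo (by positivity) (Nat.cast_nonneg M) hmM' hub (hvo.1 j)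
            (hspan j)).trans_eq (by rw [hB]; ring)⟩
    exact ⟨y, hy1, hy2, fun j => (hy3 j).trans hGB⟩
  -- The given vectors now belong to (q, J) and `dist_span_le` applies to them directly. Their
  -- eigenvalues need not coincide, but all lie within 2η of `lamVal`.
  · intro hb v hv hvo
    have hcl := hclose fun l hl => Or.inr ((h'.mono hl).trans hb.next.le)
    have hgap : ∀ k, k ∉ Finset.Ico n (n + m) → (lam' k ≤ lamVal - d) ∨ (lamVal + d ≤ lam' k) := by
      intro k hk
      rw [Finset.mem_Ico, not_and_or, not_le, not_lt] at hk
      rcases hk with hk | hk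
      · left
        obtain ⟨h3, h4⟩ := hprev' h'.mono hb k hk
        have h5 := h'.mono (show k ≤ n - 1 by omega)
        linarith
      · right
        have h5 := h'.mono hk
        rw [hb.next] at h5
        linarith
    have hval : ∀ j : Fin m, lam' (n + j) = lamVal := fun j => hb.eq _ (by omega) (by omega)
    set b : Fin m → H := fun j => J' (e' (n + j)) with hbdef
    obtain ⟨y, hy1, hy2, hy3⟩ := hG m hmM (Submodule.span ℂ (range b)) (fun j => J (v j)) (B * ε)
      (by positivity) hGB1 hvo fun j => by
        refine ⟨∑ l, (inner ℂ (b l) (J (v j))) • b l, ?_, ?_⟩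
        · exact Submodule.sum_mem _ fun l _ => Submodule.smul_mem _ _
            (Submodule.subset_span (mem_range_self l))
        · rw [norm_sub_rev]
          have h4 := (hcl (n + j) (by omega))
          rw [hval] at h4
          refine (hdist (lam (n + j)) (v j) (hv j) (hvo.1 j) (by linarith) fun k hk => ?_).trans
            (mul_le_mul_of_nonneg_right hKB hε)
          rcases hgap k hk with h3 | h3
          · exact le_trans (by linarith) (le_abs_self _)
          · exact le_trans (by linarith) (neg_le_abs _)
    exact ⟨y, hy1, hy2, fun j => (hy3 j).trans hGB⟩

end Abstract


/-! ### Operators of forms: compact resolvents, eigenvalue sequences and unitary equivalence -/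

section FormGraph

variable {V H H' : Type*} [AddCommGroup V] [Module ℂ V] [NormedAddCommGroup H]
  [InnerProductSpace ℂ H] [NormedAddCommGroup H'] [InnerProductSpace ℂ H']

/-- `G` is the graph of the operator associated with the form `q` relative to `‖J ·‖²`. -/
def IsFormGraph (G : Submodule ℂ (H × H)) (q : V →ₗ⋆[ℂ] V →ₗ[ℂ] ℂ) (J : V →ₗ[ℂ] H) : Prop :=
  ∀ u f, (u, f) ∈ G ↔ ∃ x, J x = u ∧ ∀ y, q y x = inner ℂ (J y) f

/-- The linear isometry `W` carries the graph `G` to the graph `G'`. -/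
def IntertwinesGraph (W : H ≃ₗᵢ[ℂ] H') (G : Submodule ℂ (H × H)) (G' : Submodule ℂ (H' × H')) :
    Prop :=
  ∀ u f, (u, f) ∈ G ↔ (W u, W f) ∈ G'

theorem IsFormGraph.mem_eigenspace {G : Submodule ℂ (H × H)} {q : V →ₗ⋆[ℂ] V →ₗ[ℂ] ℂ}
    {J : V →ₗ[ℂ] H} (h : IsFormGraph G q J) {t : ℝ} {u : H} :
    u ∈ eigenspace G t ↔ ∃ x, J x = u ∧ IsFormEigen q J t x := by
  rw [SpectralStability.mem_eigenspace, h]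
  refine exists_congr fun x => and_congr_right fun hx => forall_congr' fun y => ?_
  rw [inner_smul_right, hx]

theorem IntertwinesGraph.mem_eigenspace {W : H ≃ₗᵢ[ℂ] H'} {G : Submodule ℂ (H × H)}
    {G' : Submodule ℂ (H' × H')} (h : IntertwinesGraph W G G') {t : ℝ} {u : H} :
    u ∈ eigenspace G t ↔ W u ∈ eigenspace G' t := by
  rw [SpectralStability.mem_eigenspace, SpectralStability.mem_eigenspace, h, map_smul]

theorem IntertwinesGraph.map_eigenspace {W : H ≃ₗᵢ[ℂ] H'} {G : Submodule ℂ (H × H)}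
    {G' : Submodule ℂ (H' × H')} (h : IntertwinesGraph W G G') (t : ℝ) :
    (eigenspace G t).map (W.toLinearEquiv : H →ₗ[ℂ] H') = eigenspace G' t := by
  ext v
  rw [Submodule.mem_map]
  constructor
  · rintro ⟨u, hu, rfl⟩
    exact h.mem_eigenspace.1 hu
  · intro hv
    exact ⟨W.symm v, h.mem_eigenspace.2 (by rwa [W.apply_symm_apply]), W.apply_symm_apply v⟩

theorem IntertwinesGraph.isEigenvalueSeq {W : H ≃ₗᵢ[ℂ] H'} {G : Submodule ℂ (H × H)}
    {G' : Submodule ℂ (H' × H')} (h : IntertwinesGraph W G G') {lam : ℕ → ℝ}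
    (hl : IsEigenvalueSeq G lam) : IsEigenvalueSeq G' lam := by
  refine ⟨hl.1, fun t => ?_⟩
  obtain ⟨h1, h2, h3⟩ := hl.2 t
  have e := W.toLinearEquiv.submoduleMap (eigenspace G t)
  rw [← h.map_eigenspace t]
  refine ⟨h1, e.finiteDimensional, ?_⟩
  rw [h3]
  exact e.finrank_eq

theorem IntertwinesGraph.hasCompactResolvent {W : H ≃ₗᵢ[ℂ] H'} {G : Submodule ℂ (H × H)}
    {G' : Submodule ℂ (H' × H')} (h : IntertwinesGraph W G G') (hG : HasCompactResolvent G) :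
    HasCompactResolvent G' := by
  obtain ⟨R, hR, hR2⟩ := hG
  refine ⟨(W.toContinuousLinearEquiv : H →L[ℂ] H') ∘L R ∘L
    (W.symm.toContinuousLinearEquiv : H' →L[ℂ] H), ?_, fun u f => ?_⟩
  · exact (hR.comp_clm _).clm_comp _
  · have h1 := h (W.symm u) (W.symm f)
    rw [W.apply_symm_apply, W.apply_symm_apply] at h1
    rw [← h1, hR2, ← map_add, ← W.injective.eq_iff, W.apply_symm_apply]
    rfl

theorem IntertwinesGraph.trans {H'' : Type*} [NormedAddCommGroup H''] [InnerProductSpace ℂ H'']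
    {W : H ≃ₗᵢ[ℂ] H'} {W' : H' ≃ₗᵢ[ℂ] H''} {G : Submodule ℂ (H × H)} {G' : Submodule ℂ (H' × H')}
    {G'' : Submodule ℂ (H'' × H'')} (h : IntertwinesGraph W G G') (h' : IntertwinesGraph W' G' G'') :
    IntertwinesGraph (W.trans W') G G'' := fun u f => (h u f).trans (h' _ _)

theorem IsFormGraph.intertwines {W : H ≃ₗᵢ[ℂ] H'} {G : Submodule ℂ (H × H)}
    {G' : Submodule ℂ (H' × H')} (h : IntertwinesGraph W G G') {q : V →ₗ⋆[ℂ] V →ₗ[ℂ] ℂ}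
    {J : V →ₗ[ℂ] H} (hG : IsFormGraph G q J) :
    IsFormGraph G' q ((W.toLinearEquiv : H →ₗ[ℂ] H') ∘ₗ J) := by
  intro u f
  have h1 := h (W.symm u) (W.symm f)
  rw [W.apply_symm_apply, W.apply_symm_apply] at h1
  rw [← h1, hG]
  refine exists_congr fun x => and_congr ?_ (forall_congr' fun y => ?_)
  · rw [← W.injective.eq_iff, W.apply_symm_apply]
    rfl
  · rw [← W.inner_map_map, W.apply_symm_apply]
    rfl

/-- A vector on which a non-negative form vanishes is in its kernel. -/
theorem IsNonnegForm.apply_eq_zero {q : V →ₗ⋆[ℂ] V →ₗ[ℂ] ℂ} (hq : IsNonnegForm q) {x : V}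
    (hx : q x x = 0) (y : V) : q y x = 0 := by
  set a := q x y with ha
  have hya : q y x = conj a := (hq.symm x y).symm
  set Q := (q y y).re with hQ
  have hQ0 : 0 ≤ Q := hq.nonneg y
  set r : ℝ := (Q + 1)⁻¹ with hr
  have hr0 : 0 < r := by positivity
  -- Minimization along the direction y: r ≤ 1 and r q(y, y) ≤ 1, so the form at this vector is at
  -- most -r|a|², which forces a = 0.
  have h1 := hq.nonneg (x - ((r : ℂ) * conj a) • y)
  have h2 : q (x - ((r : ℂ) * conj a) • y) (x - ((r : ℂ) * conj a) • y) =
      ((-(2 * r) : ℝ) : ℂ) * (a * conj a) + (r ^ 2 : ℝ) * (a * conj a) * q y y := by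
    simp only [map_sub, LinearMap.sub_apply, map_smul, LinearMap.map_smulₛₗ, LinearMap.smul_apply,
      smul_eq_mul, map_mul, Complex.conj_ofReal, Complex.conj_conj, hx, hya, ← ha]
    push_cast
    ring
  rw [h2, Complex.mul_conj, ← Complex.ofReal_mul, ← Complex.ofReal_mul, Complex.add_re,
    Complex.ofReal_re, Complex.re_ofReal_mul, ← hQ] at h1
  have h3 : r * Q ≤ 1 := by
    rw [hr, inv_mul_le_iff₀ (by positivity)]
    linarith
  have h4 : 0 ≤ Complex.normSq a := Complex.normSq_nonneg a
  have h5 : 0 ≤ -(r * Complex.normSq a) := by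
    have : r * Complex.normSq a * (r * Q) ≤ r * Complex.normSq a * 1 := by gcongr
    nlinarith
  have h6 : Complex.normSq a = 0 := by nlinarith
  rw [hya, Complex.normSq_eq_zero.1 h6, map_zero]

/-- The eigenspaces of a form operator with compact resolvent span the space. -/
theorem IsFormGraph.eq_zero_of_forall_eigenspace [CompleteSpace H] {G : Submodule ℂ (H × H)}
    {q : V →ₗ⋆[ℂ] V →ₗ[ℂ] ℂ} (hq : IsNonnegForm q) {J : V →ₗ[ℂ] H} (h : IsFormGraph G q J)
    (hJ : ∀ f : H, (∀ x, inner ℂ (J x) f = 0) → f = 0) (hG : HasCompactResolvent G) {f : H}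
    (hf : ∀ t, ∀ u ∈ eigenspace G t, inner ℂ u f = 0) : f = 0 := by
  obtain ⟨R, hR, hRG⟩ := hG
  have hRf : ∀ f, (R f, f - R f) ∈ G := fun f => (hRG _ _).2 (by rw [sub_add_cancel])
  -- Symmetry of the form, evaluated at the preimages of `R f` and `R g`, becomes symmetry of the
  -- resolvent.
  have hsymm : R.IsSymmetric := by
    intro f g
    obtain ⟨x, hx, hx'⟩ := (h _ _).1 (hRf f)
    obtain ⟨y, hy, hy'⟩ := (h _ _).1 (hRf g)
    have h1 := hq.symm y x
    rw [hx' y, hy' x, hx, hy, inner_conj_symm, inner_sub_left, inner_sub_right] at h1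
    have h2 : inner ℂ f (R g) = inner ℂ (R f) g := by
      have := congrArg (· + inner ℂ (R f) (R g)) h1
      simpa using this
    exact h2.symm
  -- `J` need not be injective, so R g = 0 does not make its preimage `x` vanish. But q(x, x) = 0,
  -- hence q(y, x) = 0 for all y, and `g` is orthogonal to the dense range of `J`.
  have hker : ∀ g, R g = 0 → g = 0 := by
    intro g hg
    obtain ⟨x, hx, hx'⟩ := (h _ _).1 (hRf g)
    rw [hg] at hx
    have h0 : q x x = 0 := by rw [hx', hx, inner_zero_left]
    refine hJ g fun y => ?_
    have := hq.apply_eq_zero h0 y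
    rwa [hx', hg, sub_zero] at this
  have hbot := ContinuousLinearMap.orthogonalComplement_iSup_eigenspaces_eq_bot hR hsymm
  have hmem : f ∈ (⨆ μ, Module.End.eigenspace (R : Module.End ℂ H) μ)ᗮ := by
    rw [← Submodule.iInf_orthogonal, Submodule.mem_iInf]
    intro κ
    rw [Submodule.mem_orthogonal]
    intro u hu
    by_cases hu0 : u = 0
    · rw [hu0, inner_zero_left]
    have hRu : R u = κ • u := Module.End.mem_eigenspace_iff.1 hu
    have hκ : κ ≠ 0 := by
      rintro rfl
      exact hu0 (hker u (by rw [hRu, zero_smul]))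
    have hreal : ((κ.re : ℝ) : ℂ) = κ := by
      have hev : Module.End.HasEigenvalue (R : Module.End ℂ H) κ :=
        Module.End.hasEigenvalue_of_hasEigenvector ⟨hu, hu0⟩
      exact Complex.conj_eq_iff_re.1 (LinearMap.IsSymmetric.conj_eigenvalue_eq_self hsymm hev)
    -- An eigenvalue κ of R = (G + 1)⁻¹ is real and non-zero, and corresponds to the eigenvalue κ⁻¹
    -- - 1 of `G`; the spectral theorem for compact symmetric operators does the rest.
    refine hf (κ.re⁻¹ - 1) u ?_
    rw [SpectralStability.mem_eigenspace, hRG]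
    push_cast
    rw [hreal, sub_smul, one_smul, sub_add_cancel, map_smul, hRu, smul_smul, inv_mul_cancel₀ hκ,
      one_smul]
  rw [hbot] at hmem
  exact (Submodule.mem_bot ℂ).1 hmem

/-- Orthonormal eigenfunctions for an enumeration of the eigenvalues span the eigenspaces. -/
theorem IsEigenfunctionSeq.span_eq {G : Submodule ℂ (H × H)} {lam : ℕ → ℝ} {ψ : ℕ → H}
    (hl : IsEigenvalueSeq G lam) (hψ : IsEigenfunctionSeq G lam ψ) (t : ℝ) :
    Submodule.span ℂ (ψ '' {k | lam k = t}) = eigenspace G t := by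
  obtain ⟨h1, h2, h3⟩ := hl.2 t
  refine Submodule.eq_of_le_of_finrank_le (Submodule.span_le.2 ?_) ?_
  · rintro _ ⟨k, rfl, rfl⟩
    exact hψ.2 k
  · have : Fintype {k | lam k = t} := h1.fintype
    have hli : LinearIndependent ℂ fun k : {k | lam k = t} => ψ k :=
      (hψ.1.comp _ Subtype.val_injective).linearIndependent
    have h4 := finrank_span_eq_card hli
    rw [← Set.image_eq_range] at h4
    rw [h4, ← h3, ← Nat.card_coe_set_eq, Nat.card_eq_fintype_card]

/-- Otherwise `lam'` takes the value `lam n` only at places before `n`, where `lam` takes it too,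
and `lam` takes it once more at `n`: two different multiplicities for one eigenspace. -/
theorem IsEigenvalueSeq.le_of_forall_lt {G : Submodule ℂ (H × H)} {lam lam' : ℕ → ℝ}
    (h : IsEigenvalueSeq G lam) (h' : IsEigenvalueSeq G lam') {n : ℕ}
    (hn : ∀ k < n, lam k = lam' k) : lam' n ≤ lam n := by
  by_contra hlt
  rw [not_le] at hlt
  have hsub : {k | lam' k = lam n} ⊂ {k | lam k = lam n} := by
    have hlt' : ∀ k, lam' k = lam n → k < n := fun k hk => by
      by_contra hkn
      have := h'.1 (not_lt.1 hkn)
      linarith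
    refine ⟨fun k hk => ?_, fun hs => ?_⟩
    · exact (hn k (hlt' k hk)).trans hk
    · exact lt_irrefl n (hlt' n (hs rfl))
  have h1 := Set.ncard_lt_ncard hsub (h.2 (lam n)).1
  rw [(h.2 (lam n)).2.2, (h'.2 (lam n)).2.2] at h1
  exact lt_irrefl _ h1

/-- The enumeration of the eigenvalues is unique. -/
theorem IsEigenvalueSeq.unique {G : Submodule ℂ (H × H)} {lam lam' : ℕ → ℝ}
    (h : IsEigenvalueSeq G lam) (h' : IsEigenvalueSeq G lam') : lam = lam' := by
  funext n
  induction n using Nat.strong_induction_on with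
  | _ n ih => exact le_antisymm (h'.le_of_forall_lt h fun k hk => (ih k hk).symm) (h.le_of_forall_lt h' ih)

/-- An eigenvalue sequence and orthonormal eigenfunctions yield an eigenbasis of the form. -/
theorem IsFormGraph.exists_isEigenbasis [CompleteSpace H] {G : Submodule ℂ (H × H)}
    {q : V →ₗ⋆[ℂ] V →ₗ[ℂ] ℂ} (hq : IsNonnegForm q) {J : V →ₗ[ℂ] H} (h : IsFormGraph G q J)
    (hJ : ∀ f : H, (∀ x, inner ℂ (J x) f = 0) → f = 0) (hG : HasCompactResolvent G)
    {lam : ℕ → ℝ} {ψ : ℕ → H} (hl : IsEigenvalueSeq G lam) (hψ : IsEigenfunctionSeq G lam ψ) :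
    ∃ e : ℕ → V, (∀ k, J (e k) = ψ k) ∧ IsEigenbasis q J lam e := by
  have h1 : ∀ k, ∃ x, J x = ψ k ∧ IsFormEigen q J (lam k) x := fun k => h.mem_eigenspace.1 (hψ.2 k)
  choose e he he' using h1
  refine ⟨e, he, he', by simpa only [he] using hψ.1, fun f hf => ?_, hl.1⟩
  refine h.eq_zero_of_forall_eigenspace hq hJ hG fun t u hu => ?_
  rw [← hψ.span_eq hl] at hu
  have hf' : ∀ v ∈ ψ '' {k | lam k = t}, inner ℂ v f = 0 := by
    rintro _ ⟨k, -, rfl⟩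
    rw [← he]
    exact hf k
  induction hu using Submodule.span_induction with
  | mem v hv => exact hf' v hv
  | zero => exact inner_zero_left _
  | add v w _ _ hv hw => rw [inner_add_left, hv, hw, add_zero]
  | smul c v _ hv => rw [inner_smul_left, hv, mul_zero]

/-- The expansion of an eigenvector in the eigenfunctions for the same eigenvalue. -/
theorem IsEigenfunctionSeq.eq_sum {G : Submodule ℂ (H × H)} {lam : ℕ → ℝ} {ψ : ℕ → H}
    (hl : IsEigenvalueSeq G lam) (hψ : IsEigenfunctionSeq G lam ψ) {t : ℝ} {u : H}
    (hu : u ∈ eigenspace G t) :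
    u = ∑ k ∈ (hl.2 t).1.toFinset, (inner ℂ (ψ k) u) • ψ k := by
  rw [← hψ.span_eq hl] at hu
  induction hu using Submodule.span_induction with
  | mem v hv =>
    obtain ⟨k, hk, rfl⟩ := hv
    rw [Finset.sum_eq_single k]
    · rw [inner_self_eq_norm_sq_to_K, hψ.1.1 k]
      simp
    · intro j _ hj
      rw [hψ.1.2 hj, zero_smul]
    · intro hk'
      exact absurd ((hl.2 t).1.mem_toFinset.2 hk) hk'
  | zero => simp
  | add v w _ _ hv hw =>
    simp only [inner_add_right, add_smul, Finset.sum_add_distrib]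
    rw [← hv, ← hw]
  | smul c v _ hv =>
    simp only [inner_smul_right, mul_smul]
    rw [← Finset.smul_sum, ← hv]

end FormGraph

/-! ### Form densities -/

/-- A real matrix acting on `ℂ^N`. -/
def matMulVec (M : Matrix (Fin N) (Fin N) ℝ) (F : CVec N) : CVec N :=
  WithLp.toLp 2 fun i => ∑ j, (M i j : ℂ) * F j

theorem matMulVec_apply (M : Matrix (Fin N) (Fin N) ℝ) (F : CVec N) (i : Fin N) :
    matMulVec M F i = ∑ j, (M i j : ℂ) * F j := rfl

theorem pullGrad_eq_matMulVec (χ : E N → E N) (F : E N → CVec N) (x : E N) :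
    pullGrad χ F x = matMulVec (jacobian χ x).transpose (F (χ x)) := rfl

theorem matMulVec_mul (M M' : Matrix (Fin N) (Fin N) ℝ) (F : CVec N) :
    matMulVec (M * M') F = matMulVec M (matMulVec M' F) := by
  ext i
  simp only [matMulVec_apply, Matrix.mul_apply, Complex.ofReal_sum, Complex.ofReal_mul,
    Finset.sum_mul, Finset.mul_sum]
  rw [Finset.sum_comm]
  simp only [mul_assoc]

theorem matMulVec_one (F : CVec N) : matMulVec (1 : Matrix (Fin N) (Fin N) ℝ) F = F := by
  ext i
  rw [matMulVec_apply, Finset.sum_eq_single i]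
  · simp
  · intro j _ hj
    simp [Matrix.one_apply_ne hj.symm]
  · simp

theorem inner_matMulVec (M : Matrix (Fin N) (Fin N) ℝ) (F G : CVec N) :
    inner ℂ (matMulVec M F) G = inner ℂ F (matMulVec M.transpose G) := by
  simp only [PiLp.inner_apply, matMulVec_apply, RCLike.inner_apply, map_sum, map_mul,
    Complex.conj_ofReal, Finset.mul_sum, Finset.sum_mul, Matrix.transpose_apply]
  rw [Finset.sum_comm]
  refine Finset.sum_congr rfl fun i _ => Finset.sum_congr rfl fun j _ => ?_
  ring

theorem formDensity_eq_inner (B : Matrix (Fin N) (Fin N) ℝ) (F G : CVec N) :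
    formDensity B F G = inner ℂ G (matMulVec B.transpose F) := by
  simp only [formDensity, PiLp.inner_apply, matMulVec_apply, RCLike.inner_apply, Finset.sum_mul,
    Matrix.transpose_apply]
  rw [Finset.sum_comm]

theorem conj_formDensity {B : Matrix (Fin N) (Fin N) ℝ} (hB : B.IsSymm) (F G : CVec N) :
    conj (formDensity B F G) = formDensity B G F := by
  rw [formDensity_eq_inner, formDensity_eq_inner, inner_conj_symm, inner_matMulVec,
    Matrix.transpose_transpose, hB]

theorem formDensity_add_right (B : Matrix (Fin N) (Fin N) ℝ) (F G G' : CVec N) :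
    formDensity B F (G + G') = formDensity B F G + formDensity B F G' := by
  simp only [formDensity_eq_inner, inner_add_left]

theorem formDensity_smul_right (B : Matrix (Fin N) (Fin N) ℝ) (k : ℂ) (F G : CVec N) :
    formDensity B F (k • G) = conj k * formDensity B F G := by
  simp only [formDensity_eq_inner, inner_smul_left]

theorem formDensity_conj_mul (M B : Matrix (Fin N) (Fin N) ℝ) (F G : CVec N) :
    formDensity (M * B * M.transpose) F G =
      formDensity B (matMulVec M.transpose F) (matMulVec M.transpose G) := by
  rw [formDensity_eq_inner, formDensity_eq_inner, inner_matMulVec, Matrix.transpose_transpose,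
    Matrix.transpose_mul, Matrix.transpose_mul, Matrix.transpose_transpose, ← matMulVec_mul,
    ← matMulVec_mul, Matrix.mul_assoc]

/-- The factors (∇χ)⁻ᵗ of the pulled-back matrix cancel the factors (∇χ)ᵗ of the pulled-back
gradients. -/
theorem formDensity_pullbackMatrix (A : E N → Matrix (Fin N) (Fin N) ℝ) (χ : E N → E N) {x : E N}
    (hx : 0 < jacDet χ x) (F G : E N → CVec N) :
    formDensity (pullbackMatrix A χ x) (pullGrad χ F x) (pullGrad χ G x) =
      formDensity (A (χ x)) (F (χ x)) (G (χ x)) := by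
  have hdet : IsUnit (jacobian χ x).det := by
    rw [isUnit_iff_ne_zero]
    intro h
    rw [jacDet, h, abs_zero] at hx
    exact lt_irrefl _ hx
  have h1 : ((jacobian χ x)⁻¹).transpose * (jacobian χ x).transpose = 1 := by
    rw [← Matrix.transpose_mul, Matrix.mul_nonsing_inv _ hdet, Matrix.transpose_one]
  rw [pullbackMatrix, formDensity_conj_mul, pullGrad_eq_matMulVec, pullGrad_eq_matMulVec,
    ← matMulVec_mul, ← matMulVec_mul, h1, matMulVec_one, matMulVec_one]

theorem pullbackMatrix_isSymm {A : E N → Matrix (Fin N) (Fin N) ℝ} (hA : ∀ x, (A x).IsSymm)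
    (χ : E N → E N) (x : E N) : (pullbackMatrix A χ x).IsSymm := by
  rw [Matrix.IsSymm, pullbackMatrix, Matrix.transpose_mul, Matrix.transpose_mul,
    Matrix.transpose_transpose, (hA _).eq, Matrix.mul_assoc]

theorem norm_formDensity_le (B : Matrix (Fin N) (Fin N) ℝ) (F G : CVec N) :
    ‖formDensity B F G‖ ≤ (∑ i, ∑ j, |B i j|) * (‖F‖ * ‖G‖) := by
  rw [formDensity, Finset.sum_mul]
  refine (norm_sum_le _ _).trans (Finset.sum_le_sum fun i _ => ?_)
  rw [Finset.sum_mul]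
  refine (norm_sum_le _ _).trans (Finset.sum_le_sum fun j _ => ?_)
  rw [norm_mul, norm_mul, Complex.norm_real, RCLike.norm_conj, Real.norm_eq_abs, mul_assoc]
  have := mul_le_mul (PiLp.norm_apply_le (p := 2) F i) (PiLp.norm_apply_le (p := 2) G j)
    (norm_nonneg _) (norm_nonneg _)
  gcongr

theorem IsElliptic.le_formDensity {A : E N → Matrix (Fin N) (Fin N) ℝ} {θ : ℝ} (hA : IsElliptic A θ)
    (x : E N) (F : CVec N) : θ⁻¹ * ‖F‖ ^ 2 ≤ (formDensity (A x) F F).re := by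
  have h1 := add_le_add (hA.lower x fun i => (F i).re) (hA.lower x fun i => (F i).im)
  have h2 : (formDensity (A x) F F).re = (∑ i, ∑ j, A x i j * (F i).re * (F j).re) +
      ∑ i, ∑ j, A x i j * (F i).im * (F j).im := by
    simp only [formDensity, Complex.re_sum, ← Finset.sum_add_distrib]
    refine Finset.sum_congr rfl fun i _ => Finset.sum_congr rfl fun j _ => ?_
    simp
  have h3 : ‖F‖ ^ 2 = (∑ i, (F i).re ^ 2) + ∑ i, (F i).im ^ 2 := by
    rw [EuclideanSpace.norm_sq_eq, ← Finset.sum_add_distrib]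
    refine Finset.sum_congr rfl fun i _ => ?_
    rw [← Complex.normSq_eq_norm_sq, Complex.normSq_apply]
    ring
  rw [h2, h3, mul_add]
  exact h1

theorem IsElliptic.formDensity_nonneg {A : E N → Matrix (Fin N) (Fin N) ℝ} {θ : ℝ}
    (hA : IsElliptic A θ) (x : E N) (F : CVec N) : 0 ≤ (formDensity (A x) F F).re := by
  refine le_trans ?_ (hA.le_formDensity x F)
  have := hA.one_le
  positivity

theorem IsElliptic.pullbackMatrix_nonneg {A : E N → Matrix (Fin N) (Fin N) ℝ} {θ : ℝ}
    (hA : IsElliptic A θ) (χ : E N → E N) (x : E N) (F : CVec N) :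
    0 ≤ (formDensity (pullbackMatrix A χ x) F F).re := by
  rw [pullbackMatrix, formDensity_conj_mul]
  exact hA.formDensity_nonneg _ _

theorem IsElliptic.exists_bound {A : E N → Matrix (Fin N) (Fin N) ℝ} {θ : ℝ} (hA : IsElliptic A θ) :
    ∃ C : ℝ, ∀ᵐ x, ∑ i, ∑ j, |A x i j| ≤ C := by
  have h1 : ∀ i j, ∃ C : ℝ, ∀ᵐ x, |A x i j| ≤ C := fun i j => by
    refine ⟨(eLpNorm (fun x => A x i j) ⊤ volume).toReal, ?_⟩
    filter_upwards [ae_le_eLpNormEssSup (f := fun x => A x i j) (μ := volume)] with x hx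
    have h2 := (hA.memLp i j).2.ne
    rw [← eLpNorm_exponent_top] at hx
    have h3 := ENNReal.toReal_mono h2 hx
    rwa [toReal_enorm, Real.norm_eq_abs] at h3
  choose C hC using h1
  refine ⟨∑ i, ∑ j, C i j, ?_⟩
  have h2 : ∀ᵐ x, ∀ i j, |A x i j| ≤ C i j := by
    rw [ae_all_iff]
    intro i
    rw [ae_all_iff]
    exact hC i
  filter_upwards [h2] with x hx
  exact Finset.sum_le_sum fun i _ => Finset.sum_le_sum fun j _ => hx i j

theorem aestronglyMeasurable_formDensity {μ : Measure (E N)} {B : E N → Matrix (Fin N) (Fin N) ℝ}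
    (hB : ∀ i j, AEStronglyMeasurable (fun x => B x i j) μ) {F G : E N → CVec N}
    (hF : AEStronglyMeasurable F μ) (hG : AEStronglyMeasurable G μ) :
    AEStronglyMeasurable (fun x => formDensity (B x) (F x) (G x)) μ := by
  unfold formDensity
  refine Finset.aestronglyMeasurable_fun_sum _ fun i _ => Finset.aestronglyMeasurable_fun_sum _ fun j _ => ?_
  exact ((Complex.continuous_ofReal.comp_aestronglyMeasurable (hB i j)).mul
    (aestronglyMeasurable_coord hF i)).mul
    (Complex.continuous_conj.comp_aestronglyMeasurable (aestronglyMeasurable_coord hG j))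

theorem IsElliptic.integrable_formDensity {A : E N → Matrix (Fin N) (Fin N) ℝ} {θ : ℝ}
    (hA : IsElliptic A θ) {U : Set (E N)} {F G : E N → CVec N}
    (hF : MemLp F 2 (volume.restrict U)) (hG : MemLp G 2 (volume.restrict U)) :
    Integrable (fun x => formDensity (A x) (F x) (G x)) (volume.restrict U) := by
  obtain ⟨C, hC⟩ := hA.exists_bound
  have h1 : Integrable (fun x => ‖F x‖ * ‖G x‖) (volume.restrict U) := hF.norm.integrable_mul hG.norm
  refine (h1.const_mul C).mono' (aestronglyMeasurable_formDensity
    (fun i j => (hA.memLp i j).1.restrict) hF.1 hG.1) ?_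
  filter_upwards [ae_restrict_of_ae hC] with x hx
  refine (norm_formDensity_le _ _ _).trans ?_
  gcongr

/-! ### Forms and embeddings on a space of functions with weak gradients -/

/-- The form `∫ ∑ B_{ij} ∂_i u conj(∂_j v) dν` on `D`, conjugate linear in `v`. -/
def gradientForm (ν : Measure (E N)) (D : Submodule ℂ ((E N → ℂ) × (E N → CVec N)))
    (B : E N → Matrix (Fin N) (Fin N) ℝ)
    (hI : ∀ p ∈ D, ∀ r ∈ D, Integrable (fun x => formDensity (B x) (p.2 x) (r.2 x)) ν) :
    D →ₗ⋆[ℂ] D →ₗ[ℂ] ℂ :=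
  LinearMap.mk₂'ₛₗ (starRingEnd ℂ) (RingHom.id ℂ)
    (fun r p => ∫ x, formDensity (B x) (p.1.2 x) (r.1.2 x) ∂ν)
    (fun r r' p => by
      rw [← integral_add (hI p p.2 r r.2) (hI p p.2 r' r'.2)]
      exact integral_congr_ae (Filter.Eventually.of_forall fun x => formDensity_add_right _ _ _ _))
    (fun k r p => by
      rw [smul_eq_mul, ← integral_const_mul]
      exact integral_congr_ae (Filter.Eventually.of_forall fun x => formDensity_smul_right _ _ _ _))
    (fun r p p' => by
      rw [← integral_add (hI p p.2 r r.2) (hI p' p'.2 r r.2)]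
      exact integral_congr_ae (Filter.Eventually.of_forall fun x => formDensity_add _ _ _ _))
    (fun k r p => by
      rw [RingHom.id_apply, smul_eq_mul, ← integral_const_mul]
      exact integral_congr_ae (Filter.Eventually.of_forall fun x => formDensity_smul _ _ _ _))

theorem gradientForm_apply {ν : Measure (E N)} {D : Submodule ℂ ((E N → ℂ) × (E N → CVec N))}
    {B : E N → Matrix (Fin N) (Fin N) ℝ}
    (hI : ∀ p ∈ D, ∀ r ∈ D, Integrable (fun x => formDensity (B x) (p.2 x) (r.2 x)) ν) (r p : D) :
    gradientForm ν D B hI r p = ∫ x, formDensity (B x) (p.1.2 x) (r.1.2 x) ∂ν := rfl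

theorem gradientForm_isNonnegForm {ν : Measure (E N)}
    {D : Submodule ℂ ((E N → ℂ) × (E N → CVec N))} {B : E N → Matrix (Fin N) (Fin N) ℝ}
    (hI : ∀ p ∈ D, ∀ r ∈ D, Integrable (fun x => formDensity (B x) (p.2 x) (r.2 x)) ν)
    (hB : ∀ x, (B x).IsSymm) (hpos : ∀ x F, 0 ≤ (formDensity (B x) F F).re) :
    IsNonnegForm (gradientForm ν D B hI) where
  symm x y := by
    rw [gradientForm_apply, gradientForm_apply, ← integral_conj]
    exact integral_congr_ae (Filter.Eventually.of_forall fun z => conj_formDensity (hB z) _ _)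
  nonneg x := by
    rw [gradientForm_apply]
    have h1 := integral_re (hI x x.2 x x.2)
    refine le_of_le_of_eq ?_ h1
    exact integral_nonneg fun z => hpos z _

/-- The embedding of `D` in `L²(μ)`. -/
def embedLp (μ : Measure (E N)) (D : Submodule ℂ ((E N → ℂ) × (E N → CVec N)))
    (hM : ∀ p ∈ D, MemLp p.1 2 μ) : D →ₗ[ℂ] Lp ℂ 2 μ where
  toFun p := (hM p p.2).toLp
  map_add' p r := MemLp.toLp_add (hM p p.2) (hM r r.2)
  map_smul' k p := MemLp.toLp_const_smul k (hM p p.2)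

theorem coeFn_embedLp {μ : Measure (E N)} {D : Submodule ℂ ((E N → ℂ) × (E N → CVec N))}
    (hM : ∀ p ∈ D, MemLp p.1 2 μ) (p : D) : embedLp μ D hM p =ᵐ[μ] p.1.1 :=
  MemLp.coeFn_toLp (hM p p.2)

theorem isFormGraph_formOperator {μ ν : Measure (E N)}
    {D : Submodule ℂ ((E N → ℂ) × (E N → CVec N))} {B : E N → Matrix (Fin N) (Fin N) ℝ}
    (hI : ∀ p ∈ D, ∀ r ∈ D, Integrable (fun x => formDensity (B x) (p.2 x) (r.2 x)) ν)
    (hM : ∀ p ∈ D, MemLp p.1 2 μ) :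
    IsFormGraph (formOperator μ ν D B) (gradientForm ν D B hI) (embedLp μ D hM) := by
  intro u f
  constructor
  · rintro ⟨p, hp, hup, h⟩
    refine ⟨⟨p, hp⟩, ?_, fun r => (h r r.2 _ (coeFn_embedLp hM r)).2⟩
    exact Lp.ext ((coeFn_embedLp hM _).trans hup.symm)
  · rintro ⟨p, rfl, h⟩
    refine ⟨p, p.2, coeFn_embedLp hM p, fun r hr v hv => ⟨hI p p.2 r hr, ?_⟩⟩
    have : v = embedLp μ D hM ⟨r, hr⟩ := Lp.ext (hv.trans (coeFn_embedLp hM ⟨r, hr⟩).symm)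
    rw [this]
    exact h ⟨r, hr⟩


/-! ### Change of variables as a unitary equivalence of operators -/

theorem weightedMeasure_ac {U : Set (E N)} (hU : IsOpen U) {χ : E N → E N}
    (h : IsBiLipschitz U χ) : weightedMeasure U χ ≪ volume.restrict U := by
  rw [← Measure.ae_le_iff_absolutelyContinuous, ae_weightedMeasure hU h]

theorem restrict_ac_weightedMeasure {U : Set (E N)} (hU : IsOpen U) {χ : E N → E N}
    (h : IsBiLipschitz U χ) : volume.restrict U ≪ weightedMeasure U χ := by
  rw [← Measure.ae_le_iff_absolutelyContinuous, ae_weightedMeasure hU h]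

theorem lintegral_weightedMeasure {U : Set (E N)} (χ : E N → E N) {f : E N → ℝ≥0∞}
    (hf : AEMeasurable f (volume.restrict U)) :
    ∫⁻ x, f x ∂weightedMeasure U χ = ∫⁻ x in U, ENNReal.ofReal (jacDet χ x) * f x :=
  lintegral_withDensity_eq_lintegral_mul₀ (measurable_jacDet χ).ennreal_ofReal.aemeasurable hf

theorem eLpNorm_weightedMeasure {U : Set (E N)} (χ : E N → E N) {f : E N → ℂ}
    (hf : AEStronglyMeasurable f (volume.restrict U)) :
    eLpNorm f 2 (weightedMeasure U χ) =
      eLpNorm (fun x => √(jacDet χ x) • f x) 2 (volume.restrict U) := by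
  rw [eLpNorm_eq_lintegral_rpow_enorm_toReal (by norm_num) (by norm_num),
    eLpNorm_eq_lintegral_rpow_enorm_toReal (by norm_num) (by norm_num),
    lintegral_weightedMeasure χ (hf.enorm.pow_const _)]
  congr 1
  refine lintegral_congr fun x => ?_
  rw [enorm_smul, ENNReal.mul_rpow_of_nonneg _ _ (by norm_num), Real.enorm_of_nonneg (Real.sqrt_nonneg _),
    ENNReal.ofReal_rpow_of_nonneg (Real.sqrt_nonneg _) (by norm_num)]
  congr 2
  rw [ENNReal.toReal_ofNat, Real.rpow_two, Real.sq_sqrt (jacDet_nonneg χ x)]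

theorem memLp_weightedMeasure_iff {U : Set (E N)} (hU : IsOpen U) {χ : E N → E N}
    (h : IsBiLipschitz U χ) {f : E N → ℂ} : MemLp f 2 (weightedMeasure U χ) ↔
      MemLp (fun x => √(jacDet χ x) • f x) 2 (volume.restrict U) := by
  have hs : AEStronglyMeasurable (fun x => √(jacDet χ x)) (volume.restrict U) :=
    (measurable_jacDet χ).sqrt.aestronglyMeasurable
  constructor
  · intro hf
    have hm := hf.1.mono_ac (restrict_ac_weightedMeasure hU h)
    exact ⟨hs.smul hm, by rw [← eLpNorm_weightedMeasure χ hm]; exact hf.2⟩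
  · intro hf
    have hm : AEStronglyMeasurable f (volume.restrict U) := by
      have h1 : AEStronglyMeasurable (fun x => (√(jacDet χ x))⁻¹ • (√(jacDet χ x) • f x))
          (volume.restrict U) :=
        ((measurable_jacDet χ).sqrt.inv.aestronglyMeasurable).smul hf.1
      refine h1.congr ?_
      filter_upwards [h.ae_jacDet_pos hU] with x hx
      rw [smul_smul, inv_mul_cancel₀ (Real.sqrt_pos.2 hx).ne', one_smul]
    exact ⟨hm.mono_ac (weightedMeasure_ac hU h), by rw [eLpNorm_weightedMeasure χ hm]; exact hf.2⟩

/-- Multiplication by `g^{1/2}` is a unitary map from `L²(g dx)` to `L²(dx)`. -/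
theorem exists_sqrt_isometry {U : Set (E N)} (hU : IsOpen U) {χ : E N → E N}
    (h : IsBiLipschitz U χ) : ∃ W : Lp ℂ 2 (weightedMeasure U χ) ≃ₗᵢ[ℂ] Lp ℂ 2 (volume.restrict U),
      ∀ f, W f =ᵐ[volume.restrict U] fun x => √(jacDet χ x) • f x := by
  have hm : ∀ f : Lp ℂ 2 (weightedMeasure U χ),
      MemLp (fun x => √(jacDet χ x) • f x) 2 (volume.restrict U) := fun f =>
    (memLp_weightedMeasure_iff hU h).1 (Lp.memLp f)
  have hac := restrict_ac_weightedMeasure hU h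
  let W₀ : Lp ℂ 2 (weightedMeasure U χ) →ₗᵢ[ℂ] Lp ℂ 2 (volume.restrict U) :=
    { toFun := fun f => (hm f).toLp
      map_add' := fun f f' => by
        rw [← MemLp.toLp_add, MemLp.toLp_eq_toLp_iff]
        filter_upwards [hac.ae_le (Lp.coeFn_add f f')] with x hx
        rw [hx, Pi.add_apply, Pi.add_apply, smul_add]
      map_smul' := fun k f => by
        rw [RingHom.id_apply, ← MemLp.toLp_const_smul, MemLp.toLp_eq_toLp_iff]
        filter_upwards [hac.ae_le (Lp.coeFn_smul k f)] with x hx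
        rw [hx, Pi.smul_apply, Pi.smul_apply, smul_comm]
      norm_map' := fun f => by
        change ‖(hm f).toLp‖ = ‖f‖
        rw [Lp.norm_toLp, ← eLpNorm_weightedMeasure χ ((Lp.memLp f).1.mono_ac hac), Lp.norm_def] }
  have hsurj : Function.Surjective W₀ := by
    intro k
    have hk : (fun x => √(jacDet χ x) • ((√(jacDet χ x))⁻¹ • k x)) =ᵐ[volume.restrict U] k := by
      filter_upwards [h.ae_jacDet_pos hU] with x hx
      rw [smul_smul, mul_inv_cancel₀ (Real.sqrt_pos.2 hx).ne', one_smul]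
    have hk2 : MemLp (fun x => (√(jacDet χ x))⁻¹ • k x) 2 (weightedMeasure U χ) :=
      (memLp_weightedMeasure_iff hU h).2 ((Lp.memLp k).ae_eq hk.symm)
    refine ⟨hk2.toLp, Lp.ext ?_⟩
    refine (MemLp.coeFn_toLp (hm hk2.toLp)).trans (Filter.EventuallyEq.trans ?_ hk)
    filter_upwards [hac.ae_le hk2.coeFn_toLp] with x hx
    rw [hx]
  exact ⟨LinearIsometryEquiv.ofSurjective W₀ hsurj, fun f => MemLp.coeFn_toLp (hm f)⟩

/-- The composition with `χ` is a unitary map from `L²(χ(U))` to `L²(U, g dx)`. -/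
theorem exists_comp_isometry {U : Set (E N)} (hU : IsOpen U) {χ : E N → E N}
    (h : IsBiLipschitz U χ) :
    ∃ W : Lp ℂ 2 (volume.restrict (χ '' U)) ≃ₗᵢ[ℂ] Lp ℂ 2 (weightedMeasure U χ),
      ∀ f, W f =ᵐ[volume.restrict U] fun x => f (χ x) := by
  obtain ⟨χ', ⟨K, hK⟩, he⟩ := h.exists_extension
  have hmp := h.measurePreserving hU hK.continuous.measurable he
  have hac := restrict_ac_weightedMeasure hU h
  have hW : ∀ f : Lp ℂ 2 (volume.restrict (χ '' U)),
      Lp.compMeasurePreservingₗᵢ ℂ χ' hmp f =ᵐ[volume.restrict U] fun x => f (χ x) := fun f => by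
    filter_upwards [hac.ae_le (Lp.coeFn_compMeasurePreserving f hmp), ae_restrict_mem hU.measurableSet]
      with x hx hxU
    rw [he hxU]
    exact hx
  have hsurj : Function.Surjective
      (Lp.compMeasurePreservingₗᵢ (E := ℂ) (p := 2) ℂ χ' hmp) := by
    intro f
    have hf := (Lp.memLp f).1.mono_ac hac
    have hinv := h.inverse hU
    have hm1 : AEStronglyMeasurable (fun y => f (invMap U χ y)) (volume.restrict (χ '' U)) :=
      hinv.aestronglyMeasurable_comp h.isOpen_image (by rwa [h.invMap_image])
    have hcomp : (fun x => f (invMap U χ (χ x))) =ᵐ[volume.restrict U] f := by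
      filter_upwards [ae_restrict_mem hU.measurableSet] with x hx
      rw [h.invMap_apply hx]
    have hm2 : MemLp (fun y => f (invMap U χ y)) 2 (volume.restrict (χ '' U)) := by
      refine ⟨hm1, ?_⟩
      rw [← h.eLpNorm_weighted hU 2 hm1, eLpNorm_congr_ae ((weightedMeasure_ac hU h).ae_le hcomp)]
      exact (Lp.memLp f).2
    refine ⟨hm2.toLp, Lp.ext ((weightedMeasure_ac hU h).ae_le ((hW _).trans ?_))⟩
    filter_upwards [h.ae_comp hU hm2.coeFn_toLp, hcomp] with x hx hx'
    rw [hx, hx']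
  exact ⟨LinearIsometryEquiv.ofSurjective _ hsurj, hW⟩

theorem IsBiLipschitz.ae_of_ae_comp {U : Set (E N)} (hU : IsOpen U) {χ : E N → E N}
    (h : IsBiLipschitz U χ) {P : E N → Prop} (hP : ∀ᵐ x ∂volume.restrict U, P (χ x)) :
    ∀ᵐ y ∂volume.restrict (χ '' U), P y := by
  have h1 : ∀ᵐ x ∂volume.restrict (invMap U χ '' (χ '' U)), P (χ x) := by rwa [h.invMap_image]
  filter_upwards [(h.inverse hU).ae_comp h.isOpen_image h1,
    ae_restrict_mem h.isOpen_image.measurableSet] with y hy hyU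
  obtain ⟨x, hx, rfl⟩ := hyU
  rwa [h.invMap_apply hx] at hy

section Pullback

variable {bc : BoundaryCondition} {U : Set (E N)} {χ : E N → E N}

theorem pullbackDomain_le_sobolev (hU : IsOpen U) (h : IsBiLipschitz U χ) :
    pullbackDomain bc U χ ≤ sobolev U := by
  intro p hp
  obtain ⟨q, hq, h1, h2⟩ := exists_of_mem_pullbackDomain hU h hp
  exact mem_sobolev_congr (h.comp_mem_sobolev hU (formDomain_le_sobolev bc _ hq)) h1.symm h2.symm

theorem memLp_weighted_of_mem_sobolev (hU : IsOpen U) (h : IsBiLipschitz U χ)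
    {p : (E N → ℂ) × (E N → CVec N)} (hp : p ∈ sobolev U) : MemLp p.1 2 (weightedMeasure U χ) := by
  rw [memLp_weightedMeasure_iff hU h]
  obtain ⟨c, C, -, -, hC⟩ := h.jacDet_bounds hU
  refine hp.1.of_le_mul (c := √C) ((measurable_jacDet χ).sqrt.aestronglyMeasurable.smul hp.1.1) ?_
  filter_upwards [hC] with x hx
  rw [norm_smul, Real.norm_of_nonneg (Real.sqrt_nonneg _)]
  exact mul_le_mul_of_nonneg_right (Real.sqrt_le_sqrt hx.2.2.2.1) (norm_nonneg _)

theorem formDensity_pullback_ae (hU : IsOpen U) (h : IsBiLipschitz U χ)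
    (A : E N → Matrix (Fin N) (Fin N) ℝ) {F G F₀ G₀ : E N → CVec N}
    (hF : F =ᵐ[volume.restrict U] pullGrad χ F₀) (hG : G =ᵐ[volume.restrict U] pullGrad χ G₀) :
    (fun x => formDensity (pullbackMatrix A χ x) (F x) (G x)) =ᵐ[weightedMeasure U χ]
      fun x => formDensity (A (χ x)) (F₀ (χ x)) (G₀ (χ x)) := by
  rw [Filter.EventuallyEq, ae_weightedMeasure_iff hU h]
  filter_upwards [hF, hG, h.ae_jacDet_pos hU] with x h1 h2 h3
  rw [h1, h2, formDensity_pullbackMatrix A χ h3]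

theorem integrable_pullback (hU : IsOpen U) (h : IsBiLipschitz U χ)
    {A : E N → Matrix (Fin N) (Fin N) ℝ} {θ : ℝ} (hA : IsElliptic A θ)
    {p r : (E N → ℂ) × (E N → CVec N)} (hp : p ∈ pullbackDomain bc U χ)
    (hr : r ∈ pullbackDomain bc U χ) :
    Integrable (fun x => formDensity (pullbackMatrix A χ x) (p.2 x) (r.2 x))
      (weightedMeasure U χ) := by
  obtain ⟨p₀, hp₀, -, hp2⟩ := exists_of_mem_pullbackDomain hU h hp
  obtain ⟨r₀, hr₀, -, hr2⟩ := exists_of_mem_pullbackDomain hU h hr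
  have hi := hA.integrable_formDensity (formDomain_le_sobolev bc _ hp₀).2.1
    (formDomain_le_sobolev bc _ hr₀).2.1
  rw [integrable_congr (formDensity_pullback_ae hU h A hp2 hr2)]
  exact (h.integrable_weighted_iff hU hi.1).2 hi

theorem integral_pullback (hU : IsOpen U) (h : IsBiLipschitz U χ)
    {A : E N → Matrix (Fin N) (Fin N) ℝ} {θ : ℝ} (hA : IsElliptic A θ)
    {p r p₀ r₀ : (E N → ℂ) × (E N → CVec N)} (hp₀ : p₀ ∈ formDomain bc (χ '' U))
    (hr₀ : r₀ ∈ formDomain bc (χ '' U)) (hp : p.2 =ᵐ[volume.restrict U] pullGrad χ p₀.2)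
    (hr : r.2 =ᵐ[volume.restrict U] pullGrad χ r₀.2) :
    ∫ x, formDensity (pullbackMatrix A χ x) (p.2 x) (r.2 x) ∂weightedMeasure U χ =
      ∫ y in χ '' U, formDensity (A y) (p₀.2 y) (r₀.2 y) := by
  have hi := hA.integrable_formDensity (formDomain_le_sobolev bc _ hp₀).2.1
    (formDomain_le_sobolev bc _ hr₀).2.1
  rw [integral_congr_ae (formDensity_pullback_ae hU h A hp hr), h.integral_weighted hU hi.1]

/-- Composition with `χ` preserves inner products, and the pull-back maps the form domains onto each
other up to null sets and preserves the form; so the equations defining the two graphs are the same.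
-/
theorem intertwines_opL_opH (hU : IsOpen U) (h : IsBiLipschitz U χ)
    {A : E N → Matrix (Fin N) (Fin N) ℝ} {θ : ℝ} (hA : IsElliptic A θ)
    {W : Lp ℂ 2 (volume.restrict (χ '' U)) ≃ₗᵢ[ℂ] Lp ℂ 2 (weightedMeasure U χ)}
    (hW : ∀ f, W f =ᵐ[volume.restrict U] fun x => f (χ x)) :
    IntertwinesGraph W (opL bc A U χ) (opH bc A U χ) := by
  have hac := weightedMeasure_ac hU h
  have hac' := restrict_ac_weightedMeasure hU h
  have key : ∀ (v : Lp ℂ 2 (volume.restrict (χ '' U))) (r₀ r : E N → ℂ),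
      r =ᵐ[volume.restrict U] (fun x => r₀ (χ x)) →
      (v =ᵐ[volume.restrict (χ '' U)] r₀ ↔ W v =ᵐ[weightedMeasure U χ] r) := by
    intro v r₀ r hr
    constructor
    · intro hv
      refine hac.ae_le ?_
      filter_upwards [hW v, hr, h.ae_comp hU hv] with x h1 h2 h3
      rw [h1, h2, h3]
    · intro hv
      refine h.ae_of_ae_comp hU ?_
      filter_upwards [hW v, hr, hac'.ae_le hv] with x h1 h2 h3
      rw [← h1, ← h2, h3]
  intro u f
  constructor
  · rintro ⟨p₀, hp₀, hu, hall⟩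
    refine ⟨_, pullback_mem_pullbackDomain hU h hp₀, (key u p₀.1 _ Filter.EventuallyEq.rfl).1 hu,
      fun r hr v hv => ?_⟩
    refine ⟨integrable_pullback hU h hA (pullback_mem_pullbackDomain hU h hp₀) hr, ?_⟩
    obtain ⟨r₀, hr₀, hr1, hr2⟩ := exists_of_mem_pullbackDomain hU h hr
    rw [integral_pullback hU h hA hp₀ hr₀ Filter.EventuallyEq.rfl hr2]
    obtain ⟨v, rfl⟩ := W.surjective v
    rw [(hall r₀ hr₀ v ((key v r₀.1 r.1 hr1).2 hv)).2, W.inner_map_map]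
  · rintro ⟨p, hp, hu, hall⟩
    obtain ⟨p₀, hp₀, hp1, hp2⟩ := exists_of_mem_pullbackDomain hU h hp
    refine ⟨p₀, hp₀, (key u p₀.1 p.1 hp1).2 hu, fun r₀ hr₀ v hv => ?_⟩
    refine ⟨hA.integrable_formDensity (formDomain_le_sobolev bc _ hp₀).2.1
      (formDomain_le_sobolev bc _ hr₀).2.1, ?_⟩
    have h1 := (hall _ (pullback_mem_pullbackDomain hU h hr₀) (W v)
      ((key v r₀.1 _ Filter.EventuallyEq.rfl).1 hv)).2
    rwa [integral_pullback hU h hA hp₀ hr₀ hp2 Filter.EventuallyEq.rfl, W.inner_map_map] at h1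

/-- Multiplication by g̃^{1/2} followed by division by g^{1/2}, that is division by w. The identity
is written with w on the other side, as in the definition of w⁻¹H̃w. -/
theorem exists_weight_isometry {φ φt : E N → E N} (hU : IsOpen U) (h : IsBiLipschitz U φ)
    (ht : IsBiLipschitz U φt) :
    ∃ W : Lp ℂ 2 (weightedMeasure U φt) ≃ₗᵢ[ℂ] Lp ℂ 2 (weightedMeasure U φ),
      ∀ f : Lp ℂ 2 (weightedMeasure U φt), f =ᵐ[volume.restrict U] fun x => weightRatio φ φt x • W f x := by
  obtain ⟨M, hM⟩ := exists_sqrt_isometry hU h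
  obtain ⟨Mt, hMt⟩ := exists_sqrt_isometry hU ht
  refine ⟨Mt.trans M.symm, fun f => ?_⟩
  have h1 := hM (M.symm (Mt f))
  rw [M.apply_symm_apply] at h1
  filter_upwards [hMt f, h1, ht.ae_jacDet_pos hU] with x h2 h3 h4
  rw [h2] at h3
  change f x = weightRatio φ φt x • M.symm (Mt f) x
  rw [weightRatio, div_eq_inv_mul, mul_smul, ← h3, smul_smul,
    inv_mul_cancel₀ (Real.sqrt_pos.2 h4).ne', one_smul]

theorem intertwines_opH_opWHW {φ φt : E N → E N} (hU : IsOpen U) (h : IsBiLipschitz U φ)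
    (ht : IsBiLipschitz U φt) {A : E N → Matrix (Fin N) (Fin N) ℝ}
    {W : Lp ℂ 2 (weightedMeasure U φt) ≃ₗᵢ[ℂ] Lp ℂ 2 (weightedMeasure U φ)}
    (hW : ∀ f : Lp ℂ 2 (weightedMeasure U φt), f =ᵐ[volume.restrict U] fun x => weightRatio φ φt x • W f x) :
    IntertwinesGraph W (opH bc A U φt) (opWHW bc A U φ φt) := by
  have key : ∀ (f q : Lp ℂ 2 (weightedMeasure U φt)) (u : E N → ℂ),
      W f =ᵐ[weightedMeasure U φ] u → q =ᵐ[weightedMeasure U φt]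
        (fun x => weightRatio φ φt x • u x) → q = f := by
    intro f q u h1 h2
    refine Lp.ext ?_
    rw [Filter.EventuallyEq, ae_weightedMeasure hU h] at h1
    rw [Filter.EventuallyEq, ae_weightedMeasure hU ht] at h2 ⊢
    filter_upwards [h1, h2, hW f] with x h1 h2 h3
    rw [h2, h3, h1]
  intro u f
  constructor
  · intro hG
    exact ⟨W u, W f, Filter.EventuallyEq.rfl, Filter.EventuallyEq.rfl, (u, f), hG,
      (weightedMeasure_ac hU ht).ae_le (hW u), (weightedMeasure_ac hU ht).ae_le (hW f)⟩
  · rintro ⟨u', f', hu, hf, q, hq, h1, h2⟩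
    have e1 := key u q.1 u' hu h1
    have e2 := key f q.2 f' hf h2
    rw [← e1, ← e2]
    exact hq

/-- The form domain contains the pull-backs of test functions, for either boundary condition, and a
function orthogonal to the real test functions on χ(U) vanishes. -/
theorem embedLp_dense (hU : IsOpen U) (h : IsBiLipschitz U χ)
    {D : Submodule ℂ ((E N → ℂ) × (E N → CVec N))} (hD : D = pullbackDomain bc U χ)
    (hM : ∀ p ∈ D, MemLp p.1 2 (weightedMeasure U χ)) {f : Lp ℂ 2 (weightedMeasure U χ)}
    (hf : ∀ x, inner ℂ (embedLp (weightedMeasure U χ) D hM x) f = 0) : f = 0 := by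
  obtain ⟨W, hW⟩ := exists_comp_isometry hU h
  obtain ⟨k, rfl⟩ := W.surjective f
  have hk : k = 0 := by
    refine eq_zero_of_forall_test h.isOpen_image fun η h1 h2 h3 => ?_
    have hη : IsTestFunction (χ '' U) fun y => (η y : ℂ) := by
      refine ⟨Complex.ofRealCLM.contDiff.comp h1, h2.comp_left (g := fun r : ℝ => (r : ℂ)) (by simp), ?_⟩
      exact (tsupport_comp_subset (g := fun r : ℝ => (r : ℂ)) (by simp) η).trans h3
    have hmem := hη.mem_formDomain (bc := bc)
    have hL : MemLp (fun y => (η y : ℂ)) 2 (volume.restrict (χ '' U)) := hη.mem_sobolev.1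
    have hpD := pullback_mem_pullbackDomain hU h hmem
    rw [← hD] at hpD
    have hJ : embedLp (weightedMeasure U χ) D hM ⟨_, hpD⟩ = W hL.toLp := by
      refine Lp.ext ((coeFn_embedLp hM _).trans ((weightedMeasure_ac hU h).ae_le ?_))
      filter_upwards [hW hL.toLp, h.ae_comp hU hL.coeFn_toLp] with x hx hx'
      rw [hx, hx']
      rfl
    have h4 := hf ⟨_, hpD⟩
    rw [hJ, W.inner_map_map, L2.inner_def] at h4
    rw [← h4]
    refine integral_congr_ae ?_
    filter_upwards [hL.coeFn_toLp] with y hy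
    rw [hy, RCLike.inner_apply, Complex.conj_ofReal, mul_comm, Complex.real_smul]
  rw [hk, map_zero]

end Pullback

/-! ### Pointwise comparison of the two coefficient matrices -/

theorem matSqrt_isSymm (M : Matrix (Fin N) (Fin N) ℝ) : (matSqrt M).IsSymm := by
  have h : IsSelfAdjoint (matSqrt M) := cfc_predicate Real.sqrt M
  have h2 : star (matSqrt M) = matSqrt M := h
  rwa [Matrix.star_eq_conjTranspose, Matrix.conjTranspose_eq_transpose_of_trivial] at h2

theorem matSqrt_mul_self {M : Matrix (Fin N) (Fin N) ℝ} (hM : M.PosSemidef) :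
    matSqrt M * matSqrt M = M := by
  have hsa : IsSelfAdjoint M := hM.1
  have hspec := (Matrix.posSemidef_iff_isHermitian_and_spectrum_nonneg.1 hM).2
  rw [matSqrt, ← cfc_mul Real.sqrt Real.sqrt M]
  conv_rhs => rw [← cfc_id ℝ M]
  refine cfc_congr fun x hx => ?_
  exact Real.mul_self_sqrt (hspec hx)

theorem isUnit_matSqrt {M : Matrix (Fin N) (Fin N) ℝ} (hM : M.PosDef) : IsUnit (matSqrt M) := by
  have h : IsUnit (matSqrt M * matSqrt M) := by
    rw [matSqrt_mul_self hM.posSemidef]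
    exact hM.isUnit
  rw [Matrix.isUnit_iff_isUnit_det, Matrix.det_mul] at h
  exact (Matrix.isUnit_iff_isUnit_det _).2 (isUnit_of_mul_isUnit_left h)

theorem IsElliptic.posDef {A : E N → Matrix (Fin N) (Fin N) ℝ} {θ : ℝ} (hA : IsElliptic A θ)
    (x : E N) : (A x).PosDef := by
  refine Matrix.PosDef.of_dotProduct_mulVec_pos ?_ fun ξ hξ => ?_
  · rw [Matrix.IsHermitian, Matrix.conjTranspose_eq_transpose_of_trivial]
    exact hA.symm x
  · have h1 := hA.lower x ξ
    have h2 : star ξ ⬝ᵥ (A x).mulVec ξ = ∑ i, ∑ j, A x i j * ξ i * ξ j := by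
      simp only [dotProduct, Matrix.mulVec, star_trivial, Finset.mul_sum]
      refine Finset.sum_congr rfl fun i _ => Finset.sum_congr rfl fun j _ => ?_
      ring
    rw [h2]
    refine lt_of_lt_of_le ?_ h1
    have h3 : 0 < ∑ i, ξ i ^ 2 := by
      obtain ⟨i, hi⟩ := Function.ne_iff.1 hξ
      exact Finset.sum_pos' (fun _ _ => sq_nonneg _) ⟨i, Finset.mem_univ i, sq_pos_of_ne_zero hi⟩
    have := hA.one_le
    positivity

theorem isUnit_jacobian {χ : E N → E N} {x : E N} (hx : 0 < jacDet χ x) :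
    IsUnit (jacobian χ x) := by
  rw [Matrix.isUnit_iff_isUnit_det, isUnit_iff_ne_zero]
  intro h
  rw [jacDet, h, abs_zero] at hx
  exact lt_irrefl _ hx

theorem IsElliptic.pullbackMatrix_posDef {A : E N → Matrix (Fin N) (Fin N) ℝ} {θ : ℝ}
    (hA : IsElliptic A θ) {χ : E N → E N} {x : E N} (hx : 0 < jacDet χ x) :
    (pullbackMatrix A χ x).PosDef := by
  rw [pullbackMatrix, ← Matrix.conjTranspose_eq_transpose_of_trivial]
  refine (hA.posDef _).mul_mul_conjTranspose_same ?_
  rw [Matrix.vecMul_injective_iff_isUnit, Matrix.isUnit_nonsing_inv_iff]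
  exact isUnit_jacobian hx

/-- A real matrix acts separately on real and imaginary parts, so its norm on ℝ^N also bounds its
action on ℂ^N. -/
theorem norm_matMulVec_le (M : Matrix (Fin N) (Fin N) ℝ) (F : CVec N) :
    ‖matMulVec M F‖ ≤ matNorm M * ‖F‖ := by
  have hsq : ∀ G : CVec N, ‖G‖ ^ 2 = ‖(WithLp.toLp 2 fun i => (G i).re : E N)‖ ^ 2 +
      ‖(WithLp.toLp 2 fun i => (G i).im : E N)‖ ^ 2 := fun G => by
    simp only [EuclideanSpace.norm_sq_eq, ← Finset.sum_add_distrib]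
    refine Finset.sum_congr rfl fun i _ => ?_
    rw [← Complex.normSq_eq_norm_sq, Complex.normSq_apply, Real.norm_eq_abs, Real.norm_eq_abs,
      sq_abs, sq_abs]
    ring
  have hop : ∀ ξ : Fin N → ℝ, ‖(WithLp.toLp 2 (M.mulVec ξ) : E N)‖ ^ 2 ≤
      matNorm M ^ 2 * ‖(WithLp.toLp 2 ξ : E N)‖ ^ 2 := fun ξ => by
    rw [← mul_pow]
    refine pow_le_pow_left₀ (norm_nonneg _) ?_ 2
    rw [← Matrix.toEuclideanCLM_toLp]
    exact ContinuousLinearMap.le_opNorm _ _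
  have hre : (fun i => (matMulVec M F i).re) = M.mulVec fun i => (F i).re := by
    funext i
    simp [matMulVec_apply, Matrix.mulVec, dotProduct]
  have him : (fun i => (matMulVec M F i).im) = M.mulVec fun i => (F i).im := by
    funext i
    simp [matMulVec_apply, Matrix.mulVec, dotProduct]
  refine le_of_sq_le_sq ?_ (mul_nonneg (norm_nonneg _) (norm_nonneg _))
  rw [hsq, hre, him, mul_pow, hsq F, mul_add]
  exact add_le_add (hop _) (hop _)

theorem formDensity_sub_smul (B B' : Matrix (Fin N) (Fin N) ℝ) (k : ℝ) (F G : CVec N) :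
    formDensity (B - k • B') F G = formDensity B F G - k * formDensity B' F G := by
  simp only [formDensity, Matrix.sub_apply, Matrix.smul_apply, smul_eq_mul, Complex.ofReal_sub,
    Complex.ofReal_mul, sub_mul, Finset.sum_sub_distrib, Finset.mul_sum, mul_assoc]

theorem formDensity_mul (P Q : Matrix (Fin N) (Fin N) ℝ) (h : (P * Q).IsSymm) (F G : CVec N) :
    formDensity (P * Q) F G = inner ℂ (matMulVec P.transpose G) (matMulVec Q F) := by
  rw [formDensity_eq_inner, h.eq, inner_matMulVec, Matrix.transpose_transpose, matMulVec_mul]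

theorem formDensity_self_mul (P : Matrix (Fin N) (Fin N) ℝ) (G : CVec N) :
    (formDensity (P.transpose * P) G G).re = ‖matMulVec P G‖ ^ 2 := by
  rw [formDensity_mul _ _ (by rw [Matrix.IsSymm, Matrix.transpose_mul, Matrix.transpose_transpose]),
    Matrix.transpose_transpose, inner_self_eq_norm_sq_to_K]
  norm_cast

section Comparison

variable {a at' b s : Matrix (Fin N) (Fin N) ℝ} {k : ℝ}

/-- Cauchy-Schwarz after factorization: `Q` is absorbed into a matrix norm, while Pᵗ stays on `G`,
where it will produce the energy density exactly. -/
theorem norm_formDensity_mul_le {P Q B : Matrix (Fin N) (Fin N) ℝ} (hB : B.IsSymm) (h : B = P * Q)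
    (F G : CVec N) : ‖formDensity B F G‖ ≤ matNorm Q * ‖F‖ * ‖matMulVec P.transpose G‖ := by
  subst h
  rw [formDensity_mul P Q hB]
  refine (norm_inner_le_norm _ _).trans ?_
  rw [mul_comm]
  exact mul_le_mul_of_nonneg_right (norm_matMulVec_le _ _) (norm_nonneg _)

/-- Both parts of the comparison of `a` and `k ã` for `S = k b⁻¹ ã b⁻¹`, `b² = a`, `s² = S`. -/
theorem norm_formDensity_sub_le (ha : a.IsSymm) (hat : at'.IsSymm) (hb : b.IsSymm) (hba : b * b = a)
    (hbu : IsUnit b) (hs : s.IsSymm) (hsS : s * s = k • (b⁻¹ * at' * b⁻¹)) (hsu : IsUnit s)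
    (F G : CVec N) :
    ‖formDensity (a - k • at') F G‖ ≤ matNorm ((s - s⁻¹) * b) * ‖F‖ *
        √(k * (formDensity at' G G).re) ∧
      ‖formDensity (a - k • at') F G‖ ≤ matNorm ((k • (b⁻¹ * at' * b⁻¹) - 1) * b) * ‖F‖ *
        √(formDensity a G G).re := by
  rw [Matrix.isUnit_iff_isUnit_det] at hbu hsu
  have hsymm : (a - k • at').IsSymm := ha.sub (hat.smul k)
  have hbSb : b * (s * s) * b = k • at' := by
    rw [hsS, Matrix.mul_smul, Matrix.smul_mul, Matrix.mul_assoc, Matrix.mul_assoc,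
      Matrix.nonsing_inv_mul _ hbu, Matrix.mul_one, ← Matrix.mul_assoc,
      Matrix.mul_nonsing_inv _ hbu, Matrix.one_mul]
  -- From b s² b = k ã. The left factor b s falls on `G`, and ‖s b G‖² is the energy density of k ã.
  have h1 : a - k • at' = (-(b * s)) * ((s - s⁻¹) * b) := by
    have h2 : s * (s - s⁻¹) = s * s - 1 := by rw [mul_sub, Matrix.mul_nonsing_inv _ hsu]
    calc a - k • at' = b * b - b * (s * s) * b := by rw [hba, hbSb]
      _ = -(b * (s * s - 1) * b) := by noncomm_ring
      _ = _ := by rw [← h2]; noncomm_ring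
  -- The same difference split as b times (S - I)b: now b falls on `G`, and ‖b G‖² is the energy
  -- density of a.
  have h3 : a - k • at' = (-b) * ((k • (b⁻¹ * at' * b⁻¹) - 1) * b) := by
    rw [← hsS]
    calc a - k • at' = b * b - b * (s * s) * b := by rw [hba, hbSb]
      _ = _ := by noncomm_ring
  have hneg : ∀ (P : Matrix (Fin N) (Fin N) ℝ) (G : CVec N),
      ‖matMulVec (-P) G‖ = ‖matMulVec P G‖ := fun P G => by
    have : matMulVec (-P) G = -matMulVec P G := by
      ext i
      simp [matMulVec_apply]
    rw [this, norm_neg]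
  constructor
  · refine (norm_formDensity_mul_le hsymm h1 F G).trans_eq ?_
    rw [Matrix.transpose_neg, hneg, Matrix.transpose_mul, hs.eq, hb.eq]
    congr 1
    have h4 : k * (formDensity at' G G).re = ‖matMulVec (s * b) G‖ ^ 2 := by
      rw [← formDensity_self_mul, Matrix.transpose_mul, hs.eq, hb.eq]
      have h5 : b * s * (s * b) = k • at' := by rw [← hbSb]; noncomm_ring
      have h6 := formDensity_sub_smul 0 at' (-k) G G
      rw [h5]
      simp only [zero_sub, neg_smul, neg_neg] at h6
      rw [h6]
      simp [formDensity]
    rw [h4, Real.sqrt_sq (norm_nonneg _)]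
  · refine (norm_formDensity_mul_le hsymm h3 F G).trans_eq ?_
    rw [Matrix.transpose_neg, hneg, hb.eq]
    congr 1
    have h4 : (formDensity a G G).re = ‖matMulVec b G‖ ^ 2 := by
      rw [← formDensity_self_mul, hb.eq, hba]
    rw [h4, Real.sqrt_sq (norm_nonneg _)]

end Comparison

theorem weightRatio_sq {φ φt : E N → E N} {x : E N} :
    weightRatio φ φt x ^ 2 = jacDet φ x / jacDet φt x := by
  rw [weightRatio, div_pow, Real.sq_sqrt (jacDet_nonneg _ _), Real.sq_sqrt (jacDet_nonneg _ _)]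

theorem matS_posDef {A : E N → Matrix (Fin N) (Fin N) ℝ} {θ : ℝ} (hA : IsElliptic A θ)
    {φ φt : E N → E N} {x : E N} (hx : 0 < jacDet φ x) (hxt : 0 < jacDet φt x) :
    (matS A φ φt x).PosDef := by
  have hb := isUnit_matSqrt (hA.pullbackMatrix_posDef hx)
  have hk : 0 < (weightRatio φ φt x ^ 2)⁻¹ := by
    rw [weightRatio_sq]
    positivity
  refine Matrix.PosDef.smul ?_ hk
  have h1 : ((matSqrt (pullbackMatrix A φ x))⁻¹).conjTranspose =
      (matSqrt (pullbackMatrix A φ x))⁻¹ := by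
    rw [Matrix.conjTranspose_eq_transpose_of_trivial, Matrix.transpose_nonsing_inv,
      (matSqrt_isSymm _).eq]
  have h2 := (hA.pullbackMatrix_posDef hxt).mul_mul_conjTranspose_same
    (B := (matSqrt (pullbackMatrix A φ x))⁻¹)
    (by rwa [Matrix.vecMul_injective_iff_isUnit, Matrix.isUnit_nonsing_inv_iff])
  rwa [h1] at h2

theorem norm_pullback_formDensity_sub_le {A : E N → Matrix (Fin N) (Fin N) ℝ} {θ : ℝ}
    (hA : IsElliptic A θ) {φ φt : E N → E N} {x : E N} (hx : 0 < jacDet φ x)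
    (hxt : 0 < jacDet φt x) (F G : CVec N) :
    ‖formDensity (pullbackMatrix A φ x) F G -
        ((weightRatio φ φt x ^ 2)⁻¹ : ℝ) * formDensity (pullbackMatrix A φt x) F G‖ ≤
      matNorm ((matSqrt (matS A φ φt x) - (matSqrt (matS A φ φt x))⁻¹) *
        matSqrt (pullbackMatrix A φ x)) * ‖F‖ *
          √((weightRatio φ φt x ^ 2)⁻¹ * (formDensity (pullbackMatrix A φt x) G G).re) ∧
    ‖formDensity (pullbackMatrix A φ x) F G -
        ((weightRatio φ φt x ^ 2)⁻¹ : ℝ) * formDensity (pullbackMatrix A φt x) F G‖ ≤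
      matNorm ((matS A φ φt x - 1) * matSqrt (pullbackMatrix A φ x)) * ‖F‖ *
        √(formDensity (pullbackMatrix A φ x) G G).re := by
  have hS := matS_posDef hA hx hxt
  have ha := hA.pullbackMatrix_posDef hx
  rw [← formDensity_sub_smul]
  exact norm_formDensity_sub_le (pullbackMatrix_isSymm hA.symm φ x)
    (pullbackMatrix_isSymm hA.symm φt x) (matSqrt_isSymm _) (matSqrt_mul_self ha.posSemidef)
    (isUnit_matSqrt ha) (matSqrt_isSymm _) (matSqrt_mul_self hS.posSemidef) (isUnit_matSqrt hS) F G

/-! ### Comparison of the forms and of the embeddings -/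

theorem holderTriple_dualExponent {q₀ : ℝ≥0∞} (hq₀ : 2 < q₀) :
    ENNReal.HolderTriple (dualExponent q₀) q₀ 2 := by
  constructor
  rw [dualExponent, inv_inv]
  exact tsub_add_cancel_of_le (ENNReal.inv_le_inv.2 hq₀.le)

theorem eLpNorm_sqrt {X : Type*} [MeasurableSpace X] {μ : Measure X} {f : X → ℝ}
    (hf : Integrable f μ) (h0 : ∀ x, 0 ≤ f x) :
    eLpNorm (fun x => √(f x)) 2 μ = ENNReal.ofReal √(∫ x, f x ∂μ) := by
  rw [eLpNorm_eq_lintegral_rpow_enorm_toReal (by norm_num) (by norm_num), Real.sqrt_eq_rpow,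
    ← ENNReal.ofReal_rpow_of_nonneg (integral_nonneg h0) (by norm_num),
    ofReal_integral_eq_lintegral_ofReal hf (Filter.Eventually.of_forall h0), ENNReal.toReal_ofNat]
  congr 1
  refine lintegral_congr fun x => ?_
  rw [Real.enorm_of_nonneg (Real.sqrt_nonneg _), ENNReal.ofReal_rpow_of_nonneg (Real.sqrt_nonneg _)
    (by norm_num), Real.rpow_two, Real.sq_sqrt (h0 x)]

/-- Hölder's inequality for three factors, the first of which need not be measurable. -/
theorem norm_integral_le_of_holder {X V : Type*} [MeasurableSpace X] [NormedAddCommGroup V]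
    {μ : Measure X} {p q₀ : ℝ≥0∞} (hpq : ENNReal.HolderTriple p q₀ 2) {d : X → ℂ} {F : X → V}
    {κ m : X → ℝ} (hd : AEStronglyMeasurable d μ) (hF : AEStronglyMeasurable F μ)
    (hκ : AEStronglyMeasurable κ μ) (hκ0 : ∀ x, 0 ≤ κ x) (hm0 : ∀ x, 0 ≤ m x)
    (hle : ∀ᵐ x ∂μ, ‖d x‖ ≤ m x * ‖F x‖ * κ x) {δ B K : ℝ} (hδ0 : 0 ≤ δ) (hB0 : 0 ≤ B) (hK0 : 0 ≤ K)
    (hδ : eLpNorm m p μ ≤ ENNReal.ofReal δ) (hB : eLpNorm F q₀ μ ≤ ENNReal.ofReal B)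
    (hK : eLpNorm κ 2 μ ≤ ENNReal.ofReal K) : ‖∫ x, d x ∂μ‖ ≤ δ * B * K := by
  -- The smallest admissible factor in place of `m`. It is measurable as a quotient of measurable
  -- functions, and dominated by `m`; where the denominator vanishes, so does `d`.
  set m' : X → ℝ := fun x => ‖d x‖ / (‖F x‖ * κ x) with hm'
  have hm'm : AEStronglyMeasurable m' μ :=
    (hd.norm.aemeasurable.div (hF.norm.aemeasurable.mul hκ.aemeasurable)).aestronglyMeasurable
  have h1 : ∀ᵐ x ∂μ, ‖d x‖ = m' x * ‖F x‖ * κ x := by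
    filter_upwards [hle] with x hx
    by_cases h0 : ‖F x‖ * κ x = 0
    · have : ‖d x‖ ≤ 0 := by rwa [mul_assoc, h0, mul_zero] at hx
      rw [mul_assoc, h0, mul_zero]
      exact le_antisymm this (norm_nonneg _)
    · rw [mul_assoc, hm', div_mul_cancel₀ _ h0]
  have h2 : eLpNorm m' p μ ≤ eLpNorm m p μ := by
    refine eLpNorm_mono_ae ?_
    filter_upwards [hle] with x hx
    have hFκ : 0 ≤ ‖F x‖ * κ x := mul_nonneg (norm_nonneg _) (hκ0 x)
    rw [Real.norm_of_nonneg (div_nonneg (norm_nonneg _) hFκ), Real.norm_of_nonneg (hm0 x)]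
    refine div_le_of_le_mul₀ hFκ (hm0 x) ?_
    rwa [← mul_assoc]
  have h3 : eLpNorm d 1 μ ≤ eLpNorm m' p μ * eLpNorm F q₀ μ * eLpNorm κ 2 μ := by
    have e1 : eLpNorm d 1 μ = eLpNorm ((fun x => m' x * ‖F x‖) • κ) 1 μ := by
      refine eLpNorm_congr_norm_ae ?_
      filter_upwards [h1] with x hx
      rw [hx, Pi.smul_apply', smul_eq_mul, Real.norm_of_nonneg]
      rw [← hx]
      exact norm_nonneg _
    have e2 : eLpNorm (m' • fun x => ‖F x‖) 2 μ ≤ eLpNorm m' p μ * eLpNorm (fun x => ‖F x‖) q₀ μ :=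
      eLpNorm_smul_le_mul_eLpNorm hF.norm hm'm
    rw [eLpNorm_norm] at e2
    rw [e1]
    refine (eLpNorm_smul_le_mul_eLpNorm (p := 2) (q := 2) hκ (hm'm.mul hF.norm)).trans ?_
    gcongr
    exact e2
  have h4 : ‖∫ x, d x ∂μ‖ₑ ≤ ENNReal.ofReal (δ * B * K) := by
    refine (enorm_integral_le_lintegral_enorm d).trans ?_
    rw [← eLpNorm_one_eq_lintegral_enorm, ENNReal.ofReal_mul (by positivity), ENNReal.ofReal_mul hδ0]
    exact h3.trans (mul_le_mul' (mul_le_mul' (h2.trans hδ) hB) hK)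
  rw [← ofReal_norm] at h4
  exact (ENNReal.ofReal_le_ofReal_iff (by positivity)).1 h4

section Estimates

variable {U : Set (E N)} {φ φt : E N → E N}

theorem measurable_weightRatio (φ φt : E N → E N) : Measurable (weightRatio φ φt) :=
  (measurable_jacDet φ).sqrt.div (measurable_jacDet φt).sqrt

theorem smul_weight_ae (hU : IsOpen U) (h : IsBiLipschitz U φ) (ht : IsBiLipschitz U φt)
    {f : E N → ℂ} : (fun x => jacDet φt x • f x) =ᵐ[volume.restrict U]
      fun x => jacDet φ x • ((weightRatio φ φt x ^ 2)⁻¹ • f x) := by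
  filter_upwards [h.ae_jacDet_pos hU, ht.ae_jacDet_pos hU] with x hx hxt
  rw [smul_smul, weightRatio_sq, inv_div, mul_div_cancel₀ _ hx.ne']

theorem integral_weightedMeasure_eq (hU : IsOpen U) (h : IsBiLipschitz U φ)
    (ht : IsBiLipschitz U φt) (f : E N → ℂ) :
    ∫ x, f x ∂weightedMeasure U φt =
      ∫ x, (weightRatio φ φt x ^ 2)⁻¹ • f x ∂weightedMeasure U φ := by
  rw [weightedMeasure, weightedMeasure,
    integral_withDensity_eq_integral_toReal_smul (measurable_jacDet φt).ennreal_ofReal (by simp),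
    integral_withDensity_eq_integral_toReal_smul (measurable_jacDet φ).ennreal_ofReal (by simp)]
  simp only [ENNReal.toReal_ofReal (jacDet_nonneg _ _)]
  exact integral_congr_ae (smul_weight_ae hU h ht)

theorem integrable_weightedMeasure_iff (hU : IsOpen U) (h : IsBiLipschitz U φ)
    (ht : IsBiLipschitz U φt) (f : E N → ℂ) : Integrable f (weightedMeasure U φt) ↔
      Integrable (fun x => (weightRatio φ φt x ^ 2)⁻¹ • f x) (weightedMeasure U φ) := by
  rw [weightedMeasure, weightedMeasure,
    integrable_withDensity_iff_integrable_smul' (measurable_jacDet φt).ennreal_ofReal (by simp),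
    integrable_withDensity_iff_integrable_smul' (measurable_jacDet φ).ennreal_ofReal (by simp)]
  simp only [ENNReal.toReal_ofReal (jacDet_nonneg _ _)]
  exact integrable_congr (smul_weight_ae hU h ht)

variable {A : E N → Matrix (Fin N) (Fin N) ℝ} {θ : ℝ}
  {D : Submodule ℂ ((E N → ℂ) × (E N → CVec N))}

/-- Both forms are written as integrals against g dx, the weight g̃ becoming w⁻²g. Hölder's
inequality then uses the dual exponent for the matrix factor, q₀ for the gradient of `p`, and 2 for
the energy density of `r`; the two summands of `vicinity₂` give the energies of q' and of q. -/
theorem norm_gradientForm_sub_le (hU : IsOpen U) (h : IsBiLipschitz U φ) (ht : IsBiLipschitz U φt)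
    (hA : IsElliptic A θ)
    (hI : ∀ p ∈ D, ∀ r ∈ D, Integrable (fun x => formDensity (pullbackMatrix A φ x) (p.2 x) (r.2 x))
      (weightedMeasure U φ))
    (hI' : ∀ p ∈ D, ∀ r ∈ D,
      Integrable (fun x => formDensity (pullbackMatrix A φt x) (p.2 x) (r.2 x)) (weightedMeasure U φt))
    {q₀ : ℝ≥0∞} (hq₀ : 2 < q₀) {δ B : ℝ} (hδ0 : 0 ≤ δ) (hB0 : 0 ≤ B)
    (hδ : vicinity₂ A U φ φt (dualExponent q₀) ≤ ENNReal.ofReal δ) {p : D}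
    (hp : AEStronglyMeasurable p.1.2 (weightedMeasure U φ))
    (hB : eLpNorm p.1.2 q₀ (weightedMeasure U φ) ≤ ENNReal.ofReal B) (r : D) :
    ‖gradientForm _ D _ hI r p - gradientForm _ D _ hI' r p‖ ≤
        δ * B * √(gradientForm _ D _ hI' r r).re ∧
      ‖gradientForm _ D _ hI r p - gradientForm _ D _ hI' r p‖ ≤
        δ * B * √(gradientForm _ D _ hI r r).re := by
  have hH := holderTriple_dualExponent hq₀
  have hi2 := (integrable_weightedMeasure_iff hU h ht _).1 (hI' p p.2 r r.2)
  have hd : gradientForm _ D _ hI r p - gradientForm _ D _ hI' r p =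
      ∫ x, (formDensity (pullbackMatrix A φ x) (p.1.2 x) (r.1.2 x) -
        ((weightRatio φ φt x ^ 2)⁻¹ : ℝ) * formDensity (pullbackMatrix A φt x) (p.1.2 x) (r.1.2 x))
          ∂weightedMeasure U φ := by
    rw [gradientForm_apply, gradientForm_apply, integral_weightedMeasure_eq hU h ht,
      ← integral_sub (hI p p.2 r r.2) hi2]
    rfl
  have hdm : AEStronglyMeasurable (fun x => formDensity (pullbackMatrix A φ x) (p.1.2 x) (r.1.2 x) -
        ((weightRatio φ φt x ^ 2)⁻¹ : ℝ) * formDensity (pullbackMatrix A φt x) (p.1.2 x) (r.1.2 x))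
          (weightedMeasure U φ) := ((hI p p.2 r r.2).sub hi2).1
  have hpt : ∀ᵐ x ∂weightedMeasure U φ, 0 < jacDet φ x ∧ 0 < jacDet φt x := by
    rw [ae_weightedMeasure_iff hU h]
    filter_upwards [h.ae_jacDet_pos hU, ht.ae_jacDet_pos hU] with x hx hxt using ⟨hx, hxt⟩
  rw [hd]
  constructor
  · have hir : Integrable (fun x => (weightRatio φ φt x ^ 2)⁻¹ *
        (formDensity (pullbackMatrix A φt x) (r.1.2 x) (r.1.2 x)).re) (weightedMeasure U φ) := by
      refine ((integrable_weightedMeasure_iff hU h ht _).1 (hI' r r.2 r r.2)).re.congr ?_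
      exact Filter.Eventually.of_forall fun x => Complex.smul_re _ _
    have h0 : ∀ x, 0 ≤ (weightRatio φ φt x ^ 2)⁻¹ *
        (formDensity (pullbackMatrix A φt x) (r.1.2 x) (r.1.2 x)).re := fun x =>
      mul_nonneg (by positivity) (hA.pullbackMatrix_nonneg φt x _)
    have hint : ∫ x, (weightRatio φ φt x ^ 2)⁻¹ *
        (formDensity (pullbackMatrix A φt x) (r.1.2 x) (r.1.2 x)).re ∂weightedMeasure U φ =
        (gradientForm _ D _ hI' r r).re := by
      rw [gradientForm_apply, integral_weightedMeasure_eq hU h ht]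
      have := integral_re ((integrable_weightedMeasure_iff hU h ht _).1 (hI' r r.2 r r.2))
      refine Eq.trans ?_ this
      refine integral_congr_ae (Filter.Eventually.of_forall fun x => ?_)
      dsimp only
      rw [RCLike.re_eq_complex_re, Complex.smul_re, smul_eq_mul]
    refine norm_integral_le_of_holder hH
      (m := fun x => matNorm ((matSqrt (matS A φ φt x) - (matSqrt (matS A φ φt x))⁻¹) *
        matSqrt (pullbackMatrix A φ x))) hdm hp
      hir.1.aemeasurable.sqrt.aestronglyMeasurable (fun x => Real.sqrt_nonneg _)
      (fun x => norm_nonneg _) ?_ hδ0 hB0 (Real.sqrt_nonneg _) (le_trans le_self_add hδ) hB ?_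
    · filter_upwards [hpt] with x hx
      exact (norm_pullback_formDensity_sub_le hA hx.1 hx.2 _ _).1
    · rw [← hint]
      exact (eLpNorm_sqrt hir h0).le
  · have hir : Integrable (fun x => (formDensity (pullbackMatrix A φ x) (r.1.2 x) (r.1.2 x)).re)
        (weightedMeasure U φ) := (hI r r.2 r r.2).re
    have hint : ∫ x, (formDensity (pullbackMatrix A φ x) (r.1.2 x) (r.1.2 x)).re
        ∂weightedMeasure U φ = (gradientForm _ D _ hI r r).re := by
      rw [gradientForm_apply]
      exact integral_re (hI r r.2 r r.2)
    refine norm_integral_le_of_holder hH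
      (m := fun x => matNorm ((matS A φ φt x - 1) * matSqrt (pullbackMatrix A φ x))) hdm hp
      hir.1.aemeasurable.sqrt.aestronglyMeasurable (fun x => Real.sqrt_nonneg _)
      (fun x => norm_nonneg _) ?_ hδ0 hB0 (Real.sqrt_nonneg _) (le_trans le_add_self hδ) hB ?_
    · filter_upwards [hpt] with x hx
      exact (norm_pullback_formDensity_sub_le hA hx.1 hx.2 _ _).2
    · rw [← hint]
      exact (eLpNorm_sqrt hir fun x => hA.pullbackMatrix_nonneg φ x _).le

theorem norm_le_of_ae_smul {μ : Measure (E N)} {p q₀ : ℝ≥0∞} (hpq : ENNReal.HolderTriple p q₀ 2)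
    {f : Lp ℂ 2 μ} {k : E N → ℝ} {u : E N → ℂ} (hk : AEStronglyMeasurable k μ)
    (hu : AEStronglyMeasurable u μ) (hf : f =ᵐ[μ] fun x => k x • u x) {δ B : ℝ} (hδ0 : 0 ≤ δ)
    (hB0 : 0 ≤ B) (hδ : eLpNorm k p μ ≤ ENNReal.ofReal δ) (hB : eLpNorm u q₀ μ ≤ ENNReal.ofReal B) :
    ‖f‖ ≤ δ * B := by
  rw [Lp.norm_def, eLpNorm_congr_ae hf]
  refine ENNReal.toReal_le_of_le_ofReal (by positivity) ?_
  rw [ENNReal.ofReal_mul hδ0]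
  exact (eLpNorm_smul_le_mul_eLpNorm hu hk).trans (mul_le_mul' hδ hB)

/-- The real factor `k` is moved to the other argument, whose L^{q₀} norm is under control; so `f'`
enters only with its L² norm. -/
theorem norm_inner_le_of_ae_smul {μ : Measure (E N)} {p q₀ : ℝ≥0∞}
    (hpq : ENNReal.HolderTriple p q₀ 2) {f f' u : Lp ℂ 2 μ} {k : E N → ℝ}
    (hk : AEStronglyMeasurable k μ) (hf : f =ᵐ[μ] fun x => k x • f' x) {δ B : ℝ} (hδ0 : 0 ≤ δ)
    (hB0 : 0 ≤ B) (hδ : eLpNorm k p μ ≤ ENNReal.ofReal δ) (hB : eLpNorm u q₀ μ ≤ ENNReal.ofReal B) :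
    ‖inner ℂ f u‖ ≤ δ * B * ‖f'‖ := by
  have hle : eLpNorm (k • (u : E N → ℂ)) 2 μ ≤ ENNReal.ofReal (δ * B) := by
    rw [ENNReal.ofReal_mul hδ0]
    exact (eLpNorm_smul_le_mul_eLpNorm (Lp.memLp u).1 hk).trans (mul_le_mul' hδ hB)
  have hY : MemLp (k • (u : E N → ℂ)) 2 μ :=
    ⟨hk.smul (Lp.memLp u).1, hle.trans_lt ENNReal.ofReal_lt_top⟩
  have h1 : inner ℂ f u = inner ℂ f' hY.toLp := by
    rw [L2.inner_def, L2.inner_def]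
    refine integral_congr_ae ?_
    filter_upwards [hf, hY.coeFn_toLp] with x h1 h2
    rw [h1, h2, Pi.smul_apply', RCLike.inner_apply, RCLike.inner_apply, Complex.real_smul,
      Complex.real_smul, map_mul, Complex.conj_ofReal]
    ring
  rw [h1, mul_comm]
  refine (norm_inner_le_norm _ _).trans (mul_le_mul_of_nonneg_left ?_ (norm_nonneg _))
  rw [Lp.norm_toLp]
  exact ENNReal.toReal_le_of_le_ofReal (by positivity) hle

/-- The norms of constants are controlled by means of any function of unit norm. -/
theorem eLpNorm_const_le {X : Type*} [MeasurableSpace X] {μ : Measure X} {p q₀ : ℝ≥0∞}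
    (hpq : ENNReal.HolderTriple p q₀ 2) (hq₀ : q₀ ≠ 0) (hp : p ≠ 0) {u : X → ℂ}
    (hu : AEStronglyMeasurable u μ) (h1 : eLpNorm u 2 μ = 1) {B : ℝ}
    (hB : eLpNorm u q₀ μ ≤ ENNReal.ofReal B) (c : ℂ) :
    eLpNorm (fun _ => c) q₀ μ ≤ ENNReal.ofReal B * eLpNorm (fun _ => c) 2 μ := by
  have hμ : μ ≠ 0 := by
    rintro rfl
    simp at h1
  -- Hölder's inequality for 1 · u bounds the total mass from below. This suffices, because the
  -- L^{q₀} and L² norms of a constant differ by the factor μ(X)^{-1/p}.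
  have h2 : 1 ≤ eLpNorm (fun _ : X => (1 : ℝ)) p μ * eLpNorm u q₀ μ := by
    have := eLpNorm_smul_le_mul_eLpNorm (p := p) (q := q₀) (r := 2) (μ := μ) hu
      (aestronglyMeasurable_const (b := (1 : ℝ)))
    rw [← h1]
    refine le_trans (le_of_eq ?_) this
    congr 1
    ext x
    simp
  rw [eLpNorm_const _ hp hμ, enorm_one, one_mul] at h2
  rw [eLpNorm_const _ hq₀ hμ, eLpNorm_const _ (by norm_num) hμ]
  have hexp : 1 / (2 : ℝ≥0∞).toReal = 1 / p.toReal + 1 / q₀.toReal := by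
    have := congrArg ENNReal.toReal hpq.inv_add_inv_eq_inv
    rw [ENNReal.toReal_add (ENNReal.inv_ne_top.2 hp) (ENNReal.inv_ne_top.2 hq₀), ENNReal.toReal_inv,
      ENNReal.toReal_inv, ENNReal.toReal_inv] at this
    rw [one_div, one_div, one_div, this]
  rw [hexp, ENNReal.rpow_add_of_nonneg _ _ (by positivity) (by positivity)]
  calc ‖c‖ₑ * μ univ ^ (1 / q₀.toReal) = ‖c‖ₑ * μ univ ^ (1 / q₀.toReal) * 1 := (mul_one _).symm
    _ ≤ ‖c‖ₑ * μ univ ^ (1 / q₀.toReal) * (μ univ ^ (1 / p.toReal) * ENNReal.ofReal B) := by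
        gcongr
        exact h2.trans (by gcongr)
    _ = _ := by ring

end Estimates

/-! ### Norms of eigenfunctions and closeness of the forms -/

theorem IsWeakGradient.sum {U : Set (E N)} {ι : Type*} (s : Finset ι) {u : ι → E N → ℂ}
    {F : ι → E N → CVec N} (h : ∀ i ∈ s, IsWeakGradient U (u i) (F i)) :
    IsWeakGradient U (∑ i ∈ s, u i) (∑ i ∈ s, F i) := by
  classical
  induction s using Finset.induction_on with
  | empty => simpa using IsWeakGradient.zero U
  | insert i s hi ih =>
    rw [Finset.sum_insert hi, Finset.sum_insert hi]
    exact (h i (Finset.mem_insert_self i s)).add (ih fun j hj => h j (Finset.mem_insert_of_mem hj))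

theorem IsWeakGradient.aestronglyMeasurable {U : Set (E N)} {u : E N → ℂ}
    {F : E N → CVec N} (h : IsWeakGradient U u F) : AEStronglyMeasurable F (volume.restrict U) :=
  aestronglyMeasurable_of_coord fun i => (h.2.1 i).aestronglyMeasurable

/-- Inversion of the growth condition: the positions of the non-zero eigenvalues up to Λ are bounded
in terms of α, C₁ and Λ alone. -/
theorem EigenvalueGrowth.lt_of_le {lam : ℕ → ℝ} {α C₁ Λ : ℝ} (hg : EigenvalueGrowth lam α C₁)
    (hα : 0 < α) (hC₁ : 0 < C₁) {M : ℕ} (hM : (Λ / C₁) ^ α < M) {k : ℕ} (hk0 : lam k ≠ 0)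
    (hk : lam k ≤ Λ) : k + 1 < M := by
  have h1 := (hg k hk0).trans hk
  have h2 : ((k : ℝ) + 1) ^ (1 / α) ≤ Λ / C₁ := by
    rw [le_div_iff₀ hC₁, mul_comm]
    exact h1
  have h3 := Real.rpow_le_rpow (by positivity) h2 hα.le
  rw [← Real.rpow_mul (by positivity), one_div, inv_mul_cancel₀ hα.ne', Real.rpow_one] at h3
  have h4 := h3.trans_lt hM
  exact_mod_cast h4

section EigenfunctionNorms

variable {μ : Measure (E N)} {G : Submodule ℂ (Lp ℂ 2 μ × Lp ℂ 2 μ)} {lam : ℕ → ℝ} {q₀ : ℝ≥0∞}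
  {γ C₂ : ℝ}

theorem norm_coeff_le {ψ : ℕ → Lp ℂ 2 μ} (hψ : IsEigenfunctionSeq G lam ψ) {u : Lp ℂ 2 μ}
    (hu : ‖u‖ = 1) (k : ℕ) : ‖inner ℂ (ψ k) u‖ₑ ≤ 1 := by
  have h1 := norm_inner_le_norm (𝕜 := ℂ) (ψ k) u
  rw [hψ.1.1 k, hu, mul_one] at h1
  rw [← ofReal_norm]
  exact ENNReal.ofReal_le_one.2 h1

/-- All positions of the value `t` lie below `M`, so the multiplicity is at most `M`. Zero is
excluded, as the growth condition says nothing about its multiplicity. -/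
theorem card_eigenvalue_le (hl : IsEigenvalueSeq G lam) {Λ : ℝ} {M : ℕ}
    (hM : ∀ k, lam k ≠ 0 → lam k ≤ Λ → k + 1 < M) {t : ℝ} (ht0 : t ≠ 0) (ht : t ≤ Λ) :
    (hl.2 t).1.toFinset.card ≤ M := by
  calc (hl.2 t).1.toFinset.card ≤ (Finset.range M).card := by
        refine Finset.card_le_card fun k hk => ?_
        have hkt : lam k = t := (hl.2 t).1.mem_toFinset.1 hk
        have := hM k (by rwa [hkt]) (by rwa [hkt])
        exact Finset.mem_range.2 (by omega)
    _ = M := Finset.card_range M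

theorem coeFn_finset_sum {ι : Type*} (s : Finset ι) (f : ι → Lp ℂ 2 μ) :
    ((∑ i ∈ s, f i : Lp ℂ 2 μ) : E N → ℂ) =ᵐ[μ] ∑ i ∈ s, (f i : E N → ℂ) := by
  classical
  induction s using Finset.induction_on with
  | empty =>
    rw [Finset.sum_empty, Finset.sum_empty]
    exact Lp.coeFn_zero _ _ _
  | insert i s hi ih =>
    rw [Finset.sum_insert hi, Finset.sum_insert hi]
    exact (Lp.coeFn_add _ _).trans (Filter.EventuallyEq.rfl.add ih)

theorem coeFn_eigenfunction_sum {ψ : ℕ → Lp ℂ 2 μ} (hl : IsEigenvalueSeq G lam)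
    (hψ : IsEigenfunctionSeq G lam ψ) {t : ℝ} {u : Lp ℂ 2 μ} (hu : u ∈ eigenspace G t) :
    u =ᵐ[μ] ∑ k ∈ (hl.2 t).1.toFinset, (inner ℂ (ψ k) u) • (ψ k : E N → ℂ) := by
  have h1 := hψ.eq_sum hl hu
  have h2 : (u : E N → ℂ) =ᵐ[μ]
      ((∑ k ∈ (hl.2 t).1.toFinset, (inner ℂ (ψ k) u) • ψ k : Lp ℂ 2 μ) : E N → ℂ) := by rw [← h1]
  refine h2.trans ((coeFn_finset_sum _ _).trans ?_)
  have h3 : ∀ᵐ x ∂μ, ∀ k, ((inner ℂ (ψ k) u • ψ k : Lp ℂ 2 μ) : E N → ℂ) x =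
      (inner ℂ (ψ k) u • (ψ k : E N → ℂ)) x := ae_all_iff.2 fun k => Lp.coeFn_smul _ _
  filter_upwards [h3] with x hx
  simp only [Finset.sum_apply, hx]

/-- Property (P1) concerns one particular orthonormal sequence. An arbitrary normalized
eigenfunction is a combination of its members for the same eigenvalue with coefficients at most 1 in
modulus. -/
theorem eLpNorm_eigenfunction_le (hl : IsEigenvalueSeq G lam) (hP : PropertyP1 μ G q₀ γ C₂)
    (hq₀ : 1 ≤ q₀) {t : ℝ} (ht : t ≠ 0) {u : Lp ℂ 2 μ} (hu : u ∈ eigenspace G t) (hu1 : ‖u‖ = 1) :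
    eLpNorm u q₀ μ ≤ (hl.2 t).1.toFinset.card * ENNReal.ofReal (C₂ * t ^ γ) := by
  obtain ⟨lam', ψ, hl', hψ, hP⟩ := hP
  obtain rfl := hl'.unique hl
  rw [eLpNorm_congr_ae (coeFn_eigenfunction_sum hl hψ hu)]
  refine (eLpNorm_sum_le (fun k _ => (Lp.memLp (ψ k)).1.const_smul _) hq₀).trans ?_
  rw [← nsmul_eq_mul]
  refine Finset.sum_le_card_nsmul _ _ _ fun k hk => ?_
  have hkt : lam' k = t := (hl.2 t).1.mem_toFinset.1 hk
  rw [eLpNorm_const_smul]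
  have h1 := hP k (by rwa [hkt])
  rw [hkt] at h1
  calc _ ≤ 1 * ENNReal.ofReal (C₂ * t ^ γ) := mul_le_mul' (norm_coeff_le hψ hu1 k) h1
    _ = _ := one_mul _

/-- The same expansion for gradients. The weak gradient of the sum is the sum of the gradients in
(P2), by uniqueness almost everywhere. -/
theorem eLpNorm_gradient_le {U : Set (E N)} (hU : IsOpen U) (hac : μ ≪ volume.restrict U)
    (hac' : volume.restrict U ≪ μ) (hl : IsEigenvalueSeq G lam) (hP : PropertyP2 U μ G q₀ γ C₂)
    (hq₀ : 1 ≤ q₀) {t : ℝ} {u : Lp ℂ 2 μ} (hu : u ∈ eigenspace G t) (hu1 : ‖u‖ = 1)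
    {v : E N → ℂ} {F : E N → CVec N} (hF : IsWeakGradient U v F) (huv : u =ᵐ[μ] v) :
    eLpNorm F q₀ μ ≤ (hl.2 t).1.toFinset.card * ENNReal.ofReal (C₂ * t ^ (1 / 2 + γ)) := by
  obtain ⟨lam', ψ, hl', hψ, hP⟩ := hP
  obtain rfl := hl'.unique hl
  choose F' hF' hP using hP
  have h1 : IsWeakGradient U (∑ k ∈ (hl.2 t).1.toFinset, (inner ℂ (ψ k) u) • (ψ k : E N → ℂ))
      (∑ k ∈ (hl.2 t).1.toFinset, (inner ℂ (ψ k) u) • F' k) :=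
    IsWeakGradient.sum _ fun k _ => (hF' k).smul _
  have h2 := hF.ae_unique hU h1
    (hac'.ae_le (huv.symm.trans (coeFn_eigenfunction_sum hl hψ hu)))
  rw [eLpNorm_congr_ae (hac.ae_le h2)]
  refine (eLpNorm_sum_le
    (fun k _ => (((hF' k).aestronglyMeasurable).mono_ac hac).const_smul _) hq₀).trans ?_
  rw [← nsmul_eq_mul]
  refine Finset.sum_le_card_nsmul _ _ _ fun k hk => ?_
  have hkt : lam' k = t := (hl.2 t).1.mem_toFinset.1 hk
  rw [eLpNorm_const_smul]
  have h1 := hP k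
  rw [hkt] at h1
  calc _ ≤ 1 * ENNReal.ofReal (C₂ * t ^ (1 / 2 + γ)) := mul_le_mul' (norm_coeff_le hψ hu1 k) h1
    _ = _ := one_mul _

theorem card_mul_ofReal_le {n M : ℕ} (h : n ≤ M) {C t Λ r : ℝ} (hC : 0 ≤ C) (ht : 0 ≤ t)
    (htΛ : t ≤ Λ) (hr : 0 ≤ r) :
    n * ENNReal.ofReal (C * t ^ r) ≤ ENNReal.ofReal (M * (C * Λ ^ r)) := by
  rw [← ENNReal.ofReal_natCast, ← ENNReal.ofReal_mul (Nat.cast_nonneg n)]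
  refine ENNReal.ofReal_le_ofReal ?_
  gcongr

end EigenfunctionNorms

section Closeness

variable {bc : BoundaryCondition} {U : Set (E N)} {φ φt : E N → E N}
  {A : E N → Matrix (Fin N) (Fin N) ℝ} {θ : ℝ} {q₀ : ℝ≥0∞} {γ C₂ Λ : ℝ} {M : ℕ}

/-- The gradient of a normalized eigenvector. -/
theorem IsFormGraph.gradient_bounds (hU : IsOpen U) (h : IsBiLipschitz U φ)
    {G : Submodule ℂ (Lp ℂ 2 (weightedMeasure U φ) × Lp ℂ 2 (weightedMeasure U φ))}
    {q : pullbackDomain bc U φ →ₗ⋆[ℂ] pullbackDomain bc U φ →ₗ[ℂ] ℂ} (hq : IsNonnegForm q)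
    {hM : ∀ p ∈ pullbackDomain bc U φ, MemLp p.1 2 (weightedMeasure U φ)}
    (hG : IsFormGraph G q (embedLp _ _ hM)) {lam : ℕ → ℝ} (hl : IsEigenvalueSeq G lam)
    (hP : PropertyP2 U (weightedMeasure U φ) G q₀ γ C₂) (hq₀ : 1 ≤ q₀) (hγ : 0 < γ) (hC₂ : 0 < C₂)
    (hgrowth : ∀ k, lam k ≠ 0 → lam k ≤ Λ → k + 1 < M) {t : ℝ} {x : pullbackDomain bc U φ}
    (ht : t ≤ Λ) (hx : IsFormEigen q (embedLp _ _ hM) t x) (hx1 : ‖embedLp _ _ hM x‖ = 1) :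
    eLpNorm x.1.2 q₀ (weightedMeasure U φ) ≤ ENNReal.ofReal (M * (C₂ * Λ ^ (1 / 2 + γ))) ∧
      (t = 0 → x.1.2 =ᵐ[volume.restrict U] 0) := by
  have ht0 : 0 ≤ t := hx.nonneg hq hx1
  have h1 := eLpNorm_gradient_le hU (weightedMeasure_ac hU h) (restrict_ac_weightedMeasure hU h) hl
    hP hq₀ (hG.mem_eigenspace.2 ⟨x, rfl, hx⟩) hx1 x.2.1 (coeFn_embedLp hM x)
  have hm : AEStronglyMeasurable x.1.2 (weightedMeasure U φ) :=
    (IsWeakGradient.aestronglyMeasurable x.2.1).mono_ac (weightedMeasure_ac hU h)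
  -- At t = 0 the factor t^{1/2+γ} vanishes, so the gradient is zero whatever the multiplicity is.
  by_cases h0 : t = 0
  · rw [h0, Real.zero_rpow (by positivity), mul_zero, ENNReal.ofReal_zero, mul_zero] at h1
    refine ⟨h1.trans zero_le, fun _ => ?_⟩
    have h2 := (eLpNorm_eq_zero_iff hm (by positivity)).1 (le_antisymm h1 zero_le)
    exact (restrict_ac_weightedMeasure hU h).ae_le h2
  · exact ⟨h1.trans (card_mul_ofReal_le (card_eigenvalue_le hl hgrowth h0 ht) hC₂.le ht0 ht
      (by positivity)), fun h => absurd h h0⟩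

/-- A normalized eigenvector for a non-zero eigenvalue. -/
theorem IsFormGraph.eigenfunction_bound {V : Type*} [AddCommGroup V] [Module ℂ V]
    {μ : Measure (E N)} {G : Submodule ℂ (Lp ℂ 2 μ × Lp ℂ 2 μ)}
    {q : V →ₗ⋆[ℂ] V →ₗ[ℂ] ℂ} (hq : IsNonnegForm q) {J : V →ₗ[ℂ] Lp ℂ 2 μ}
    (hG : IsFormGraph G q J) {lam : ℕ → ℝ} (hl : IsEigenvalueSeq G lam)
    (hP : PropertyP1 μ G q₀ γ C₂) (hq₀ : 1 ≤ q₀) (hγ : 0 < γ) (hC₂ : 0 < C₂)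
    (hgrowth : ∀ k, lam k ≠ 0 → lam k ≤ Λ → k + 1 < M) {t : ℝ} {x : V} (ht : t ≤ Λ) (ht0 : t ≠ 0)
    (hx : IsFormEigen q J t x) (hx1 : ‖J x‖ = 1) :
    eLpNorm (J x) q₀ μ ≤ ENNReal.ofReal (M * (C₂ * Λ ^ γ)) :=
  (eLpNorm_eigenfunction_le hl hP hq₀ ht0 (hG.mem_eigenspace.2 ⟨x, rfl, hx⟩) hx1).trans
    (card_mul_ofReal_le (card_eigenvalue_le hl hgrowth ht0 ht) hC₂.le (hx.nonneg hq hx1) ht hγ.le)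

/-- An eigenvector with vanishing gradient is constant, hence bounded. -/
theorem eLpNorm_le_of_gradient_eq_zero (hU : IsOpen U) (hc : IsConnected U) (h : IsBiLipschitz U φ)
    {hM : ∀ p ∈ pullbackDomain bc U φ, MemLp p.1 2 (weightedMeasure U φ)} (hq₀ : 2 < q₀)
    {u : Lp ℂ 2 (weightedMeasure U φ)} (hu1 : ‖u‖ = 1) {B : ℝ}
    (hB : eLpNorm u q₀ (weightedMeasure U φ) ≤ ENNReal.ofReal B) (hB0 : 0 ≤ B)
    {x : pullbackDomain bc U φ} (hx : x.1.2 =ᵐ[volume.restrict U] 0) :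
    eLpNorm x.1.1 q₀ (weightedMeasure U φ) ≤ ENNReal.ofReal (B * ‖embedLp _ _ hM x‖) := by
  obtain ⟨c, hxc⟩ := ae_const_of_weakGradient_eq_zero hU hc x.2.1 hx
  have hxc' := (weightedMeasure_ac hU h).ae_le hxc
  have hu2 : eLpNorm u 2 (weightedMeasure U φ) = 1 := by
    rw [Lp.norm_def] at hu1
    exact (ENNReal.toReal_eq_one_iff _).1 hu1
  have hp0 : dualExponent q₀ ≠ 0 := by
    rw [dualExponent]
    exact ENNReal.inv_ne_zero.2 (ne_top_of_le_ne_top (by simp) tsub_le_self)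
  have h1 := eLpNorm_const_le (holderTriple_dualExponent hq₀) (by positivity) hp0 (Lp.memLp u).1 hu2
    hB c
  rw [eLpNorm_congr_ae hxc', ENNReal.ofReal_mul hB0, Lp.norm_def,
    ENNReal.ofReal_toReal (Lp.eLpNorm_ne_top _), eLpNorm_congr_ae (coeFn_embedLp hM x),
    eLpNorm_congr_ae hxc']
  exact h1

/-- The forms `q, q'` and embeddings `J, J'` of the two transformed operators are close. -/
theorem isClose_gradientForm (hU : IsOpen U) (hconn : IsConnected U) (h : IsBiLipschitz U φ)
    (ht : IsBiLipschitz U φt) (hA : IsElliptic A θ) (hq₀ : 2 < q₀) (hγ : 0 < γ) (hC₂ : 0 < C₂)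
    (hΛ : 0 ≤ Λ)
    {hI : ∀ p ∈ pullbackDomain bc U φ, ∀ r ∈ pullbackDomain bc U φ,
      Integrable (fun x => formDensity (pullbackMatrix A φ x) (p.2 x) (r.2 x)) (weightedMeasure U φ)}
    {hI' : ∀ p ∈ pullbackDomain bc U φ, ∀ r ∈ pullbackDomain bc U φ,
      Integrable (fun x => formDensity (pullbackMatrix A φt x) (p.2 x) (r.2 x))
        (weightedMeasure U φt)}
    {hM : ∀ p ∈ pullbackDomain bc U φ, MemLp p.1 2 (weightedMeasure U φ)}
    {J' : pullbackDomain bc U φ →ₗ[ℂ] Lp ℂ 2 (weightedMeasure U φ)}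
    (hJ' : ∀ p, p.1.1 =ᵐ[volume.restrict U] fun x => weightRatio φ φt x • J' p x)
    {lam lamt lamh : ℕ → ℝ} (hl : IsEigenvalueSeq (opH bc A U φ) lam)
    (hlt : IsEigenvalueSeq (opWHW bc A U φ φt) lamt) (hlh : IsEigenvalueSeq (opTST bc A U φ φt) lamh)
    (gH : IsFormGraph (opH bc A U φ) (gradientForm _ _ _ hI) (embedLp _ _ hM))
    (gT : IsFormGraph (opTST bc A U φ φt) (gradientForm _ _ _ hI') (embedLp _ _ hM))
    (gW : IsFormGraph (opWHW bc A U φ φt) (gradientForm _ _ _ hI') J')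
    (hP1 : PropertyP1 (weightedMeasure U φ) (opH bc A U φ) q₀ γ C₂)
    (hP2 : PropertyP2 U (weightedMeasure U φ) (opH bc A U φ) q₀ γ C₂)
    (hP2h : PropertyP2 U (weightedMeasure U φ) (opTST bc A U φ φt) q₀ γ C₂)
    (hP1t : PropertyP1 (weightedMeasure U φ) (opWHW bc A U φ φt) q₀ γ C₂)
    (hg : ∀ k, lam k ≠ 0 → lam k ≤ Λ → k + 1 < M) (hgt : ∀ k, lamt k ≠ 0 → lamt k ≤ Λ → k + 1 < M)
    (hgh : ∀ k, lamh k ≠ 0 → lamh k ≤ Λ → k + 1 < M)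
    {u : Lp ℂ 2 (weightedMeasure U φ)} (hu1 : ‖u‖ = 1) {B : ℝ} (hB0 : 0 ≤ B)
    (hB : eLpNorm u q₀ (weightedMeasure U φ) ≤ ENNReal.ofReal B) {δ : ℝ} (hδ0 : 0 ≤ δ)
    (hδ : vicinity A U φ φt (dualExponent q₀) ≤ ENNReal.ofReal δ) (hδB : δ * B ≤ 1 / 2) :
    IsClose (gradientForm _ _ _ hI) (gradientForm _ _ _ hI') (embedLp _ _ hM) J' Λ
      ((M * (C₂ * Λ ^ γ) + M * (C₂ * Λ ^ (1 / 2 + γ)) + 2 * B) * δ) := by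
  have hq : IsNonnegForm (gradientForm _ _ _ hI) :=
    gradientForm_isNonnegForm hI (pullbackMatrix_isSymm hA.symm φ) (hA.pullbackMatrix_nonneg φ)
  have hq' : IsNonnegForm (gradientForm _ _ _ hI') :=
    gradientForm_isNonnegForm hI' (pullbackMatrix_isSymm hA.symm φt) (hA.pullbackMatrix_nonneg φt)
  set B₁ := M * (C₂ * Λ ^ γ) with hB₁
  set B₂ := M * (C₂ * Λ ^ (1 / 2 + γ)) with hB₂
  have hB₁0 : 0 ≤ B₁ := by positivity
  have hB₂0 : 0 ≤ B₂ := by positivity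
  have hq1 : 1 ≤ q₀ := le_trans (by norm_num) hq₀.le
  have hac := weightedMeasure_ac hU h
  have hH := holderTriple_dualExponent hq₀
  have hδ1 : eLpNorm (fun x => weightRatio φ φt x - 1) (dualExponent q₀) (weightedMeasure U φ) ≤
      ENNReal.ofReal δ := le_trans (le_self_add.trans le_self_add) hδ
  have hδ2 : eLpNorm (fun x => (weightRatio φ φt x)⁻¹ - 1) (dualExponent q₀) (weightedMeasure U φ) ≤
      ENNReal.ofReal δ := le_trans (le_add_self.trans le_self_add) hδ
  have hδ3 : vicinity₂ A U φ φt (dualExponent q₀) ≤ ENNReal.ofReal δ := le_add_self.trans hδ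
  have hδ2' : eLpNorm (fun x => 1 - (weightRatio φ φt x)⁻¹) (dualExponent q₀) (weightedMeasure U φ) ≤
      ENNReal.ofReal δ := by
    rw [← eLpNorm_neg]
    refine le_of_eq_of_le (congrArg (fun f => eLpNorm f _ _) ?_) hδ2
    funext x
    simp
  have hk1 : AEStronglyMeasurable (fun x => weightRatio φ φt x - 1) (weightedMeasure U φ) :=
    ((measurable_weightRatio φ φt).sub_const 1).aestronglyMeasurable
  have hk2 : AEStronglyMeasurable (fun x => 1 - (weightRatio φ φt x)⁻¹) (weightedMeasure U φ) :=
    ((measurable_weightRatio φ φt).inv.const_sub 1).aestronglyMeasurable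
  -- The difference u - w⁻¹u is written both as (w - 1) w⁻¹u and as (1 - w⁻¹) u, so that the factor
  -- can multiply whichever of J'u and Ju has a known estimate.
  have hsub1 : ∀ p, embedLp _ _ hM p - J' p =ᵐ[weightedMeasure U φ]
      fun x => (weightRatio φ φt x - 1) • J' p x := fun p => by
    filter_upwards [Lp.coeFn_sub (embedLp _ _ hM p) (J' p), coeFn_embedLp hM p, hac.ae_le (hJ' p)]
      with x h1 h2 h3
    rw [h1, Pi.sub_apply, h2, h3, sub_smul, one_smul]
  have hsub2 : ∀ p, embedLp _ _ hM p - J' p =ᵐ[weightedMeasure U φ]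
      fun x => (1 - (weightRatio φ φt x)⁻¹) • p.1.1 x := fun p => by
    filter_upwards [Lp.coeFn_sub (embedLp _ _ hM p) (J' p), coeFn_embedLp hM p, hac.ae_le (hJ' p),
      hac.ae_le (h.ae_jacDet_pos hU), hac.ae_le (ht.ae_jacDet_pos hU)] with x h1 h2 h3 h4 h5
    have hw : weightRatio φ φt x ≠ 0 := (div_pos (Real.sqrt_pos.2 h4) (Real.sqrt_pos.2 h5)).ne'
    rw [h1, Pi.sub_apply, h2, sub_smul, one_smul]
    conv_rhs => rw [h3]
    rw [smul_smul, inv_mul_cancel₀ hw, one_smul, h3]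
  have hpm : ∀ p : pullbackDomain bc U φ, AEStronglyMeasurable p.1.1 (weightedMeasure U φ) :=
    fun p => (hM p p.2).1
  have hgm : ∀ p : pullbackDomain bc U φ, AEStronglyMeasurable p.1.2 (weightedMeasure U φ) :=
    fun p => (IsWeakGradient.aestronglyMeasurable p.2.1).mono_ac hac
  -- L^{q₀} bound for eigenfunctions of H: by (P1) for non-zero eigenvalues, and by constancy and
  -- comparison with the unit vector `u` for the eigenvalue zero.
  have hfun : ∀ t x, t ≤ Λ → IsFormEigen (gradientForm _ _ _ hI) (embedLp _ _ hM) t x →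
      ‖embedLp _ _ hM x‖ = 1 → eLpNorm x.1.1 q₀ (weightedMeasure U φ) ≤ ENNReal.ofReal (B₁ + 2 * B) := by
    intro t x htΛ hx hx1
    by_cases h0 : t = 0
    · have h1 := (gH.gradient_bounds hU h hq hl hP2 hq1 hγ hC₂ hg htΛ hx hx1).2 h0
      have h2 := eLpNorm_le_of_gradient_eq_zero hU hconn h (hM := hM) hq₀ hu1 hB hB0 h1
      rw [hx1, mul_one] at h2
      exact h2.trans (ENNReal.ofReal_le_ofReal (by linarith))
    · have h1 := gH.eigenfunction_bound hq hl hP1 hq1 hγ hC₂ hg htΛ h0 hx hx1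
      rw [eLpNorm_congr_ae (coeFn_embedLp hM x)] at h1
      exact h1.trans (ENNReal.ofReal_le_ofReal (by linarith))
  have hle1 : δ * B₂ ≤ (B₁ + B₂ + 2 * B) * δ := by nlinarith
  have hle2 : δ * (B₁ + 2 * B) ≤ (B₁ + B₂ + 2 * B) * δ := by nlinarith
  refine ⟨?_, ?_, ?_, ?_, ?_⟩
  · intro t x htΛ hx hx1 y
    have h1 := (gH.gradient_bounds hU h hq hl hP2 hq1 hγ hC₂ hg htΛ hx hx1).1
    exact (norm_gradientForm_sub_le hU h ht hA hI hI' hq₀ hδ0 hB₂0 hδ3 (hgm x) h1 y).1.trans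
      (mul_le_mul_of_nonneg_right hle1 (Real.sqrt_nonneg _))
  · intro t x htΛ hx hx1
    exact (norm_le_of_ae_smul hH hk2 (hpm x) (hsub2 x) hδ0 (by positivity) hδ2'
      (hfun t x htΛ hx hx1)).trans hle2
  · intro t x htΛ hx hx1 z
    refine (norm_inner_le_of_ae_smul hH hk1 (hsub1 z) hδ0 (B := B₁ + 2 * B) (by positivity) hδ1
      ?_).trans (mul_le_mul_of_nonneg_right hle2 (norm_nonneg _))
    rw [eLpNorm_congr_ae (coeFn_embedLp hM x)]
    exact hfun t x htΛ hx hx1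
  · intro t x htΛ hx hx1
    by_cases h0 : t = 0
    -- For the eigenvalue zero the embedding plays no role in the eigenvector equation, so `x` is
    -- also an eigenvector of (q', J). Property (P2) of T*ST, after normalization, then yields the
    -- vanishing gradient that is needed for w⁻¹H̃w.
    · have hx' : IsFormEigen (gradientForm _ _ _ hI') (embedLp _ _ hM) t x := fun y => by
        rw [hx y, h0, Complex.ofReal_zero, zero_mul, zero_mul]
      have hgrad : x.1.2 =ᵐ[volume.restrict U] 0 := by
        set c : ℂ := ((‖embedLp _ _ hM x‖⁻¹ : ℝ) : ℂ) with hc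
        have hne : embedLp _ _ hM x ≠ 0 := by
          intro h1
          have h2 := hJ' x
          have h3 : x.1.1 =ᵐ[weightedMeasure U φ] 0 := by
            refine (coeFn_embedLp hM x).symm.trans ?_
            rw [h1]
            exact Lp.coeFn_zero _ _ _
          have h4 : J' x = 0 := by
            refine (Lp.eq_zero_iff_ae_eq_zero).2 ?_
            filter_upwards [h3, hac.ae_le h2, hac.ae_le (h.ae_jacDet_pos hU),
              hac.ae_le (ht.ae_jacDet_pos hU)] with z h5 h6 h7 h8
            rw [h5] at h6
            have hw : weightRatio φ φt z ≠ 0 :=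
              (div_pos (Real.sqrt_pos.2 h7) (Real.sqrt_pos.2 h8)).ne'
            exact (smul_eq_zero.1 h6.symm).resolve_left hw
          rw [h4, norm_zero] at hx1
          exact zero_ne_one hx1
        have hn : ‖embedLp _ _ hM (c • x)‖ = 1 := by
          rw [map_smul, norm_smul, hc, Complex.norm_real, norm_inv, norm_norm,
            inv_mul_cancel₀ (norm_ne_zero_iff.2 hne)]
        have hcx : IsFormEigen (gradientForm _ _ _ hI') (embedLp _ _ hM) t (c • x) := fun y => by
          rw [map_smul, hx' y, map_smul, inner_smul_right, smul_eq_mul]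
          ring
        have h1 := (gT.gradient_bounds hU h hq' hlh hP2h hq1 hγ hC₂ hgh htΛ hcx hn).2 h0
        have hc0 : c ≠ 0 := by
          rw [hc, Complex.ofReal_ne_zero]
          exact inv_ne_zero (norm_ne_zero_iff.2 hne)
        filter_upwards [h1] with z hz
        exact (smul_eq_zero.1 hz).resolve_left hc0
      have h2 := eLpNorm_le_of_gradient_eq_zero hU hconn h (hM := hM) hq₀ hu1 hB hB0 hgrad
      have h3 := norm_le_of_ae_smul hH hk2 (hpm x) (hsub2 x) hδ0
        (mul_nonneg hB0 (norm_nonneg _)) hδ2' h2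
      have h4 : ‖embedLp _ _ hM x‖ ≤ ‖embedLp _ _ hM x - J' x‖ + 1 := by
        rw [← hx1]
        exact norm_le_norm_sub_add _ _
      have h5 : 0 ≤ δ * B := mul_nonneg hδ0 hB0
      -- The constant is normalized by J' rather than J, so ‖Jx‖ ≤ ‖Jx - J'x‖ + 1 is inserted, and
      -- δB ≤ 1/2 absorbs the first term.
      have h6 : ‖embedLp _ _ hM x - J' x‖ ≤ 2 * (δ * B) := by
        nlinarith [norm_nonneg (embedLp _ _ hM x - J' x)]
      nlinarith
    · exact (norm_le_of_ae_smul hH hk1 (Lp.memLp (J' x)).1 (hsub1 x) hδ0 hB₁0 hδ1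
        (gW.eigenfunction_bound hq' hlt hP1t hq1 hγ hC₂ hgt htΛ h0 hx hx1)).trans (by nlinarith)
  · intro t x htΛ hx hx1 y
    have h1 := (gT.gradient_bounds hU h hq' hlh hP2h hq1 hγ hC₂ hgh htΛ hx hx1).1
    exact (norm_gradientForm_sub_le hU h ht hA hI hI' hq₀ hδ0 hB₂0 hδ3 (hgm x) h1 y).2.trans
      (mul_le_mul_of_nonneg_right hle1 (Real.sqrt_nonneg _))

end Closeness

/-! ### From the transformed operators to the original ones -/

theorem eLpNorm_restrict_union_le {S T : Set (E N)} (f : E N → ℂ) :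
    eLpNorm f 2 (volume.restrict (S ∪ T)) ≤
      eLpNorm f 2 (volume.restrict S) + eLpNorm f 2 (volume.restrict T) := by
  simp only [eLpNorm_eq_lintegral_rpow_enorm_toReal (p := 2) (by norm_num) (by norm_num)]
  refine (ENNReal.rpow_le_rpow (lintegral_union_le _ S T) (by positivity)).trans ?_
  exact ENNReal.rpow_add_le_add_rpow _ _ (by positivity) (by norm_num)

section Transfer

variable {U : Set (E N)} {φ φt : E N → E N}

theorem eLpNorm_image_le (hU : IsOpen U) (h : IsBiLipschitz U φ) {f : E N → ℂ}
    (hf : AEStronglyMeasurable f (volume.restrict (φ '' U))) {a b : E N → ℂ}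
    (ha : AEStronglyMeasurable a (volume.restrict U)) (hb : AEStronglyMeasurable b (volume.restrict U))
    (hab : ∀ᵐ x ∂volume.restrict U, √(jacDet φ x) • f (φ x) = a x + b x) :
    eLpNorm f 2 (volume.restrict (φ '' U)) ≤
      eLpNorm a 2 (volume.restrict U) + eLpNorm b 2 (volume.restrict U) := by
  rw [← h.eLpNorm_weighted hU 2 hf, eLpNorm_weightedMeasure φ (h.aestronglyMeasurable_comp hU hf),
    eLpNorm_congr_ae hab]
  exact eLpNorm_add_le ha hb (by norm_num)

/-- The `L²` distance of two functions, extended by zero, in terms of their pull-backs to `U`. -/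
theorem eLpNorm_indicator_sub_le (hU : IsOpen U) (h : IsBiLipschitz U φ) (ht : IsBiLipschitz U φt)
    {u v : E N → ℂ} (hu : AEStronglyMeasurable u (volume.restrict (φ '' U)))
    (hv : AEStronglyMeasurable v (volume.restrict (φt '' U))) {d : E N → ℂ}
    (hd : ∀ᵐ x ∂volume.restrict U, d x = √(jacDet φ x) • u (φ x) - √(jacDet φt x) • v (φt x)) :
    eLpNorm ((φ '' U).indicator u - (φt '' U).indicator v) 2 (volume.restrict (φ '' U ∪ φt '' U)) ≤
      2 * eLpNorm d 2 (volume.restrict U) + changeTerm U φ φt ((φ '' U).indicator u) +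
        changeTerm U φ φt ((φt '' U).indicator v) := by
  set u' := (φ '' U).indicator u with hu'
  set v' := (φt '' U).indicator v with hv'
  have hum : AEStronglyMeasurable u' volume :=
    (aestronglyMeasurable_indicator_iff h.isOpen_image.measurableSet).2 hu
  have hvm : AEStronglyMeasurable v' volume :=
    (aestronglyMeasurable_indicator_iff ht.isOpen_image.measurableSet).2 hv
  have huφ : ∀ᵐ x ∂volume.restrict U, u' (φ x) = u (φ x) := by
    filter_upwards [ae_restrict_mem hU.measurableSet] with x hx
    exact indicator_of_mem (mem_image_of_mem φ hx) u
  have hvφ : ∀ᵐ x ∂volume.restrict U, v' (φt x) = v (φt x) := by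
    filter_upwards [ae_restrict_mem hU.measurableSet] with x hx
    exact indicator_of_mem (mem_image_of_mem φt hx) v
  have hm : ∀ {χ χ' : E N → E N}, IsBiLipschitz U χ → ∀ {f : E N → ℂ},
      AEStronglyMeasurable f volume →
      AEStronglyMeasurable (fun x => √(jacDet χ' x) • f (χ x)) (volume.restrict U) :=
    fun {χ χ'} hχ {f} hf => (measurable_jacDet χ').sqrt.aestronglyMeasurable.smul
      (hχ.aestronglyMeasurable_comp hU hf.restrict)
  have hdm : AEStronglyMeasurable d (volume.restrict U) := by
    have h1 : AEStronglyMeasurable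
        (fun x => √(jacDet φ x) • u' (φ x) - √(jacDet φt x) • v' (φt x)) (volume.restrict U) :=
      (hm h hum).sub (hm ht hvm)
    refine h1.congr ?_
    filter_upwards [hd, huφ, hvφ] with x h1 h2 h3
    rw [h1, h2, h3]
  -- On φ(U) the difference is pulled back by φ: √g (u - v)(φ) equals `d` minus the change of `v`
  -- between φ and φ̃. On φ̃(U), in `e2`, the change of `u` appears instead.
  have e1 : eLpNorm (u' - v') 2 (volume.restrict (φ '' U)) ≤
      eLpNorm d 2 (volume.restrict U) + changeTerm U φ φt v' := by
    rw [changeTerm, ← eLpNorm_neg (fun x => √(jacDet φ x) • v' (φ x) - √(jacDet φt x) • v' (φt x))]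
    refine eLpNorm_image_le hU h (hum.sub hvm).restrict hdm ((hm h hvm).sub (hm ht hvm)).neg ?_
    filter_upwards [hd, huφ, hvφ] with x h1 h2 h3
    rw [h1, Pi.sub_apply, Pi.neg_apply, h2, ← h3, smul_sub]
    abel
  have e2 : eLpNorm (u' - v') 2 (volume.restrict (φt '' U)) ≤
      eLpNorm d 2 (volume.restrict U) + changeTerm U φ φt u' := by
    rw [changeTerm, ← eLpNorm_neg (fun x => √(jacDet φ x) • u' (φ x) - √(jacDet φt x) • u' (φt x))]
    refine eLpNorm_image_le hU ht (hum.sub hvm).restrict hdm ((hm h hum).sub (hm ht hum)).neg ?_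
    filter_upwards [hd, huφ, hvφ] with x h1 h2 h3
    rw [h1, Pi.sub_apply, Pi.neg_apply, h3, ← h2, smul_sub]
    abel
  calc _ ≤ (eLpNorm d 2 (volume.restrict U) + changeTerm U φ φt v') +
        (eLpNorm d 2 (volume.restrict U) + changeTerm U φ φt u') :=
      (eLpNorm_restrict_union_le _).trans (add_le_add e1 e2)
    _ = _ := by rw [two_mul]; abel

/-- Multiplied by √g, the difference of the transformed functions is √g u ∘ φ - √g̃ v ∘ φ̃. It
enters once for each image domain, whence the factor 2 in `hr`. -/
theorem eigenfunctionEstimate_of_norm_le (hU : IsOpen U) (h : IsBiLipschitz U φ)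
    (ht : IsBiLipschitz U φt)
    {W : Lp ℂ 2 (volume.restrict (φ '' U)) ≃ₗᵢ[ℂ] Lp ℂ 2 (weightedMeasure U φ)}
    (hW : ∀ f, W f =ᵐ[volume.restrict U] fun x => f (φ x))
    {Wt : Lp ℂ 2 (volume.restrict (φt '' U)) ≃ₗᵢ[ℂ] Lp ℂ 2 (weightedMeasure U φt)}
    (hWt : ∀ f, Wt f =ᵐ[volume.restrict U] fun x => f (φt x))
    {W' : Lp ℂ 2 (weightedMeasure U φt) ≃ₗᵢ[ℂ] Lp ℂ 2 (weightedMeasure U φ)}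
    (hW' : ∀ f : Lp ℂ 2 (weightedMeasure U φt), f =ᵐ[volume.restrict U]
      fun x => weightRatio φ φt x • W' f x)
    {A : E N → Matrix (Fin N) (Fin N) ℝ} {q₀ : ℝ≥0∞} {s : ℝ} {c : ℝ≥0} {r : ℝ} (hc1 : 1 ≤ c)
    (hr : 2 * ENNReal.ofReal r ≤ c * vicinityFactor A U φ φt q₀ s)
    {u : Lp ℂ 2 (volume.restrict (φ '' U))} {v : Lp ℂ 2 (volume.restrict (φt '' U))}
    (huv : ‖W u - W' (Wt v)‖ ≤ r) : EigenfunctionEstimate A U φ φt q₀ s c u v := by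
  have hac := restrict_ac_weightedMeasure hU h
  set f := W u - W' (Wt v) with hf
  have hd : ∀ᵐ x ∂volume.restrict U, √(jacDet φ x) • f x =
      √(jacDet φ x) • u (φ x) - √(jacDet φt x) • v (φt x) := by
    filter_upwards [hW u, hWt v, hW' (Wt v), hac.ae_le (Lp.coeFn_sub (W u) (W' (Wt v))),
      ht.ae_jacDet_pos hU] with x h1 h2 h3 h4 h5
    rw [hf, h4, Pi.sub_apply, h1, smul_sub, ← h2, h3, smul_smul, weightRatio,
      mul_div_cancel₀ _ (Real.sqrt_pos.2 h5).ne']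
  have h1 := eLpNorm_indicator_sub_le hU h ht (Lp.memLp u).1 (Lp.memLp v).1 hd
  rw [← eLpNorm_weightedMeasure φ ((Lp.memLp f).1.mono_ac hac)] at h1
  have h2 : eLpNorm f 2 (weightedMeasure U φ) ≤ ENNReal.ofReal r := by
    rw [← ENNReal.ofReal_toReal (Lp.eLpNorm_ne_top f), ← Lp.norm_def]
    exact ENNReal.ofReal_le_ofReal huv
  have hc : ∀ a : ℝ≥0∞, a ≤ c * a := fun a => by
    calc a = 1 * a := (one_mul a).symm
      _ ≤ c * a := by gcongr; exact_mod_cast hc1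
  refine h1.trans ?_
  rw [mul_add, mul_add]
  exact add_le_add (add_le_add ((mul_le_mul_right h2 2).trans hr) (hc _)) (hc _)

end Transfer

/-! ### Blocks of equal eigenvalues -/

section Blocks

variable {H : Type*} [NormedAddCommGroup H] [InnerProductSpace ℂ H]

/-- The neighbours of a block of eigenvalues, which exhausts the multiplicity, are different. -/
theorem IsEigenvalueSeq.neighbours {G : Submodule ℂ (H × H)} {lam : ℕ → ℝ}
    (hl : IsEigenvalueSeq G lam) {n m : ℕ} {v : ℝ} (hm : 0 < m)
    (hfin : Module.finrank ℂ (eigenspace G v) = m) (heq : ∀ j, n ≤ j → j < n + m → lam j = v) :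
    v < lam (n + m) ∧ ∀ j, j + 1 = n → lam j < v := by
  have hn : lam n = v := heq n le_rfl (by omega)
  have key : ∀ j, lam j = v → n ≤ j ∧ j < n + m := by
    intro j hj
    by_contra hcon
    -- Another position with the same value would give m + 1 positions for an eigenspace of
    -- dimension `m`.
    have hsub : insert j (Finset.Ico n (n + m) : Finset ℕ) ⊆ (hl.2 v).1.toFinset := by
      intro k hk
      rw [Finite.mem_toFinset]
      rcases Finset.mem_insert.1 hk with rfl | hk
      · exact hj
      · rw [Finset.mem_Ico] at hk
        exact heq k hk.1 hk.2
    have h1 := Finset.card_le_card hsub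
    rw [Finset.card_insert_of_notMem (by rwa [Finset.mem_Ico]), Nat.card_Ico,
      ← Set.ncard_eq_toFinset_card _ (hl.2 v).1, (hl.2 v).2.2, hfin] at h1
    omega
  refine ⟨lt_of_le_of_ne ?_ fun h => ?_, fun j hj => lt_of_le_of_ne ?_ fun h => ?_⟩
  · rw [← hn]
    exact hl.1 (by omega)
  · have := key _ h.symm
    omega
  · rw [← hn]
    exact hl.1 (by omega)
  · have := key _ h
    omega

theorem IsFormGraph.eigenvalue_nonneg {V : Type*} [AddCommGroup V] [Module ℂ V]
    {G : Submodule ℂ (H × H)} {q : V →ₗ⋆[ℂ] V →ₗ[ℂ] ℂ} (hq : IsNonnegForm q) {J : V →ₗ[ℂ] H}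
    (h : IsFormGraph G q J) {t : ℝ} (ht : 0 < Module.finrank ℂ (eigenspace G t)) : 0 ≤ t := by
  have : Nontrivial (eigenspace G t) := Module.nontrivial_of_finrank_pos ht
  obtain ⟨u, hu⟩ := exists_ne (0 : eigenspace G t)
  have hu0 : (u : H) ≠ 0 := fun h => hu (Subtype.ext h)
  set c : ℂ := ((‖(u : H)‖⁻¹ : ℝ) : ℂ) with hc
  obtain ⟨x, hx, hx'⟩ := h.mem_eigenspace.1 ((eigenspace G t).smul_mem c u.2)
  refine hx'.nonneg hq ?_
  rw [hx, norm_smul, hc, Complex.norm_real, norm_inv, norm_norm,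
    inv_mul_cancel₀ (norm_ne_zero_iff.2 hu0)]

end Blocks

/-! ### Realization of the transformed operators by forms on a common domain -/

section Realization

variable {bc : BoundaryCondition} {U : Set (E N)} {φ φt χ : E N → E N}
  {A : E N → Matrix (Fin N) (Fin N) ℝ} {θ : ℝ} {q₀ : ℝ≥0∞} {γ C₂ : ℝ}

theorem eigenvalue_opL_nonneg (hA : IsElliptic A θ) {t : ℝ}
    (h : 0 < Module.finrank ℂ (eigenspace (opL bc A U χ) t)) : 0 ≤ t := by
  have hI : ∀ p ∈ formDomain bc (χ '' U), ∀ r ∈ formDomain bc (χ '' U),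
      Integrable (fun x => formDensity (A x) (p.2 x) (r.2 x)) (volume.restrict (χ '' U)) :=
    fun p hp r hr => hA.integrable_formDensity (formDomain_le_sobolev bc _ hp).2.1
      (formDomain_le_sobolev bc _ hr).2.1
  have hM : ∀ p ∈ formDomain bc (χ '' U), MemLp p.1 2 (volume.restrict (χ '' U)) :=
    fun p hp => (formDomain_le_sobolev bc _ hp).1
  exact (isFormGraph_formOperator hI hM).eigenvalue_nonneg
    (gradientForm_isNonnegForm hI hA.symm fun x F => hA.formDensity_nonneg x F) h

theorem IsEigenvalueBlock.bounds (hA : IsElliptic A θ) {lam : ℕ → ℝ} {n m : ℕ}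
    {lamPrev lamVal lamNext : ℝ} (hb : IsEigenvalueBlock bc A U χ lam n m lamPrev lamVal lamNext)
    (hl : IsEigenvalueSeq (opL bc A U χ) lam) :
    0 ≤ lamVal ∧ lamVal < lamNext ∧ (0 < n → lamPrev < lamVal) := by
  obtain ⟨h1, h2⟩ := hl.neighbours hb.pos hb.multiplicity hb.eq
  refine ⟨eigenvalue_opL_nonneg hA (hb.multiplicity ▸ hb.pos), hb.next ▸ h1, fun hn => ?_⟩
  rw [← hb.prev (n - 1) (by omega)]
  exact h2 _ (by omega)

/-- The isometries, forms and embeddings which represent the operators `L`, `L̃` and `T^*ST` on the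
common form domain. -/
structure FormRealization (bc : BoundaryCondition) (A : E N → Matrix (Fin N) (Fin N) ℝ)
    (U : Set (E N)) (φ φt : E N → E N) where
  W : Lp ℂ 2 (volume.restrict (φ '' U)) ≃ₗᵢ[ℂ] Lp ℂ 2 (weightedMeasure U φ)
  Wt : Lp ℂ 2 (volume.restrict (φt '' U)) ≃ₗᵢ[ℂ] Lp ℂ 2 (weightedMeasure U φt)
  W' : Lp ℂ 2 (weightedMeasure U φt) ≃ₗᵢ[ℂ] Lp ℂ 2 (weightedMeasure U φ)
  coe_W : ∀ f, W f =ᵐ[volume.restrict U] fun x => f (φ x)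
  coe_Wt : ∀ f, Wt f =ᵐ[volume.restrict U] fun x => f (φt x)
  coe_W' : ∀ f : Lp ℂ 2 (weightedMeasure U φt), f =ᵐ[volume.restrict U]
    fun x => weightRatio φ φt x • W' f x
  integrable : ∀ p ∈ pullbackDomain bc U φ, ∀ r ∈ pullbackDomain bc U φ,
    Integrable (fun x => formDensity (pullbackMatrix A φ x) (p.2 x) (r.2 x)) (weightedMeasure U φ)
  integrable' : ∀ p ∈ pullbackDomain bc U φ, ∀ r ∈ pullbackDomain bc U φ,
    Integrable (fun x => formDensity (pullbackMatrix A φt x) (p.2 x) (r.2 x)) (weightedMeasure U φt)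
  memLp : ∀ p ∈ pullbackDomain bc U φ, MemLp p.1 2 (weightedMeasure U φ)
  memLp' : ∀ p ∈ pullbackDomain bc U φ, MemLp p.1 2 (weightedMeasure U φt)

theorem nonempty_formRealization (hU : IsOpen U) (h : IsBiLipschitz U φ) (ht : IsBiLipschitz U φt)
    (hA : IsElliptic A θ) : Nonempty (FormRealization bc A U φ φt) := by
  obtain ⟨W, hW⟩ := exists_comp_isometry hU h
  obtain ⟨Wt, hWt⟩ := exists_comp_isometry hU ht
  obtain ⟨W', hW'⟩ := exists_weight_isometry hU h ht
  exact ⟨⟨W, Wt, W', hW, hWt, hW', fun p hp r hr => integrable_pullback hU h hA hp hr,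
    fun p hp r hr => integrable_pullback hU ht hA (pullbackDomain_le hU h ht hp)
      (pullbackDomain_le hU h ht hr),
    fun p hp => memLp_weighted_of_mem_sobolev hU h (pullbackDomain_le_sobolev hU h hp),
    fun p hp => memLp_weighted_of_mem_sobolev hU ht (pullbackDomain_le_sobolev hU h hp)⟩⟩

namespace FormRealization

variable (R : FormRealization bc A U φ φt)

/-- The form of `H`. -/
def form : pullbackDomain bc U φ →ₗ⋆[ℂ] pullbackDomain bc U φ →ₗ[ℂ] ℂ :=
  gradientForm _ _ _ R.integrable

/-- The form of `w⁻¹ H̃ w` and of `T^*ST`. -/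
def form' : pullbackDomain bc U φ →ₗ⋆[ℂ] pullbackDomain bc U φ →ₗ[ℂ] ℂ :=
  gradientForm _ _ _ R.integrable'

/-- The embedding of the form domain for `H` and `T^*ST`. -/
def embed : pullbackDomain bc U φ →ₗ[ℂ] Lp ℂ 2 (weightedMeasure U φ) := embedLp _ _ R.memLp

/-- The embedding `u ↦ w⁻¹ u` of the form domain for `w⁻¹ H̃ w`. -/
def embed' : pullbackDomain bc U φ →ₗ[ℂ] Lp ℂ 2 (weightedMeasure U φ) :=
  (R.W'.toLinearEquiv : _ →ₗ[ℂ] _) ∘ₗ embedLp _ _ R.memLp'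

theorem isNonnegForm (hA : IsElliptic A θ) : IsNonnegForm R.form :=
  gradientForm_isNonnegForm _ (pullbackMatrix_isSymm hA.symm φ) (hA.pullbackMatrix_nonneg φ)

theorem isNonnegForm' (hA : IsElliptic A θ) : IsNonnegForm R.form' :=
  gradientForm_isNonnegForm _ (pullbackMatrix_isSymm hA.symm φt) (hA.pullbackMatrix_nonneg φt)

theorem isFormGraph_opH : IsFormGraph (opH bc A U φ) R.form R.embed :=
  isFormGraph_formOperator _ _

theorem isFormGraph_opTST : IsFormGraph (opTST bc A U φ φt) R.form' R.embed :=
  isFormGraph_formOperator _ _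

/-- The form q' with the plain embedding in L²(Ω, g̃ dx) represents H̃, since the form domains of φ
and φ̃ coincide; division by w then changes only the embedding. -/
theorem isFormGraph_opWHW (hU : IsOpen U) (h : IsBiLipschitz U φ) (ht : IsBiLipschitz U φt) :
    IsFormGraph (opWHW bc A U φ φt) R.form' R.embed' := by
  have h1 : IsFormGraph (opH bc A U φt) R.form' (embedLp _ _ R.memLp') := by
    rw [opH, ← pullbackDomain_eq hU h ht]
    exact isFormGraph_formOperator _ _
  exact h1.intertwines (intertwines_opH_opWHW hU h ht R.coe_W')

theorem intertwines (hU : IsOpen U) (h : IsBiLipschitz U φ) (hA : IsElliptic A θ) :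
    IntertwinesGraph R.W (opL bc A U φ) (opH bc A U φ) :=
  intertwines_opL_opH hU h hA R.coe_W

theorem intertwines' (hU : IsOpen U) (h : IsBiLipschitz U φ) (ht : IsBiLipschitz U φt)
    (hA : IsElliptic A θ) :
    IntertwinesGraph (R.Wt.trans R.W') (opL bc A U φt) (opWHW bc A U φ φt) :=
  (intertwines_opL_opH hU ht hA R.coe_Wt).trans (intertwines_opH_opWHW hU h ht R.coe_W')

theorem embed_dense (hU : IsOpen U) (h : IsBiLipschitz U φ) {f : Lp ℂ 2 (weightedMeasure U φ)}
    (hf : ∀ x, inner ℂ (R.embed x) f = 0) : f = 0 :=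
  embedLp_dense hU h rfl R.memLp hf

theorem embed'_dense (hU : IsOpen U) (h : IsBiLipschitz U φ) (ht : IsBiLipschitz U φt)
    {f : Lp ℂ 2 (weightedMeasure U φ)} (hf : ∀ x, inner ℂ (R.embed' x) f = 0) : f = 0 := by
  obtain ⟨k, rfl⟩ := R.W'.surjective f
  rw [embedLp_dense hU ht (pullbackDomain_eq hU h ht) R.memLp' (f := k) fun x => ?_, map_zero]
  rw [← hf x]
  exact (R.W'.inner_map_map _ _).symm

theorem coe_embed' (hU : IsOpen U) (ht : IsBiLipschitz U φt) (p : pullbackDomain bc U φ) :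
    p.1.1 =ᵐ[volume.restrict U] fun x => weightRatio φ φt x • R.embed' p x := by
  have h1 : embedLp _ _ R.memLp' p =ᵐ[volume.restrict U] p.1.1 :=
    (restrict_ac_weightedMeasure hU ht).ae_le (coeFn_embedLp R.memLp' p)
  exact h1.symm.trans (R.coe_W' (embedLp _ _ R.memLp' p))

end FormRealization

end Realization

/-! ### Transport of eigenvectors between unitarily equivalent operators -/

section Transport

variable {V H H' : Type*} [AddCommGroup V] [Module ℂ V] [NormedAddCommGroup H]
  [InnerProductSpace ℂ H] [NormedAddCommGroup H'] [InnerProductSpace ℂ H'] {W : H ≃ₗᵢ[ℂ] H'}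
  {G : Submodule ℂ (H × H)} {G' : Submodule ℂ (H' × H')} {q : V →ₗ⋆[ℂ] V →ₗ[ℂ] ℂ}
  {J : V →ₗ[ℂ] H'}

/-- Orthonormal eigenvectors of an operator, as eigenvectors of the form of a unitarily equivalent
operator. -/
theorem IntertwinesGraph.exists_formEigen (h : IntertwinesGraph W G G') (hG : IsFormGraph G' q J)
    {ι : Type*} {t : ι → ℝ} {ψ : ι → H} (ho : Orthonormal ℂ ψ) (hψ : ∀ j, ψ j ∈ eigenspace G (t j)) :
    ∃ v : ι → V, (∀ j, J (v j) = W (ψ j)) ∧ (∀ j, IsFormEigen q J (t j) (v j)) ∧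
      Orthonormal ℂ fun j => J (v j) := by
  have h1 : ∀ j, ∃ x, J x = W (ψ j) ∧ IsFormEigen q J (t j) x := fun j =>
    hG.mem_eigenspace.1 (h.mem_eigenspace.1 (hψ j))
  choose v hv hv' using h1
  refine ⟨v, hv, hv', ?_⟩
  simp only [hv]
  exact ho.comp_linearIsometryEquiv W

/-- Orthonormal vectors spanned by eigenvectors of the form for one eigenvalue. -/
theorem IntertwinesGraph.symm_mem_eigenspace (h : IntertwinesGraph W G G') (hG : IsFormGraph G' q J)
    {lam : ℕ → ℝ} {e : ℕ → V} (he : IsEigenbasis q J lam e) {n m : ℕ} {t : ℝ}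
    (ht : ∀ j, n ≤ j → j < n + m → lam j = t) {y : H'}
    (hy : y ∈ Submodule.span ℂ (range fun i : Fin m => J (e (n + i)))) :
    W.symm y ∈ eigenspace G t := by
  rw [h.mem_eigenspace, W.apply_symm_apply]
  refine Submodule.span_le.2 ?_ hy
  rintro _ ⟨i, rfl⟩
  refine hG.mem_eigenspace.2 ⟨_, rfl, ?_⟩
  rw [← ht (n + i) (by omega) (by omega)]
  exact he.eigen _

end Transport

theorem PropertyP1.exists_eigenfunctionSeq {μ : Measure (E N)}
    {G : Submodule ℂ (Lp ℂ 2 μ × Lp ℂ 2 μ)} {q₀ : ℝ≥0∞} {γ C₂ : ℝ} (hP : PropertyP1 μ G q₀ γ C₂)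
    {lam : ℕ → ℝ} (hl : IsEigenvalueSeq G lam) : ∃ ψ : ℕ → Lp ℂ 2 μ, IsEigenfunctionSeq G lam ψ ∧
      ∀ n, lam n ≠ 0 → eLpNorm (ψ n) q₀ μ ≤ ENNReal.ofReal (C₂ * lam n ^ γ) := by
  obtain ⟨lam', ψ, hl', hψ, h⟩ := hP
  obtain rfl := hl'.unique hl
  exact ⟨ψ, hψ, h⟩

theorem vicinity_le_vicinityFactor (A : E N → Matrix (Fin N) (Fin N) ℝ) (U : Set (E N))
    (φ φt : E N → E N) (q₀ : ℝ≥0∞) (s : ℝ) :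
    vicinity A U φ φt (dualExponent q₀) ≤ vicinityFactor A U φ φt q₀ s := by
  rw [vicinityFactor]
  calc _ = 1 * vicinity A U φ φt (dualExponent q₀) := (one_mul _).symm
    _ ≤ _ := by gcongr; exact le_self_add

/-- The numerical consequences of the smallness of the vicinity. -/
theorem exists_real_of_le_inv {v F : ℝ≥0∞} {c : ℝ≥0} (hvF : v ≤ F) (hF : F ≤ (c : ℝ≥0∞)⁻¹)
    {B K C ε₀ : ℝ} (hB : 0 ≤ B) (hK : 0 ≤ K) (hC : 0 < C) (hε : 0 < ε₀)
    (hc : (c : ℝ) = 2 + 2 * B + K / ε₀ + 2 * (C * K)) :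
    ∃ δ : ℝ, 0 ≤ δ ∧ v ≤ ENNReal.ofReal δ ∧ δ * B ≤ 1 / 2 ∧ K * δ ≤ ε₀ ∧
      2 * ENNReal.ofReal (C * (K * δ)) ≤ c * F := by
  have hKε : 0 ≤ K / ε₀ := by positivity
  have hCK : 0 ≤ C * K := by positivity
  have hc0 : 0 < (c : ℝ) := by rw [hc]; positivity
  have hc0' : c ≠ 0 := fun h => by simp [h] at hc0
  have hv : v ≠ ⊤ := ne_top_of_le_ne_top (by simp [hc0']) (hvF.trans hF)
  have hδc : v.toReal * c ≤ 1 := by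
    have h1 := ENNReal.toReal_mono (by simp [hc0']) (hvF.trans hF)
    rw [ENNReal.toReal_inv, ENNReal.coe_toReal] at h1
    calc v.toReal * c ≤ (c : ℝ)⁻¹ * c := by gcongr
      _ = 1 := inv_mul_cancel₀ hc0.ne'
  have hδ0 : 0 ≤ v.toReal := ENNReal.toReal_nonneg
  -- `v` is finite and δc ≤ 1. The summands 2B, K/ε₀ and 2CK of `c` account for the last three
  -- inequalities, in this order.
  refine ⟨v.toReal, hδ0, (ENNReal.ofReal_toReal hv).ge, ?_, ?_, ?_⟩
  · have : v.toReal * (2 * B) ≤ v.toReal * c := by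
      refine mul_le_mul_of_nonneg_left ?_ hδ0
      linarith
    linarith
  · have : v.toReal * (K / ε₀) ≤ v.toReal * c := by
      refine mul_le_mul_of_nonneg_left ?_ hδ0
      linarith
    have h2 := mul_le_mul_of_nonneg_right (this.trans hδc) hε.le
    calc K * v.toReal = v.toReal * (K / ε₀) * ε₀ := by field_simp
      _ ≤ ε₀ := by linarith
  · calc 2 * ENNReal.ofReal (C * (K * v.toReal)) = ENNReal.ofReal (2 * (C * K)) * v := by
          rw [← ENNReal.ofReal_ofNat 2, ← ENNReal.ofReal_mul (by norm_num)]
          conv_rhs => rw [← ENNReal.ofReal_toReal hv, ← ENNReal.ofReal_mul (by positivity)]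
          ring_nf
      _ ≤ c * F := by
          refine mul_le_mul' ?_ hvF
          rw [← ENNReal.ofReal_coe_nnreal]
          exact ENNReal.ofReal_le_ofReal (by linarith)

end SpectralStability

end

/-! ### The stability theorem for eigenfunctions -/

open SpectralStability
theorem theorem3p3 (bc : BoundaryCondition) (α γ C₁ C₂ : ℝ)
    (hα : 0 < α) (hγ : 0 < γ) (hC₁ : 0 < C₁) (hC₂ : 0 < C₂)
    (q₀ : ℝ≥0∞) (hq₀ : 2 < q₀)
    (s : ℝ) (hs : ENNReal.ofReal (α + 2 * γ) / (1 - 2 / q₀) < ENNReal.ofReal s)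
    (lamPrev lamVal lamNext : ℝ) (normG : ℝ≥0) :
    ∃ c : ℝ≥0, 0 < c ∧
      ∀ (N : ℕ) (_ : 0 < N) (Ω : Set (E N))
        (_ : IsOpen Ω) (_ : IsConnected Ω) (_ : Bornology.IsBounded Ω)
        (A : E N → Matrix (Fin N) (Fin N) ℝ) (θ : ℝ)
        (_ : IsElliptic A θ)
        (φ φt : E N → E N)
        (_ : IsBiLipschitz Ω φ) (_ : IsBiLipschitz Ω φt)
        (_ : bc = .neumann →
          eLpNorm (jacDet φ) q₀ (volume.restrict Ω) = normG)
        -- compact resolvents, enumerations of the eigenvalues, and their growth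
        (_ : HasCompactResolvent (opL bc A Ω φ))
        (_ : HasCompactResolvent (opL bc A Ω φt))
        (_ : HasCompactResolvent (opTST bc A Ω φ φt))
        (lam lamt lamh : ℕ → ℝ)
        (_ : IsEigenvalueSeq (opL bc A Ω φ) lam)
        (_ : IsEigenvalueSeq (opL bc A Ω φt) lamt)
        (_ : IsEigenvalueSeq (opTST bc A Ω φ φt) lamh)
        (_ : EigenvalueGrowth lam α C₁)
        (_ : EigenvalueGrowth lamt α C₁)
        (_ : EigenvalueGrowth lamh α C₁)
        -- properties (P1) and (P2)
        (_ : PropertyP1 (weightedMeasure Ω φ)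
          (opH bc A Ω φ) q₀ γ C₂)
        (_ : PropertyP2 Ω (weightedMeasure Ω φ)
          (opH bc A Ω φ) q₀ γ C₂)
        (_ : PropertyP1 (weightedMeasure Ω φ)
          (opTST bc A Ω φ φt) q₀ γ C₂)
        (_ : PropertyP2 Ω (weightedMeasure Ω φ)
          (opTST bc A Ω φ φt) q₀ γ C₂)
        (_ : PropertyP1 (weightedMeasure Ω φ)
          (opWHW bc A Ω φ φt) q₀ γ C₂)
        -- smallness
        (_ : vicinityFactor A Ω φ φt q₀ s ≤ (c : ℝ≥0∞)⁻¹)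
        (n m : ℕ),
        -- an eigenvalue of the first operator, eigenfunctions of the second one are given
        (IsEigenvalueBlock bc A Ω φ lam n m lamPrev lamVal lamNext →
          ∀ ψt : Fin m → Lp ℂ 2 (volume.restrict (φt '' Ω)),
            AreEigenfunctions bc A Ω φt lamt n m ψt →
            ∃ ψ : Fin m → Lp ℂ 2 (volume.restrict (φ '' Ω)),
              AreEigenfunctions bc A Ω φ lam n m ψ ∧
              ∀ j, EigenfunctionEstimate A Ω φ φt q₀ s c (ψ j) (ψt j)) ∧
        -- an eigenvalue of the second operator, eigenfunctions of the first one are given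
        (IsEigenvalueBlock bc A Ω φt lamt n m lamPrev lamVal lamNext →
          ∀ ψ : Fin m → Lp ℂ 2 (volume.restrict (φ '' Ω)),
            AreEigenfunctions bc A Ω φ lam n m ψ →
            ∃ ψt : Fin m → Lp ℂ 2 (volume.restrict (φt '' Ω)),
              AreEigenfunctions bc A Ω φt lamt n m ψt ∧
              ∀ j, EigenfunctionEstimate A Ω φ φt q₀ s c (ψ j) (ψt j)) := by
  -- A block forces 0 ≤ `lamVal` < `lamNext`; otherwise both claims are vacuous and any constant
  -- will do.
  by_cases hv : 0 ≤ lamVal ∧ lamVal < lamNext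
  swap
  · refine ⟨1, one_pos, ?_⟩
    intro N _ U hU _ _ A θ hA φ φt _ _ _ _ _ _ lam lamt lamh hl hlt _ _ _ _ _ _ _ _ _ _ n m
    exact ⟨fun hb => absurd ⟨(hb.bounds hA hl).1, (hb.bounds hA hl).2.1⟩ hv,
      fun hb => absurd ⟨(hb.bounds hA hlt).1, (hb.bounds hA hlt).2.1⟩ hv⟩
  obtain ⟨hv0, hvn⟩ := hv
  have hΛ0 : 0 ≤ lamNext + 1 := by linarith
  have hn0 : 0 < lamNext := by linarith
  -- `M` bounds the positions of all non-zero eigenvalues up to `lamNext` + 1 for the three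
  -- operators, hence multiplicities and the length of the block. The extra 1 is the room used in
  -- `eigenvalue_close`.
  obtain ⟨M, hM⟩ := exists_nat_gt (((lamNext + 1) / C₁) ^ α)
  obtain ⟨C, ε₀, hC, hε₀, hstab⟩ := exists_eigenvector_stability_const (lamPrev := lamPrev) hv0 hvn M
  -- The bound from (P1) for a normalized eigenfunction with eigenvalue `lamNext`, which is
  -- positive. This is the unit vector that serves to estimate constants.
  set B := C₂ * lamNext ^ γ with hB
  set K := M * (C₂ * (lamNext + 1) ^ γ) + M * (C₂ * (lamNext + 1) ^ (1 / 2 + γ)) + 2 * B with hK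
  have hB0 : 0 ≤ B := by positivity
  have hK0 : 0 ≤ K := by positivity
  obtain ⟨c, hc⟩ : ∃ c : ℝ≥0, (c : ℝ) = 2 + 2 * B + K / ε₀ + 2 * (C * K) :=
    ⟨⟨2 + 2 * B + K / ε₀ + 2 * (C * K), by positivity⟩, rfl⟩
  have hc1 : 1 ≤ c := by
    rw [← NNReal.coe_le_coe, hc, NNReal.coe_one]
    have h1 : 0 ≤ K / ε₀ := by positivity
    have h2 : 0 ≤ C * K := by positivity
    linarith
  refine ⟨c, one_pos.trans_le hc1, ?_⟩
  intro N _ U hU hconn _ A θ hA φ φt h ht _ hcL hcLt hcT lam lamt lamh hl hlt hlh hg hgt hgh hP1 hP2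
    hP1h hP2h hP1t hsmall n m
  obtain ⟨δ, hδ0, hδ, hδB, hδε, hδr⟩ := exists_real_of_le_inv
    (vicinity_le_vicinityFactor A U φ φt q₀ s) hsmall hB0 hK0 hC hε₀ hc
  obtain ⟨R⟩ := nonempty_formRealization (bc := bc) hU h ht hA
  have iL := R.intertwines hU h hA
  have iLt := R.intertwines' hU h ht hA
  have gH := R.isFormGraph_opH
  have gT := R.isFormGraph_opTST
  have gW := R.isFormGraph_opWHW hU h ht
  have hq := R.isNonnegForm hA
  have hq' := R.isNonnegForm' hA
  have lH := iL.isEigenvalueSeq hl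
  have lW := iLt.isEigenvalueSeq hlt
  obtain ⟨ψH, hψH, hψHb⟩ := hP1.exists_eigenfunctionSeq lH
  obtain ⟨ψW, hψW, hψWb⟩ := hP1t.exists_eigenfunctionSeq lW
  obtain ⟨ψT, hψT, -⟩ := hP1h.exists_eigenfunctionSeq hlh
  obtain ⟨e, -, he⟩ := gH.exists_isEigenbasis hq (fun f => R.embed_dense hU h)
    (iL.hasCompactResolvent hcL) lH hψH
  obtain ⟨e', -, he'⟩ := gW.exists_isEigenbasis hq' (fun f => R.embed'_dense hU h ht)
    (iLt.hasCompactResolvent hcLt) lW hψW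
  obtain ⟨eh, -, heh⟩ := gT.exists_isEigenbasis hq' (fun f => R.embed_dense hU h) hcT hlh hψT
  have bd : ∀ k, lam k ≠ 0 → lam k ≤ lamNext + 1 → k + 1 < M :=
    fun k => hg.lt_of_le hα hC₁ hM
  have bdt : ∀ k, lamt k ≠ 0 → lamt k ≤ lamNext + 1 → k + 1 < M :=
    fun k => hgt.lt_of_le hα hC₁ hM
  have bdh : ∀ k, lamh k ≠ 0 → lamh k ≤ lamNext + 1 → k + 1 < M :=
    fun k => hgh.lt_of_le hα hC₁ hM
  -- The unit vector is left open because it is taken from the operator that carries the block: H in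
  -- the first case, w⁻¹H̃w in the second.
  have close : ∀ {u : Lp ℂ 2 (weightedMeasure U φ)}, ‖u‖ = 1 →
      eLpNorm u q₀ (weightedMeasure U φ) ≤ ENNReal.ofReal B →
      IsClose R.form R.form' R.embed R.embed' (lamNext + 1) (K * δ) := fun hu hub =>
    isClose_gradientForm hU hconn h ht hA hq₀ hγ hC₂ hΛ0 (R.coe_embed' hU ht) lH lW hlh gH gT gW
      hP1 hP2 hP2h hP1t bd bdt bdh hu hB0 hub hδ0 hδ hδB
  have hKδ : 0 ≤ K * δ := by positivity
  constructor
  · rintro hb ψt ⟨hψo, hψe⟩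
    have hcl := close (hψH.1.1 (n + m)) (by
      have := hψHb (n + m) (by rw [hb.next]; exact hn0.ne')
      rwa [hb.next] at this)
    -- Position n + m carries the non-zero value `lamNext`, so the growth bound applies there even
    -- if zero eigenvalues occur earlier.
    have hnm : n + m < M := by
      have := bd (n + m) (by rw [hb.next]; exact hn0.ne') (by rw [hb.next]; linarith)
      omega
    obtain ⟨v, hv1, hv2, hv3⟩ := iLt.exists_formEigen gW hψo hψe
    obtain ⟨y, hy1, hy2, hy3⟩ := (hstab hq hq' he he' heh hKδ hδε hcl hnm (hb.bounds hA hl).2.2).1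
      ⟨hb.eq, hb.prev, hb.next⟩ v hv2 hv3
    refine ⟨fun j => R.W.symm (y j), ⟨hy1.comp_linearIsometryEquiv R.W.symm, fun j => ?_⟩, fun j =>
      eigenfunctionEstimate_of_norm_le hU h ht R.coe_W R.coe_Wt R.coe_W' hc1 hδr ?_⟩
    · rw [hb.eq _ (by omega) (by omega)]
      exact iL.symm_mem_eigenspace gH he hb.eq (hy2 j)
    · rw [R.W.apply_symm_apply]
      have := hy3 j
      rwa [hv1] at this
  · rintro hb ψ ⟨hψo, hψe⟩
    have hcl := close (hψW.1.1 (n + m)) (by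
      have := hψWb (n + m) (by rw [hb.next]; exact hn0.ne')
      rwa [hb.next] at this)
    have hnm : n + m < M := by
      have := bdt (n + m) (by rw [hb.next]; exact hn0.ne') (by rw [hb.next]; linarith)
      omega
    obtain ⟨v, hv1, hv2, hv3⟩ := iL.exists_formEigen gH hψo hψe
    obtain ⟨y, hy1, hy2, hy3⟩ := (hstab hq hq' he he' heh hKδ hδε hcl hnm (hb.bounds hA hlt).2.2).2
      ⟨hb.eq, hb.prev, hb.next⟩ v hv2 hv3
    refine ⟨fun j => (R.Wt.trans R.W').symm (y j),
      ⟨hy1.comp_linearIsometryEquiv (R.Wt.trans R.W').symm, fun j => ?_⟩, fun j =>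
      eigenfunctionEstimate_of_norm_le hU h ht R.coe_W R.coe_Wt R.coe_W' hc1 hδr ?_⟩
    · rw [hb.eq _ (by omega) (by omega)]
      exact iLt.symm_mem_eigenspace gW he' hb.eq (hy2 j)
    -- The estimate is symmetric under exchange of the given and the constructed function, but its
    -- statement has the function on φ(Ω) first.
    · have h1 := hy3 j
      rw [hv1, norm_sub_rev] at h1
      have h2 : R.W' (R.Wt ((R.Wt.trans R.W').symm (y j))) = y j :=
        (R.Wt.trans R.W').apply_symm_apply (y j)
      rwa [h2]
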